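/- **Setting.** For a finite positive Borel measure $\mu$ on $\mathbb{C}$ write $U^\mu(z)=\int \log\frac{1}{|z-w|}\,\mu(dw)$ and $\|\mu\|=\mu(\mathbb{C})$. For $V:\mathbb{C}\to\mathbb{R}\cup\{+\infty\}$ let $\Sigma_V=\overline{\{V<\infty\}}$. An equilibrium measure $\mu_V$ of $V$ is a minimizer of $$I_V(\mu)=\iint\log\frac{1}{|z-w|}\,\mu(dz)\,\mu(dw)+\int V\,d\mu=\iint\Big(\log\frac{1}{|z-w|}+\tfrac12V(z)+\tfrac12V(w)\Big)\mu(dz)\,\mu(dw)$$ over the Borel probability measures $\mu$ on $\Sigma_V$, where the last expression is the definition when the two terms of the first one are not separately defined. Its support is denoted $S_V$. Let $\mathbb{D}$ be the open unit disk, let $\rho,\alpha,t>0$, and let $s$ be the arclength measure on $\partial\rho\mathbb{D}$. For $z\in\partial\rho\mathbb{D}$ let $\bar n=z/|z|$ and $$\partial_n^-f(z)=\lim_{\varepsilon\downarrow0}\frac{f(z)-f(z-\varepsilon\bar n)}{\varepsilon}.$$ Let $\|\cdot\|_{\infty,\partial\rho\mathbb{D}}\in[0,\infty]$ denote the essential supremum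 norm with respect to $s$. Let $V:\mathbb{C}\to\mathbb{R}\cup\{+\infty\}$ be lower semicontinuous with $$\liminf_{|z|\to\infty}\big(V(z)-(2+\epsilon)\log|z|\big)=+\infty\quad\text{for some }\epsilon>0,$$ and let $\mu_V$ be its equilibrium measure. Assume that $S_V=\rho\overline{\mathbb{D}}$, that on $\rho\overline{\mathbb{D}}$ the potential $V$ agrees with a real function on $\mathbb{C}$ that is differentiable with locally Lipschitz derivative, and that $\frac1{4\pi}\Delta V\ge\alpha$ almost everywhere in $\rho\mathbb{D}$. Let $\nu$ be a finite positive Borel measure on $\mathbb{C}$ with $\operatorname{supp}\nu\cap\rho\mathbb{D}=\emptyset$ and $\int\log(1+|w|)\,\nu(dw)<\infty$. Let $R$ be a real function that is continuous on $\rho\overline{\mathbb{D}}$, harmonic in $\rho\mathbb{D}$, and for which the (finite) derivative $\partial_n^-R(z)$ exists at every $z\in\partial\rho\mathbb{D}$. Put $$W(z)=\begin{cases}tV(z)+2U^\nu(z)+2R(z),& |z|\le\rho,\\ +\infty,&|z|>\rho,\end{cases}$$ and let $\mu_W$ be the equilibrium measure of $W$. **Proposition.** Assume in addition that $\mu_V$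 is absolutely continuous with respect to the two-dimensional Lebesgue measure. Then $\mu_W=\mu+\eta$ with positive measures $\mu,\eta$ such that $\mu$ is absolutely continuous with respect to $\mu_V$, and $\eta$ is absolutely continuous with respect to $s$ with $$\rho\,\Big\|\frac{d\eta}{ds}\Big\|_{\infty,\partial\rho\mathbb{D}}\le\frac1{2\pi}\Big(\|\eta\|+\|\nu\|+2\rho\,\|\partial_n^-R\|_{\infty,\partial\rho\mathbb{D}}+|1-t|\,\rho\,\|\partial_n^-V\|_{\infty,\partial\rho\mathbb{D}}\Big).$$ -/

import Mathlib

open MeasureTheory Filter Topology Metric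
open scoped ENNReal NNReal

noncomputable section

namespace LogPotential

/-- The integral of an extended-real function: integral of the positive part minus integral of
the negative part. It has its usual meaning whenever one of the two is finite. -/
def eintegral {X : Type*} [MeasurableSpace X] (μ : Measure X) (f : X → EReal) : EReal :=
  ((∫⁻ x, (f x).toENNReal ∂μ : ℝ≥0∞) : EReal) - ((∫⁻ x, (-f x).toENNReal ∂μ : ℝ≥0∞) : EReal)

open Classical in
/-- The kernel `log (1 / |z - w|)`, equal to `+∞` on the diagonal. -/
def logKernel (z w : ℂ) : EReal :=
  if z = w then ⊤ else ((-Real.log ‖z - w‖ : ℝ) : EReal)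

/-- The logarithmic potential `U^μ(z) = ∫ log (1 / |z - w|) μ(dw)`. -/
def potential (μ : Measure ℂ) (z : ℂ) : EReal :=
  eintegral μ (fun w => logKernel z w)

/-- The weighted logarithmic energy
`I_V(μ) = ∬ log (1 / |z - w|) μ(dz) μ(dw) + ∫ V dμ` of a probability measure, with the two terms
written as one double integral of `log (1 / |z - w|) + V(z) / 2 + V(w) / 2`: for potentials that
grow faster than `2 log |z|` this integrand is bounded below, so that the energy is defined in
`(-∞, +∞]` for every probability measure. -/
def energy (V : ℂ → EReal) (μ : Measure ℂ) : EReal :=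
  eintegral (μ.prod μ) (fun p =>
    logKernel p.1 p.2 + ((1 / 2 : ℝ) : EReal) * V p.1 + ((1 / 2 : ℝ) : EReal) * V p.2)

/-- The set `Σ_V`, the closure of the set where `V` is finite. -/
def finitenessSet (V : ℂ → EReal) : Set ℂ := closure {z | V z < ⊤}

/-- `μ` is a Borel probability measure supported on the set `S`. -/
def IsProbabilityOn (S : Set ℂ) (μ : Measure ℂ) : Prop :=
  IsProbabilityMeasure μ ∧ μ Sᶜ = 0

/-- `μ` minimizes the weighted logarithmic energy among the probability measures on `Σ_V`. -/
def IsEquilibriumMeasure (V : ℂ → EReal) (μ : Measure ℂ) : Prop :=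
  IsProbabilityOn (finitenessSet V) μ ∧
    ∀ μ' : Measure ℂ, IsProbabilityOn (finitenessSet V) μ' → energy V μ ≤ energy V μ'

/-- The growth condition `liminf_{|z| → ∞} (V(z) - (2 + ε) log |z|) = +∞` for some `ε > 0`. -/
def HasGrowth (V : ℂ → EReal) : Prop :=
  ∃ ε : ℝ, 0 < ε ∧
    liminf (fun z : ℂ => V z - (((2 + ε) * Real.log ‖z‖ : ℝ) : EReal)) (cocompact ℂ) = ⊤

/-- The extended-real function `V` is finite and of class `C^{1,1}` on `S`: it agrees on `S` with a
real function on the plane that is differentiable with locally Lipschitz derivative. -/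
def IsC11On (V : ℂ → EReal) (S : Set ℂ) : Prop :=
  ∃ g : ℂ → ℝ, Differentiable ℝ g ∧ LocallyLipschitz (fderiv ℝ g) ∧ ∀ z ∈ S, V z = (g z : EReal)

/-- The perturbed potential: `t V + 2 U^ν + 2 R` on the closed disk of radius `ρ`, and `+∞`
outside it. -/
def perturbed (ρ t : ℝ) (V : ℂ → EReal) (ν : Measure ℂ) (R : ℂ → ℝ) (z : ℂ) : EReal :=
  open Classical in
  if z ∈ closedBall (0 : ℂ) ρ then
    (t : EReal) * V z + 2 * potential ν z + 2 * (R z : EReal)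
  else ⊤

/-- `f` has derivative `d` at the boundary point `z` of a disk centred at the origin, in the
direction of the outer unit normal `z / |z|`, taken from inside the disk. -/
def HasInnerNormalDeriv (f : ℂ → ℝ) (d : ℝ) (z : ℂ) : Prop :=
  Tendsto (fun ε : ℝ => (f z - f (z - (ε : ℂ) * (z / (‖z‖ : ℂ)))) / ε) (𝓝[>] 0) (𝓝 d)

open Classical in
/-- The one-sided normal derivative `∂_n^- f (z)` (zero where it does not exist). -/
def innerNormalDeriv (f : ℂ → ℝ) (z : ℂ) : ℝ :=
  if h : ∃ d : ℝ, HasInnerNormalDeriv f d z then h.choose else 0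

/-- The arclength measure on the circle of radius `ρ` centred at the origin. -/
def arclength (ρ : ℝ) : Measure ℂ :=
  ENNReal.ofReal ρ • Measure.map (circleMap 0 ρ) (volume.restrict (Set.Ioc 0 (2 * Real.pi)))

end LogPotential

end

/-! On the closed disk `log (1 / |z - w|)` is the nonnegative kernel `logk (2 * ρ)` minus a
constant, and both external fields are nonnegative up to constants. The equilibrium measures
therefore minimize `fieldEnergy`, with values in `ℝ≥0∞`. All information about them comes from one
first-order condition, `ae_fieldPotential_le_of_isMin`: at almost every point the field `G = 2 U^μ +
u` is at most its mean over any admissible displacement of the point.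

For `V`, whose support is the whole disk, this yields the Euler-Lagrange equation `G = c` in the
open disk, and on the circle almost everywhere for every measure of finite energy
(`exists_const_of_isEquilibriumMeasure`). The `C^{1,1}` bound makes the density of `μV` bounded.

Inside the disk, each point of `μW` is spread over a small circle around it. The contributions of
`ν` and `R` are harmonic and drop out. By the Riesz-type formula what is left says that the
potential of `μW` truncated at the radius `δ` is at most `t` times that of `μV`. Since truncated
potentials are weighted integrals of the masses of small balls, differentiation of measures gives
`μW ≤ t μV` on the open disk (`restrict_ball_le_smul`). So `μ` is the part of `μW` in the open disk,
`η` its part on the circle, and `t μV = μ + κ` with `κ` positive of bounded density.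

On the circle, `z` is moved to `l z` with `l < 1`. By the Euler-Lagrange equation, `t V` cancels
against the potential of `t μV = μ + κ`, which leaves the increments of the potentials of `η`, `ν`,
`κ` and of `R`. The first two gain at most `log (1 / l) / 2` per unit of mass, `κ` contributes `o(1
- l)`, and `η` loses the integral of `log (1 + a ^ 2 / |z - w| ^ 2) / 2`, where `a` is asymptotic to
`(1 - l) ρ`. If `η` has lower density `m` at `z`, this loss is about `π m a`. Division by `1 - l`
gives `2 π ρ m ≤ ‖η‖ + ‖ν‖ - 2 ρ ∂R` (`density_le_of_radial_le`). Differentiation of measures turns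
this into absolute continuity and the bound on the density, even without the term in `|1 - t|`. -/

namespace LogPotential

/-- The mutual energy `∬ K(x, y) a(dx) b(dy)` of two measures for a nonnegative kernel `K`. -/
noncomputable def mutualEnergy (K : ℂ → ℂ → ℝ≥0∞) (a b : Measure ℂ) : ℝ≥0∞ :=
  ∫⁻ x, ∫⁻ y, K x y ∂b ∂a

/-- The energy of a measure for a nonnegative kernel and a nonnegative external field. -/
noncomputable def fieldEnergy (K : ℂ → ℂ → ℝ≥0∞) (u : ℂ → ℝ≥0∞) (a : Measure ℂ) : ℝ≥0∞ :=
  mutualEnergy K a a + ∫⁻ x, u x ∂a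

/-- The gradient of the energy: twice the potential of `a` plus the external field. -/
noncomputable def fieldPotential (K : ℂ → ℂ → ℝ≥0∞) (u : ℂ → ℝ≥0∞) (a : Measure ℂ) (x : ℂ) :
    ℝ≥0∞ :=
  2 * ∫⁻ y, K x y ∂a + u x

/-! ### First-order conditions for minimizers of a nonnegative energy -/

section Variational

variable {K : ℂ → ℂ → ℝ≥0∞} {u : ℂ → ℝ≥0∞}

theorem measurable_kernel_lintegral (hK : Measurable (Function.uncurry K)) (a : Measure ℂ)
    [SFinite a] : Measurable fun x => ∫⁻ y, K x y ∂a :=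
  Measurable.lintegral_prod_right' (f := Function.uncurry K) hK

theorem measurable_fieldPotential (hK : Measurable (Function.uncurry K)) (hu : Measurable u)
    (a : Measure ℂ) [SFinite a] : Measurable (fieldPotential K u a) :=
  ((measurable_kernel_lintegral hK a).const_mul 2).add hu

theorem mutualEnergy_add_left (a b c : Measure ℂ) :
    mutualEnergy K (a + b) c = mutualEnergy K a c + mutualEnergy K b c := by
  simp [mutualEnergy]

theorem mutualEnergy_smul_left (r : ℝ≥0∞) (a c : Measure ℂ) :
    mutualEnergy K (r • a) c = r * mutualEnergy K a c := by
  simp [mutualEnergy]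

theorem mutualEnergy_comm (hK : Measurable (Function.uncurry K)) (hsymm : ∀ x y, K x y = K y x)
    (a b : Measure ℂ) [SFinite a] [SFinite b] : mutualEnergy K a b = mutualEnergy K b a := by
  unfold mutualEnergy
  rw [lintegral_lintegral_swap hK.aemeasurable]
  simp_rw [hsymm]

theorem mutualEnergy_mono {a a' b b' : Measure ℂ} (ha : a ≤ a') (hb : b ≤ b') :
    mutualEnergy K a b ≤ mutualEnergy K a' b' :=
  lintegral_mono' ha fun _ => lintegral_mono' hb le_rfl

theorem lintegral_fieldPotential (hK : Measurable (Function.uncurry K)) (hu : Measurable u)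
    (a b : Measure ℂ) [SFinite a] :
    ∫⁻ x, fieldPotential K u a x ∂b = 2 * mutualEnergy K b a + ∫⁻ x, u x ∂b := by
  unfold fieldPotential mutualEnergy
  rw [lintegral_add_right _ hu, lintegral_const_mul _ (measurable_kernel_lintegral hK a)]

/-- Divide by `ε` and let `ε` tend to zero: this extracts the first variation from a quadratic
expansion of the energy. -/
theorem le_of_forall_quadratic {p q c : ℝ}
    (h : ∀ ε : ℝ, 0 < ε → ε ≤ 1 → 0 ≤ ε * (q - p) + ε ^ 2 * c) : p ≤ q := by
  by_contra! hlt
  have hd : 0 < p - q := by linarith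
  have hc : 0 < |c| + 1 := by positivity
  set ε := min 1 ((p - q) / (2 * (|c| + 1))) with hε
  have hε0 : 0 < ε := lt_min one_pos (by positivity)
  have h1 := h ε hε0 (min_le_left _ _)
  have h2 : ε * (|c| + 1) ≤ (p - q) / 2 := by
    have : ε ≤ (p - q) / (2 * (|c| + 1)) := min_le_right _ _
    rw [le_div_iff₀ (by positivity)] at this
    linarith
  have h3 : ε * c ≤ ε * (|c| + 1) := by
    apply mul_le_mul_of_nonneg_left _ hε0.le
    linarith [le_abs_self c]
  have h4 : 0 ≤ ε * ((q - p) + ε * c) := by nlinarith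
  have h5 := nonneg_of_mul_nonneg_right h4 hε0
  linarith

/-- First-order condition at a minimizer: moving a part `τ` of the minimizer to a measure `τ'` of
finite energy and of the same mass does not decrease the integral of the field potential. -/
theorem lintegral_fieldPotential_le_of_isMin (hK : Measurable (Function.uncurry K))
    (hsymm : ∀ x y, K x y = K y x) (hu : Measurable u) {S : Set ℂ} {μ σ τ τ' : Measure ℂ}
    [IsFiniteMeasure σ] [IsFiniteMeasure τ] [IsFiniteMeasure τ']
    (hμ : IsProbabilityOn S μ) (hsum : μ = σ + τ)
    (hmass : τ' Set.univ = τ Set.univ) (hτ' : τ' Sᶜ = 0) (hfin : fieldEnergy K u μ ≠ ⊤)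
    (hE : mutualEnergy K τ' τ' ≠ ⊤)
    (hmin : ∀ μ', IsProbabilityOn S μ' → fieldEnergy K u μ ≤ fieldEnergy K u μ') :
    ∫⁻ x, fieldPotential K u μ x ∂τ ≤ ∫⁻ x, fieldPotential K u μ x ∂τ' := by
  have : SFinite μ := by rw [hsum]; infer_instance
  -- Outside this trivial case all mixed energies are finite, so the expansion below can be carried
  -- out in `ℝ`.
  by_cases hτfin : ∫⁻ x, fieldPotential K u μ x ∂τ' = ⊤
  · rw [hτfin]; exact le_top
  rw [lintegral_fieldPotential hK hu] at hτfin ⊢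
  rw [lintegral_fieldPotential hK hu]
  have c1 := mutualEnergy_comm hK hsymm σ τ
  have c2 := mutualEnergy_comm hK hsymm σ τ'
  have c3 := mutualEnergy_comm hK hsymm τ τ'
  have addr : ∀ a b c : Measure ℂ, SFinite a → SFinite b → SFinite c →
      mutualEnergy K a (b + c) = mutualEnergy K a b + mutualEnergy K a c := by
    intro a b c _ _ _
    rw [mutualEnergy_comm hK hsymm, mutualEnergy_add_left, mutualEnergy_comm hK hsymm b,
      mutualEnergy_comm hK hsymm c]
  have smulr : ∀ (r : ℝ≥0∞) (a b : Measure ℂ), SFinite a → SFinite b →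
      mutualEnergy K a (r • b) = r * mutualEnergy K a b := by
    intro r a b _ _
    rw [mutualEnergy_comm hK hsymm, mutualEnergy_smul_left, mutualEnergy_comm hK hsymm b]
  have hJ : fieldEnergy K u μ = mutualEnergy K σ σ + 2 * mutualEnergy K σ τ + mutualEnergy K τ τ
      + (∫⁻ x, u x ∂σ + ∫⁻ x, u x ∂τ) := by
    unfold fieldEnergy
    rw [hsum, lintegral_add_measure, mutualEnergy_add_left, addr _ _ _ inferInstance inferInstance
      inferInstance, addr _ _ _ inferInstance inferInstance inferInstance, ← c1]
    ring
  have hJ' : ∀ ε : ℝ≥0∞, ∀ ε' : ℝ≥0∞, fieldEnergy K u (σ + ε' • τ + ε • τ') =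
      mutualEnergy K σ σ + 2 * ε' * mutualEnergy K σ τ + 2 * ε * mutualEnergy K σ τ'
      + ε' ^ 2 * mutualEnergy K τ τ + 2 * ε * ε' * mutualEnergy K τ τ'
      + ε ^ 2 * mutualEnergy K τ' τ'
      + (∫⁻ x, u x ∂σ + ε' * ∫⁻ x, u x ∂τ + ε * ∫⁻ x, u x ∂τ') := by
    intro ε ε'
    unfold fieldEnergy
    rw [lintegral_add_measure, lintegral_add_measure, lintegral_smul_measure,
      lintegral_smul_measure]
    simp only [mutualEnergy_add_left, mutualEnergy_smul_left,
      addr _ _ _ inferInstance inferInstance inferInstance,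
      smulr _ _ _ inferInstance inferInstance, ← c1, ← c2, ← c3, smul_eq_mul]
    ring
  have m1 : mutualEnergy K τ μ = mutualEnergy K σ τ + mutualEnergy K τ τ := by
    rw [hsum, addr _ _ _ inferInstance inferInstance inferInstance, c1]
  have m2 : mutualEnergy K τ' μ = mutualEnergy K σ τ' + mutualEnergy K τ τ' := by
    rw [hsum, addr _ _ _ inferInstance inferInstance inferInstance, c2, c3]
  rw [m2] at hτfin ⊢
  rw [m1]
  rw [hJ] at hfin hmin
  simp only [ENNReal.add_eq_top, ENNReal.mul_eq_top, not_or, ne_eq, OfNat.ofNat_ne_zero,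
    not_false_eq_true, true_and, ENNReal.ofNat_ne_top, false_and, or_false] at hfin hτfin
  obtain ⟨⟨⟨hss, hst⟩, htt⟩, hus, hut⟩ := hfin
  obtain ⟨⟨hst', htt'⟩, hut'⟩ := hτfin
  have hmin' : ∀ ε : ℝ≥0, ∀ ε' : ℝ≥0, ε + ε' = 1 → _ := fun ε ε' hεε => by
    have hp : IsProbabilityOn S (σ + (ε' : ℝ≥0∞) • τ + (ε : ℝ≥0∞) • τ') := by
      have hz := hμ.2
      rw [hsum] at hz
      simp only [Measure.coe_add, Pi.add_apply, add_eq_zero] at hz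
      refine ⟨⟨?_⟩, ?_⟩
      · have h1 := hμ.1.measure_univ
        rw [hsum] at h1
        simp only [Measure.coe_add, Pi.add_apply, Measure.coe_smul, Pi.smul_apply, smul_eq_mul,
          hmass] at h1 ⊢
        rw [add_assoc, ← add_mul, ← ENNReal.coe_add, add_comm ε' ε, hεε]
        simpa using h1
      · simp [hz.1, hz.2, hτ']
    have := hmin _ hp
    rw [hJ'] at this
    exact this
  lift mutualEnergy K σ σ to ℝ≥0 using hss with ss
  lift mutualEnergy K σ τ to ℝ≥0 using hst with st
  lift mutualEnergy K τ τ to ℝ≥0 using htt with tt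
  lift mutualEnergy K σ τ' to ℝ≥0 using hst' with st'
  lift mutualEnergy K τ τ' to ℝ≥0 using htt' with tt'
  lift mutualEnergy K τ' τ' to ℝ≥0 using hE with t't'
  lift ∫⁻ x, u x ∂σ to ℝ≥0 using hus with us
  lift ∫⁻ x, u x ∂τ to ℝ≥0 using hut with ut
  lift ∫⁻ x, u x ∂τ' to ℝ≥0 using hut' with ut'
  -- The competitor is `σ + (1 - ε) τ + ε τ'`. The coefficient of `ε ^ 2` is the energy of `τ' - τ`,
  -- finite because of `hE`.
  have key : (2 * (st + tt) + ut : ℝ) ≤ 2 * (st' + tt') + ut' := by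
    apply le_of_forall_quadratic (c := tt - 2 * tt' + t't')
    intro ε h0 h1
    lift ε to ℝ≥0 using h0.le
    have h1' : ε ≤ 1 := by exact_mod_cast h1
    have h2 := hmin' ε (1 - ε) (add_tsub_cancel_of_le h1')
    norm_cast at h2
    rw [← NNReal.coe_le_coe] at h2
    push_cast [NNReal.coe_sub h1'] at h2
    have h3 : (ss + 2 * st + tt + (us + ut) : ℝ) ≤ ss + 2 * (1 - ε) * st + 2 * ε * st'
      + (1 - ε) ^ 2 * tt + 2 * ε * (1 - ε) * tt' + ε ^ 2 * t't'
      + (us + (1 - ε) * ut + ε * ut') := by linarith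
    linarith
  exact_mod_cast key

/-- Pointwise form of the first-order condition: for almost every point of a set the field
potential is at most its mean over the random displacement `T x` of that point. -/
theorem ae_fieldPotential_le_of_isMin (hK : Measurable (Function.uncurry K))
    (hsymm : ∀ x y, K x y = K y x) (hu : Measurable u) {S : Set ℂ} {μ : Measure ℂ}
    (hμ : IsProbabilityOn S μ) (hfin : fieldEnergy K u μ ≠ ⊤)
    (hmin : ∀ μ', IsProbabilityOn S μ' → fieldEnergy K u μ ≤ fieldEnergy K u μ')
    {A : Set ℂ} (hA : MeasurableSet A) (hS : MeasurableSet S) {Ω : Type*} [MeasurableSpace Ω]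
    {P : Measure Ω} [IsProbabilityMeasure P] {T : ℂ × Ω → ℂ} (hT : Measurable T)
    (hTS : ∀ x ∈ A, ∀ ω, T (x, ω) ∈ S)
    (hE : ∀ τ : Measure ℂ, IsFiniteMeasure τ → τ Aᶜ = 0 → mutualEnergy K τ τ ≠ ⊤ →
      mutualEnergy K ((τ.prod P).map T) ((τ.prod P).map T) ≠ ⊤) :
    ∀ᵐ x ∂μ, x ∈ A → fieldPotential K u μ x ≤ ∫⁻ ω, fieldPotential K u μ (T (x, ω)) ∂P := by
  have := hμ.1
  set G := fieldPotential K u μ with hG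
  have hGm : Measurable G := measurable_fieldPotential hK hu μ
  have hGT : Measurable fun x => ∫⁻ ω, G (T (x, ω)) ∂P :=
    Measurable.lintegral_prod_right' (f := fun p => G (T p)) (hGm.comp hT)
  -- If the exceptional set had positive mass, displacing only the part of `μ` on it would lower the
  -- energy to first order.
  set B := {x | x ∈ A ∧ ∫⁻ ω, G (T (x, ω)) ∂P < G x} with hB
  have hBm : MeasurableSet B := hA.inter (measurableSet_lt hGT hGm)
  have hJμ : mutualEnergy K μ μ ≠ ⊤ := ne_top_of_le_ne_top hfin le_self_add
  have hfinG : ∫⁻ x, G x ∂μ ≠ ⊤ := by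
    rw [lintegral_fieldPotential hK hu]
    have : ∫⁻ x, u x ∂μ ≠ ⊤ := ne_top_of_le_ne_top hfin le_add_self
    finiteness
  have h0 : μ B = 0 := by
    by_contra hne
    set τ := μ.restrict B with hτ
    have hprod : (τ.prod P).map T Set.univ = τ Set.univ := by
      rw [Measure.map_apply hT MeasurableSet.univ, Set.preimage_univ, Measure.prod_apply
        MeasurableSet.univ]
      simp
    have hTz : (τ.prod P).map T Sᶜ = 0 := by
      rw [Measure.map_apply hT hS.compl, Measure.prod_apply (hT hS.compl), lintegral_eq_zero_iff
        (measurable_measure_prodMk_left (hT hS.compl)), hτ]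
      rw [Filter.EventuallyEq, ae_restrict_iff' hBm]
      refine Eventually.of_forall fun x hx => ?_
      have : Prod.mk x ⁻¹' (T ⁻¹' Sᶜ) = ∅ := by
        ext ω
        simpa using hTS x hx.1 ω
      change P (Prod.mk x ⁻¹' (T ⁻¹' Sᶜ)) = 0
      rw [this, measure_empty]
    have hτA : τ Aᶜ = 0 := by
      rw [hτ, Measure.restrict_apply hA.compl]
      convert measure_empty (μ := μ)
      ext x
      simp only [Set.mem_inter_iff, Set.mem_compl_iff, Set.mem_empty_iff_false, iff_false]
      exact fun h => h.1 h.2.1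
    have hEτ := hE τ inferInstance hτA (ne_top_of_le_ne_top hJμ
      (mutualEnergy_mono Measure.restrict_le_self Measure.restrict_le_self))
    have hle := lintegral_fieldPotential_le_of_isMin hK hsymm hu hμ
      (σ := μ.restrict Bᶜ) (τ := τ) (by rw [add_comm, hτ, Measure.restrict_add_restrict_compl hBm])
      hprod hTz hfin hEτ hmin
    rw [← hG, lintegral_map hGm hT, lintegral_prod (fun p => G (T p)) (hGm.comp hT).aemeasurable] at hle
    have hlt : ∫⁻ x in B, ∫⁻ ω, G (T (x, ω)) ∂P ∂μ < ∫⁻ x in B, G x ∂μ := by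
      refine lintegral_strict_mono ?_ hGm.aemeasurable.restrict ?_ ?_
      · simpa using hne
      · refine ne_top_of_le_ne_top hfinG (le_trans ?_ (setLIntegral_le_lintegral B G))
        exact setLIntegral_mono hGm fun x hx => hx.2.le
      · exact (ae_restrict_iff' hBm).2 (Eventually.of_forall fun x hx => hx.2)
    exact absurd hle (not_le.2 hlt)
  rw [← compl_mem_ae_iff] at h0
  filter_upwards [h0] with x hx hxA
  by_contra! hlt
  exact hx ⟨hxA, hlt⟩

end Variational

/-! ### Extended integrals of a nonnegative function minus an integrable one -/

section ExtendedIntegral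

variable {X : Type*} [MeasurableSpace X]

theorem eintegral_congr_ae {μ : Measure X} {f g : X → EReal} (h : f =ᵐ[μ] g) :
    eintegral μ f = eintegral μ g := by
  unfold eintegral
  congr 2
  · exact lintegral_congr_ae (h.mono fun x hx => by simp [hx])
  · exact lintegral_congr_ae (h.mono fun x hx => by simp [hx])

/-- The identity `(f - b)⁺ + b = (b - f)⁺ + f` is integrated. Since `(b - f)⁺ ≤ b` is integrable, no
`∞ - ∞` occurs. -/
theorem eintegral_coe_sub {μ : Measure X} {f : X → ℝ≥0∞} (hf : Measurable f) {b : X → ℝ}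
    (hb : Integrable b μ) (hbm : Measurable b) (hb0 : ∀ x, 0 ≤ b x) :
    eintegral μ (fun x => (f x : EReal) - (b x : EReal)) =
      ((∫⁻ x, f x ∂μ : ℝ≥0∞) : EReal) - ((∫ x, b x ∂μ : ℝ) : EReal) := by
  have hbE : ∀ x, ((b x : ℝ) : EReal) = ((ENNReal.ofReal (b x) : ℝ≥0∞) : EReal) := fun x => by
    rw [EReal.coe_ennreal_ofReal, max_eq_left (hb0 x)]
  have h1 : ∀ x, ((f x : EReal) - (b x : EReal)).toENNReal = f x - ENNReal.ofReal (b x) := by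
    intro x
    rw [hbE, EReal.toENNReal_sub (EReal.coe_ennreal_nonneg _)]
    simp
  have h2 : ∀ x, (-((f x : EReal) - (b x : EReal))).toENNReal = ENNReal.ofReal (b x) - f x := by
    intro x
    rw [EReal.neg_sub (by simp) (by simp), add_comm, ← sub_eq_add_neg, hbE,
      EReal.toENNReal_sub (EReal.coe_ennreal_nonneg _)]
    simp
  unfold eintegral
  simp_rw [h1, h2]
  have hbf : ∫⁻ x, ENNReal.ofReal (b x) ∂μ = ENNReal.ofReal (∫ x, b x ∂μ) :=
    (ofReal_integral_eq_lintegral_ofReal hb (Eventually.of_forall hb0)).symm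
  have hfin : ∫⁻ x, (ENNReal.ofReal (b x) - f x) ∂μ ≠ ⊤ := by
    refine ne_top_of_le_ne_top (b := ENNReal.ofReal (∫ x, b x ∂μ)) ENNReal.ofReal_ne_top ?_
    rw [← hbf]
    exact lintegral_mono fun x => tsub_le_self
  have hsum : ∫⁻ x, (f x - ENNReal.ofReal (b x)) ∂μ + ENNReal.ofReal (∫ x, b x ∂μ) =
      ∫⁻ x, (ENNReal.ofReal (b x) - f x) ∂μ + ∫⁻ x, f x ∂μ := by
    rw [← hbf, ← lintegral_add_right _ hbm.ennreal_ofReal, ← lintegral_add_right _ hf]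
    refine lintegral_congr fun x => ?_
    rcases le_total (f x) (ENNReal.ofReal (b x)) with h | h
    · rw [tsub_eq_zero_of_le h, zero_add, tsub_add_cancel_of_le h]
    · rw [tsub_eq_zero_of_le h, zero_add, tsub_add_cancel_of_le h]
  have hbi : ((∫ x, b x ∂μ : ℝ) : EReal) = ((ENNReal.ofReal (∫ x, b x ∂μ) : ℝ≥0∞) : EReal) := by
    rw [EReal.coe_ennreal_ofReal, max_eq_left (integral_nonneg hb0)]
  rw [hbi]
  generalize ∫⁻ x, (f x - ENNReal.ofReal (b x)) ∂μ = p at *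
  generalize ∫⁻ x, f x ∂μ = q at *
  generalize hB : ENNReal.ofReal (∫ x, b x ∂μ) = B at *
  have hBt : B ≠ ⊤ := by rw [← hB]; exact ENNReal.ofReal_ne_top
  lift ∫⁻ x, (ENNReal.ofReal (b x) - f x) ∂μ to ℝ≥0 using hfin with n
  lift B to ℝ≥0 using hBt
  by_cases hp : p = ⊤
  · subst hp
    have : q = ⊤ := by
      by_contra hq
      rw [top_add] at hsum
      exact (ENNReal.add_ne_top.2 ⟨ENNReal.coe_ne_top, hq⟩) hsum.symm
    subst this
    rfl
  · have hq : q ≠ ⊤ := by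
      rintro rfl
      rw [add_top] at hsum
      exact (ENNReal.add_ne_top.2 ⟨hp, ENNReal.coe_ne_top⟩) hsum
    lift p to ℝ≥0 using hp
    lift q to ℝ≥0 using hq
    norm_cast at hsum
    have h3 : (p : ℝ) + B = n + q := by exact_mod_cast hsum
    have h4 : (p : ℝ) - n = q - B := by linarith
    change (((p : ℝ) : EReal) - ((n : ℝ) : EReal)) = ((q : ℝ) : EReal) - ((B : ℝ) : EReal)
    exact_mod_cast h4

end ExtendedIntegral

end LogPotential

/-! ### The truncated logarithmic kernel, circular means and the layer-cake formula -/

namespace LogPotential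

open Classical in
/-- The truncated logarithmic kernel `log⁺ (d / |z - w|)`, equal to `∞` on the diagonal. -/
noncomputable def logk (d : ℝ) (z w : ℂ) : ℝ≥0∞ :=
  if z = w then ⊤ else ENNReal.ofReal (Real.log (d / ‖z - w‖))

theorem logk_of_ne {d : ℝ} {z w : ℂ} (h : z ≠ w) :
    logk d z w = ENNReal.ofReal (Real.log (d / ‖z - w‖)) := if_neg h

@[simp] theorem logk_self (d : ℝ) (z : ℂ) : logk d z z = ⊤ := if_pos rfl

theorem logk_comm (d : ℝ) (z w : ℂ) : logk d z w = logk d w z := by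
  unfold logk
  rw [norm_sub_rev]
  simp only [eq_comm]

theorem measurable_logk {X : Type*} [MeasurableSpace X] {d : X → ℝ} {f g : X → ℂ}
    (hd : Measurable d) (hf : Measurable f) (hg : Measurable g) :
    Measurable fun x => logk (d x) (f x) (g x) := by
  unfold logk
  refine Measurable.ite (measurableSet_eq_fun hf hg) measurable_const ?_
  exact (Real.measurable_log.comp (hd.div (hf.sub hg).norm)).ennreal_ofReal

theorem measurable_uncurry_logk (d : ℝ) : Measurable (Function.uncurry (logk d)) :=
  measurable_logk measurable_const measurable_fst measurable_snd

theorem measurable_potential_logk (d : ℝ) (μ : Measure ℂ) [SFinite μ] :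
    Measurable fun x => ∫⁻ y, logk d x y ∂μ :=
  measurable_kernel_lintegral (measurable_uncurry_logk d) μ

/-- Within distance `d` the truncation at zero has no effect, so the signed kernel is a nonnegative
one up to a constant. -/
theorem logKernel_eq_logk_sub {d : ℝ} (hd : 0 < d) {z w : ℂ} (h : ‖z - w‖ ≤ d) :
    logKernel z w = (logk d z w : EReal) - ((Real.log d : ℝ) : EReal) := by
  by_cases hzw : z = w
  · subst hzw
    simp [logKernel]
  · have hpos : 0 < ‖z - w‖ := norm_pos_iff.2 (sub_ne_zero.2 hzw)
    rw [logk_of_ne hzw, EReal.coe_ennreal_ofReal, max_eq_left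
      (Real.log_nonneg ((one_le_div hpos).2 h)), Real.log_div hd.ne' hpos.ne']
    simp only [logKernel, if_neg hzw]
    rw [← EReal.coe_sub]
    congr 1
    ring

/-- The uniform probability measure on the parameter interval of a circle. -/
noncomputable def circleProb : Measure ℝ :=
  ENNReal.ofReal (2 * Real.pi)⁻¹ • volume.restrict (Set.Ioc 0 (2 * Real.pi))

instance : IsProbabilityMeasure circleProb := by
  constructor
  simp only [circleProb, Measure.smul_apply, smul_eq_mul, Measure.restrict_apply_univ,
    Real.volume_Ioc, sub_zero]
  rw [← ENNReal.ofReal_mul (by positivity), inv_mul_cancel₀ (by positivity), ENNReal.ofReal_one]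

theorem circleProb_absolutelyContinuous : circleProb ≪ volume :=
  (Measure.smul_absolutelyContinuous).trans Measure.absolutelyContinuous_restrict

theorem integral_circleProb (f : ℂ → ℝ) (c : ℂ) (r : ℝ) :
    ∫ θ, f (circleMap c r θ) ∂circleProb = Real.circleAverage f c r := by
  rw [circleProb, integral_smul_measure, Real.circleAverage_def,
    intervalIntegral.integral_of_le (by positivity), ENNReal.toReal_ofReal (by positivity)]

theorem integrable_circleProb {f : ℂ → ℝ} {c : ℂ} {r : ℝ} (hf : CircleIntegrable f c r) :
    Integrable (fun θ => f (circleMap c r θ)) circleProb := by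
  have := (intervalIntegrable_iff_integrableOn_Ioc_of_le (by positivity)).1 hf
  exact Integrable.smul_measure this ENNReal.ofReal_ne_top

theorem ae_circleMap_ne (c w : ℂ) {r : ℝ} (hr : r ≠ 0) :
    ∀ᵐ θ ∂circleProb, circleMap c r θ ≠ w := by
  refine circleProb_absolutelyContinuous.ae_le ?_
  have := ((Set.countable_singleton w).preimage_circleMap c hr).measure_zero volume
  rw [← compl_mem_ae_iff] at this
  filter_upwards [this] with θ hθ h
  exact hθ h

theorem norm_circleMap_sub_le (c w : ℂ) {r : ℝ} (hr : 0 ≤ r) (θ : ℝ) :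
    ‖circleMap c r θ - w‖ ≤ r + ‖c - w‖ := by
  have : circleMap c r θ - w = (circleMap c r θ - c) + (c - w) := by ring
  rw [this]
  refine (norm_add_le _ _).trans ?_
  simp [circleMap, abs_of_nonneg hr]

/-- The mean of `log ‖z - w‖` over the circle is `log (max ‖c - w‖ r)`. The hypothesis on `d` puts
the whole circle within distance `d` of `w`, where the kernel is not truncated. -/
theorem lintegral_circleProb_logk {c w : ℂ} {r d : ℝ} (hr : 0 < r) (hd : r + ‖c - w‖ ≤ d) :
    ∫⁻ θ, logk d (circleMap c r θ) w ∂circleProb =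
      ENNReal.ofReal (Real.log (d / max ‖c - w‖ r)) := by
  have hd0 : 0 < d := lt_of_lt_of_le (by positivity) hd
  have hint : CircleIntegrable (fun z => Real.log ‖z - w‖) c r :=
    circleIntegrable_log_norm_sub_const r
  have hint' : CircleIntegrable (fun z => Real.log d - Real.log ‖z - w‖) c r :=
    (circleIntegrable_const _ _ _).sub hint
  have h1 : ∀ᵐ θ ∂circleProb, logk d (circleMap c r θ) w =
      ENNReal.ofReal ((fun z => Real.log d - Real.log ‖z - w‖) (circleMap c r θ)) := by
    filter_upwards [ae_circleMap_ne c w hr.ne'] with θ hθ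
    rw [logk_of_ne hθ, Real.log_div hd0.ne' (norm_ne_zero_iff.2 (sub_ne_zero.2 hθ))]
  have h2 : ∀ᵐ θ ∂circleProb,
      0 ≤ (fun z => Real.log d - Real.log ‖z - w‖) (circleMap c r θ) := by
    filter_upwards [ae_circleMap_ne c w hr.ne'] with θ hθ
    have := Real.log_le_log (norm_pos_iff.2 (sub_ne_zero.2 hθ))
      ((norm_circleMap_sub_le c w hr.le θ).trans hd)
    linarith
  rw [lintegral_congr_ae h1, ← ofReal_integral_eq_lintegral_ofReal (integrable_circleProb hint') h2,
    integral_circleProb fun z => Real.log d - Real.log ‖z - w‖, Real.circleAverage_fun_sub (circleIntegrable_const _ _ _) hint,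
    Real.circleAverage_const,
    circleAverage_log_norm_sub_const_eq_log_radius_add_posLog hr.ne']
  congr 1
  have hmax : 0 < max ‖c - w‖ r := lt_max_of_lt_right hr
  rw [Real.log_div hd0.ne' hmax.ne']
  congr 1
  rcases le_total ‖c - w‖ r with h | h
  · rw [max_eq_right h, (Real.posLog_eq_zero_iff _).2, add_zero]
    rw [abs_of_nonneg (by positivity), inv_mul_le_iff₀ hr]
    simpa using h
  · rw [max_eq_left h, Real.posLog_eq_log, Real.log_mul (inv_ne_zero hr.ne') (by linarith),
      Real.log_inv]
    · ring
    · rw [abs_of_nonneg (by positivity), le_inv_mul_iff₀ hr]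
      simpa using h

theorem logk_eq_add {x y : ℂ} {r d : ℝ} (hr : 0 < r) (hd : r ≤ d) :
    logk d x y = ENNReal.ofReal (Real.log (d / max ‖x - y‖ r)) + logk r x y := by
  by_cases h : x = y
  · simp [h]
  have hpos : 0 < ‖x - y‖ := norm_pos_iff.2 (sub_ne_zero.2 h)
  have hd0 : 0 < d := hr.trans_le hd
  rw [logk_of_ne h, logk_of_ne h]
  rcases le_total ‖x - y‖ r with h1 | h1
  · rw [max_eq_right h1, ← ENNReal.ofReal_add (Real.log_nonneg ((one_le_div hr).2 hd))
      (Real.log_nonneg ((one_le_div hpos).2 h1)), Real.log_div hd0.ne' hr.ne',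
      Real.log_div hr.ne' hpos.ne', Real.log_div hd0.ne' hpos.ne']
    congr 1
    ring
  · rw [max_eq_left h1, ENNReal.ofReal_of_nonpos (p := Real.log (r / ‖x - y‖)), add_zero]
    exact Real.log_nonpos (by positivity) ((div_le_one hpos).2 h1)

/-- Riesz-type formula: the logarithmic potential at the centre of a circle is its mean over the
circle plus the potential of the kernel truncated at the radius. -/
theorem potential_logk_eq_circle_add {μ : Measure ℂ} [SFinite μ] {x : ℂ} {r : ℝ} {d : ℂ → ℝ}
    (hdm : Measurable d) (hr : 0 < r) (hd : ∀ᵐ y ∂μ, r + ‖x - y‖ ≤ d y) :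
    ∫⁻ y, logk (d y) x y ∂μ =
      ∫⁻ θ, ∫⁻ y, logk (d y) (circleMap x r θ) y ∂μ ∂circleProb + ∫⁻ y, logk r x y ∂μ := by
  rw [lintegral_lintegral_swap]
  · rw [← lintegral_add_right _ (measurable_logk (g := fun y => y) measurable_const measurable_const
      measurable_id)]
    refine lintegral_congr_ae (hd.mono fun y hy => ?_)
    simp only
    rw [lintegral_circleProb_logk hr hy, logk_eq_add hr]
    linarith [norm_nonneg (x - y)]
  · refine (measurable_logk (hdm.comp measurable_snd) ?_ measurable_snd).aemeasurable
    exact (continuous_circleMap x r).measurable.comp measurable_fst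

/-- The fundamental theorem of calculus on `[s, δ]`. It represents the radial kernel `Φ δ - Φ s` as
a superposition of indicators of balls. -/
theorem lintegral_Ioo_indicator_Ici {φ Φ : ℝ → ℝ} {δ s : ℝ} (hs : 0 < s) (hsδ : s ≤ δ)
    (hΦ : ∀ r, 0 < r → HasDerivAt Φ (φ r) r) (hφ : ContinuousOn φ (Set.Ioi 0))
    (hφ0 : ∀ r, 0 < r → 0 ≤ φ r) :
    ∫⁻ r : ℝ in Set.Ioo 0 δ, (Set.Ici s).indicator (fun r => ENNReal.ofReal (φ r)) r =
      ENNReal.ofReal (Φ δ - Φ s) := by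
  have hsub : Set.uIcc s δ ⊆ Set.Ioi 0 := by
    rw [Set.uIcc_of_le hsδ]
    exact fun r hr => hs.trans_le hr.1
  have hii : IntervalIntegrable φ volume s δ := (hφ.mono hsub).intervalIntegrable
  rw [lintegral_indicator measurableSet_Ici, Measure.restrict_restrict measurableSet_Ici,
    ← intervalIntegral.integral_eq_sub_of_hasDerivAt (fun r hr => hΦ r (hsub hr)) hii,
    intervalIntegral.integral_of_le hsδ, ofReal_integral_eq_lintegral_ofReal hii.1]
  · refine setLIntegral_congr ?_
    have : Set.Ici s ∩ Set.Ioo 0 δ = Set.Ico s δ := by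
      ext r
      simp only [Set.mem_inter_iff, Set.mem_Ici, Set.mem_Ioo, Set.mem_Ico]
      exact ⟨fun h => ⟨h.1, h.2.2⟩, fun h => ⟨h.1, hs.trans_le h.1, h.2⟩⟩
    rw [this]
    exact Ico_ae_eq_Ioc
  · rw [Filter.EventuallyLE, ae_restrict_iff' measurableSet_Ioc]
    exact Eventually.of_forall fun r hr => hφ0 r (hs.trans hr.1)

/-- Layer-cake formula for radial kernels. -/
theorem lintegral_radial_eq_lintegral_closedBall (μ : Measure ℂ) [SFinite μ] (x : ℂ) (δ : ℝ)
    {w : ℝ → ℝ≥0∞} (hw : Measurable w) :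
    ∫⁻ y, (∫⁻ r : ℝ in Set.Ioo 0 δ, (Set.Ici ‖x - y‖).indicator w r) ∂μ =
      ∫⁻ r in Set.Ioo 0 δ, w r * μ (closedBall x r) := by
  have hset : MeasurableSet {p : ℂ × ℝ | ‖x - p.1‖ ≤ p.2} :=
    measurableSet_le (by fun_prop) (by fun_prop)
  rw [lintegral_lintegral_swap]
  · refine lintegral_congr fun r => ?_
    have : ∀ y, (Set.Ici ‖x - y‖).indicator w r =
        (closedBall x r).indicator (fun _ => w r) y := by
      intro y
      simp only [Set.indicator, Set.mem_Ici, mem_closedBall, dist_comm y x, dist_eq_norm]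
    simp_rw [this]
    rw [lintegral_indicator_const measurableSet_closedBall]
  · refine Measurable.aemeasurable ?_
    exact (hw.comp measurable_snd).indicator hset

/-- The layer-cake formula for `log⁺ (δ / s) = ∫ dr / r` over `s < r < δ`. It lets comparisons of
the masses of small balls pass to truncated potentials. -/
theorem potential_logk_eq_lintegral_closedBall {μ : Measure ℂ} [SFinite μ] {x : ℂ} {δ : ℝ}
    (hδ : 0 < δ) (hx : μ {x} = 0) :
    ∫⁻ y, logk δ x y ∂μ =
      ∫⁻ r in Set.Ioo 0 δ, ENNReal.ofReal r⁻¹ * μ (closedBall x r) := by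
  rw [← lintegral_radial_eq_lintegral_closedBall μ x δ measurable_inv.ennreal_ofReal]
  rw [← compl_mem_ae_iff] at hx
  refine lintegral_congr_ae ?_
  filter_upwards [hx] with y hy
  have hy' : x ≠ y := fun h => hy h.symm
  have hpos : 0 < ‖x - y‖ := norm_pos_iff.2 (sub_ne_zero.2 hy')
  rw [logk_of_ne hy']
  rcases le_total ‖x - y‖ δ with h | h
  · rw [lintegral_Ioo_indicator_Ici (φ := fun r => r⁻¹) (Φ := Real.log) hpos h
      (fun r hr => Real.hasDerivAt_log hr.ne') (continuousOn_inv₀.mono fun r hr => ne_of_gt hr)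
      (fun r hr => by positivity), Real.log_div hδ.ne' hpos.ne']
  · rw [ENNReal.ofReal_of_nonpos (Real.log_nonpos (by positivity) ((div_le_one hpos).2 h)),
      eq_comm, setLIntegral_eq_zero measurableSet_Ioo]
    intro r hr
    exact Set.indicator_of_notMem (fun h' => absurd (hr.2.trans_le h) (not_lt.2 h')) _

end LogPotential

namespace LogPotential

/-! ### Reduction of the weighted energy to a nonnegative energy on the disk -/

section Energy

variable {ρ b : ℝ} {U : ℂ → EReal} {u : ℂ → ℝ≥0∞}

theorem norm_sub_le_of_mem_closedBall {x y : ℂ} (hx : x ∈ closedBall (0 : ℂ) ρ)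
    (hy : y ∈ closedBall (0 : ℂ) ρ) : ‖x - y‖ ≤ 2 * ρ := by
  rw [mem_closedBall_zero_iff] at hx hy
  linarith [norm_sub_le x y]

theorem half_mul_coe_sub (p : ℝ≥0∞) (b : ℝ) :
    ((1 / 2 : ℝ) : EReal) * ((p : EReal) - (b : EReal)) =
      ((2⁻¹ * p : ℝ≥0∞) : EReal) - ((b / 2 : ℝ) : EReal) := by
  induction p with
  | top =>
    rw [ENNReal.mul_top (by simp), EReal.coe_ennreal_top, EReal.top_sub_coe, EReal.top_sub_coe,
      EReal.coe_mul_top_of_pos (by norm_num)]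
  | coe p =>
    have h2 : (2⁻¹ * (p : ℝ≥0∞)) = ((2⁻¹ * p : ℝ≥0) : ℝ≥0∞) := by
      rw [ENNReal.coe_mul, ENNReal.coe_inv (by norm_num)]; rfl
    rw [h2]
    change ((1 / 2 : ℝ) : EReal) * (((p : ℝ) : EReal) - (b : EReal)) =
      (((2⁻¹ * p : ℝ≥0) : ℝ) : EReal) - ((b / 2 : ℝ) : EReal)
    rw [← EReal.coe_sub, ← EReal.coe_sub, ← EReal.coe_mul]
    congr 1
    push_cast
    ring

theorem coe_sub_add_coe_sub (p q : ℝ≥0∞) (b c : ℝ) :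
    ((p : EReal) - (b : EReal)) + ((q : EReal) - (c : EReal)) =
      ((p + q : ℝ≥0∞) : EReal) - ((b + c : ℝ) : EReal) := by
  induction p with
  | top =>
    induction q with
    | top => simp [-EReal.coe_add]
    | coe q =>
      rw [top_add, EReal.coe_ennreal_top, EReal.top_sub_coe, EReal.top_sub_coe]
      change ⊤ + (((q : ℝ) : EReal) - (c : EReal)) = ⊤
      rw [← EReal.coe_sub, EReal.top_add_coe]
  | coe p =>
    induction q with
    | top =>
      rw [add_top, EReal.coe_ennreal_top, EReal.top_sub_coe, EReal.top_sub_coe]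
      change (((p : ℝ) : EReal) - (b : EReal)) + ⊤ = ⊤
      rw [← EReal.coe_sub, EReal.coe_add_top]
    | coe q =>
      rw [← ENNReal.coe_add]
      change (((p : ℝ) : EReal) - (b : EReal)) + (((q : ℝ) : EReal) - (c : EReal)) =
        (((p + q : ℝ≥0) : ℝ) : EReal) - ((b + c : ℝ) : EReal)
      rw [← EReal.coe_sub, ← EReal.coe_sub, ← EReal.coe_add, ← EReal.coe_sub]
      congr 1
      push_cast
      ring

/-- The kernel contributes the constant `log (2 * ρ)` and each half of the field contributes `b /
2`. Nonnegativity of the sum is what `eintegral_coe_sub` requires. -/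
theorem energy_eq_fieldEnergy_sub (hρ : 0 < ρ) (hu : Measurable u)
    (hU : ∀ z ∈ closedBall (0 : ℂ) ρ, U z = (u z : EReal) - (b : EReal))
    (hb : 0 ≤ Real.log (2 * ρ) + b) {μ : Measure ℂ} (hμ : IsProbabilityOn (closedBall 0 ρ) μ) :
    energy U μ = (fieldEnergy (logk (2 * ρ)) u μ : EReal) -
      ((Real.log (2 * ρ) + b : ℝ) : EReal) := by
  have := hμ.1
  have hae : ∀ᵐ p ∂(μ.prod μ), p.1 ∈ closedBall (0 : ℂ) ρ ∧ p.2 ∈ closedBall (0 : ℂ) ρ := by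
    have h0 : ∀ᵐ x ∂μ, x ∈ closedBall (0 : ℂ) ρ := mem_ae_iff.2 hμ.2
    have h1 := (Measure.quasiMeasurePreserving_fst (μ := μ) (ν := μ)).ae h0
    have h2 := (Measure.quasiMeasurePreserving_snd (μ := μ) (ν := μ)).ae h0
    filter_upwards [h1, h2] with p hp1 hp2 using ⟨hp1, hp2⟩
  have hK := measurable_uncurry_logk (2 * ρ)
  have hu1 : Measurable fun p : ℂ × ℂ => 2⁻¹ * u p.1 := (hu.comp measurable_fst).const_mul _
  have hu2 : Measurable fun p : ℂ × ℂ => 2⁻¹ * u p.2 := (hu.comp measurable_snd).const_mul _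
  have hmeas : Measurable fun p : ℂ × ℂ =>
      logk (2 * ρ) p.1 p.2 + 2⁻¹ * u p.1 + 2⁻¹ * u p.2 := (hK.add hu1).add hu2
  unfold energy
  rw [eintegral_congr_ae (g := fun p => ((logk (2 * ρ) p.1 p.2 + 2⁻¹ * u p.1 + 2⁻¹ * u p.2 :
    ℝ≥0∞) : EReal) - ((Real.log (2 * ρ) + b : ℝ) : EReal)), eintegral_coe_sub hmeas
    (integrable_const _) measurable_const (fun _ => hb)]
  · congr 2
    · rw [lintegral_add_right _ hu2, lintegral_add_right _ hu1, fieldEnergy, mutualEnergy,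
        lintegral_prod (fun p => logk (2 * ρ) p.1 p.2) hK.aemeasurable, lintegral_prod _ hu1.aemeasurable,
        lintegral_prod _ hu2.aemeasurable]
      simp only [lintegral_const, measure_univ, mul_one]
      rw [add_assoc, lintegral_const_mul _ hu, ← add_mul, ENNReal.inv_two_add_inv_two, one_mul]
    · simp
  · filter_upwards [hae] with p hp
    rw [hU _ hp.1, hU _ hp.2, logKernel_eq_logk_sub (d := 2 * ρ) (by positivity)
      (norm_sub_le_of_mem_closedBall hp.1 hp.2), half_mul_coe_sub, half_mul_coe_sub,
      coe_sub_add_coe_sub, coe_sub_add_coe_sub]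
    congr 2
    ring

theorem isMin_fieldEnergy (hρ : 0 < ρ) (hu : Measurable u)
    (hU : ∀ z ∈ closedBall (0 : ℂ) ρ, U z = (u z : EReal) - (b : EReal))
    (hb : 0 ≤ Real.log (2 * ρ) + b) (hsub : closedBall 0 ρ ⊆ finitenessSet U) {μ : Measure ℂ}
    (hμ : IsEquilibriumMeasure U μ) (hμS : μ (closedBall 0 ρ)ᶜ = 0) :
    ∀ μ', IsProbabilityOn (closedBall 0 ρ) μ' →
      fieldEnergy (logk (2 * ρ)) u μ ≤ fieldEnergy (logk (2 * ρ)) u μ' := by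
  intro μ' hμ'
  have h := hμ.2 μ' ⟨hμ'.1, measure_mono_null (Set.compl_subset_compl.2 hsub) hμ'.2⟩
  rw [energy_eq_fieldEnergy_sub hρ hu hU hb ⟨hμ.1.1, hμS⟩,
    energy_eq_fieldEnergy_sub hρ hu hU hb hμ'] at h
  rw [← EReal.coe_ennreal_le_coe_ennreal_iff]
  have h2 := add_le_add_left h ((Real.log (2 * ρ) + b : ℝ) : EReal)
  rwa [EReal.sub_add_cancel, EReal.sub_add_cancel] at h2

end Energy

/-! ### Uniform measures on circles as test measures -/

section Circles

variable {ρ r : ℝ} {x y : ℂ}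

theorem circleMap_mem_closedBall_of_le (hr : 0 ≤ r) (hx : ‖x‖ + r ≤ ρ) (θ : ℝ) :
    circleMap x r θ ∈ closedBall (0 : ℂ) ρ := by
  have := norm_circleMap_sub_le x 0 hr θ
  simp only [sub_zero] at this
  rw [mem_closedBall_zero_iff]
  linarith

theorem lintegral_circleProb_logk_of_mem (hr : 0 < r) (hx : ‖x‖ + r ≤ ρ)
    (hy : y ∈ closedBall (0 : ℂ) ρ) :
    ∫⁻ θ, logk (2 * ρ) (circleMap x r θ) y ∂circleProb =
      ENNReal.ofReal (Real.log (2 * ρ / max ‖x - y‖ r)) := by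
  refine lintegral_circleProb_logk hr ?_
  rw [mem_closedBall_zero_iff] at hy
  linarith [norm_sub_le x y]

theorem log_div_max_le (hr : 0 < r) (hρ : 0 < ρ) :
    Real.log (2 * ρ / max ‖x - y‖ r) ≤ Real.log (2 * ρ / r) :=
  Real.log_le_log (div_pos (by positivity) (lt_max_of_lt_right hr)) (by gcongr; exact le_max_right _ _)

/-- The potential of the uniform measure on a circle of radius `r` is at most `log (2 * ρ / r)` on
the disk, so such measures are test measures of finite energy. -/
theorem mutualEnergy_circle_le (hr : 0 < r) (hx : ‖x‖ + r ≤ ρ) {τ : Measure ℂ}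
    (hτ : τ (closedBall 0 ρ)ᶜ = 0) [SFinite τ] :
    mutualEnergy (logk (2 * ρ)) (circleProb.map (circleMap x r)) τ ≤
      ENNReal.ofReal (Real.log (2 * ρ / r)) * τ Set.univ := by
  have hρ : 0 < ρ := by linarith [norm_nonneg x]
  have hm : Measurable (circleMap x r) := (continuous_circleMap x r).measurable
  unfold mutualEnergy
  rw [lintegral_map (measurable_potential_logk _ τ) hm, lintegral_lintegral_swap]
  · rw [← lintegral_const]
    have h0 : ∀ᵐ x ∂τ, x ∈ closedBall (0 : ℂ) ρ := mem_ae_iff.2 hτ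
    refine lintegral_mono_ae (h0.mono fun y hy => ?_)
    rw [lintegral_circleProb_logk_of_mem hr hx hy]
    exact ENNReal.ofReal_le_ofReal (log_div_max_le hr hρ)
  · exact (measurable_logk measurable_const (hm.comp measurable_fst) measurable_snd).aemeasurable

theorem isProbabilityOn_circle (hr : 0 ≤ r) (hx : ‖x‖ + r ≤ ρ) :
    IsProbabilityOn (closedBall 0 ρ) (circleProb.map (circleMap x r)) := by
  have hm : Measurable (circleMap x r) := (continuous_circleMap x r).measurable
  refine ⟨Measure.isProbabilityMeasure_map hm.aemeasurable, ?_⟩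
  rw [Measure.map_apply hm measurableSet_closedBall.compl]
  have : circleMap x r ⁻¹' (closedBall 0 ρ)ᶜ = ∅ := by
    ext θ
    simpa using circleMap_mem_closedBall_of_le hr hx θ
  rw [this, measure_empty]

theorem fieldEnergy_ne_top_of_isMin {u : ℂ → ℝ≥0∞} (hu : Measurable u)
    {μ : Measure ℂ} (hr : 0 < r) (hx : ‖x‖ + r ≤ ρ)
    (hmin : ∀ μ', IsProbabilityOn (closedBall 0 ρ) μ' →
      fieldEnergy (logk (2 * ρ)) u μ ≤ fieldEnergy (logk (2 * ρ)) u μ')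
    (huc : ∫⁻ θ, u (circleMap x r θ) ∂circleProb ≠ ⊤) :
    fieldEnergy (logk (2 * ρ)) u μ ≠ ⊤ := by
  have hp := isProbabilityOn_circle hr.le hx
  have := hp.1
  refine ne_top_of_le_ne_top ?_ (hmin _ hp)
  unfold fieldEnergy
  rw [lintegral_map hu (continuous_circleMap x r).measurable]
  refine ENNReal.add_ne_top.2 ⟨ne_top_of_le_ne_top ?_ (mutualEnergy_circle_le hr hx hp.2), huc⟩
  finiteness

end Circles

/-! ### Euler-Lagrange conditions -/

section EulerLagrange

variable {ρ : ℝ} {u : ℂ → ℝ≥0∞} {μ : Measure ℂ}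

theorem lintegral_fieldPotential_ne_top (hu : Measurable u) [SFinite μ]
    (hfin : fieldEnergy (logk (2 * ρ)) u μ ≠ ⊤) :
    ∫⁻ x, fieldPotential (logk (2 * ρ)) u μ x ∂μ ≠ ⊤ := by
  rw [lintegral_fieldPotential (measurable_uncurry_logk _) hu]
  have h1 : mutualEnergy (logk (2 * ρ)) μ μ ≠ ⊤ := ne_top_of_le_ne_top hfin le_self_add
  have h2 : ∫⁻ x, u x ∂μ ≠ ⊤ := ne_top_of_le_ne_top hfin le_add_self
  finiteness

/-- The first-order condition with the whole mass of the minimizer moved to `τ`. -/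
theorem const_le_lintegral_fieldPotential (hu : Measurable u)
    (hμ : IsProbabilityOn (closedBall 0 ρ) μ)
    (hfin : fieldEnergy (logk (2 * ρ)) u μ ≠ ⊤)
    (hmin : ∀ μ', IsProbabilityOn (closedBall 0 ρ) μ' →
      fieldEnergy (logk (2 * ρ)) u μ ≤ fieldEnergy (logk (2 * ρ)) u μ')
    {τ : Measure ℂ} (hτ : IsProbabilityOn (closedBall 0 ρ) τ)
    (hE : mutualEnergy (logk (2 * ρ)) τ τ ≠ ⊤) :
    ∫⁻ x, fieldPotential (logk (2 * ρ)) u μ x ∂μ ≤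
      ∫⁻ x, fieldPotential (logk (2 * ρ)) u μ x ∂τ := by
  have := hμ.1
  have := hτ.1
  exact lintegral_fieldPotential_le_of_isMin (measurable_uncurry_logk _) (logk_comm _) hu
    (σ := 0) hμ (by simp) (by simp) hτ.2 hfin hE hmin

/-- The field potential is bounded below by the equilibrium constant almost everywhere with respect
to any measure of finite energy. -/
theorem ae_const_le_fieldPotential (hu : Measurable u)
    (hμ : IsProbabilityOn (closedBall 0 ρ) μ)
    (hfin : fieldEnergy (logk (2 * ρ)) u μ ≠ ⊤)
    (hmin : ∀ μ', IsProbabilityOn (closedBall 0 ρ) μ' →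
      fieldEnergy (logk (2 * ρ)) u μ ≤ fieldEnergy (logk (2 * ρ)) u μ')
    {τ : Measure ℂ} [IsFiniteMeasure τ] (hτ : τ (closedBall 0 ρ)ᶜ = 0)
    (hE : mutualEnergy (logk (2 * ρ)) τ τ ≠ ⊤) :
    ∀ᵐ x ∂τ, ∫⁻ x, fieldPotential (logk (2 * ρ)) u μ x ∂μ ≤
      fieldPotential (logk (2 * ρ)) u μ x := by
  have := hμ.1
  set G := fieldPotential (logk (2 * ρ)) u μ with hG
  have hGm : Measurable G := measurable_fieldPotential (measurable_uncurry_logk _) hu μ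
  set c := ∫⁻ x, G x ∂μ with hc
  have hcfin : c ≠ ⊤ := lintegral_fieldPotential_ne_top hu hfin
  set B := {x | G x < c} with hB
  have hBm : MeasurableSet B := measurableSet_lt hGm measurable_const
  suffices h0 : τ B = 0 by
    rw [← compl_mem_ae_iff] at h0
    filter_upwards [h0] with x hx
    exact not_lt.1 hx
  by_contra hne
  have hfinB : τ B ≠ ⊤ := measure_ne_top τ B
  set m := τ B with hm
  -- The normalized restriction of `τ` to the set where the field is below `c` is a test measure
  -- whose mean field would be below `c`.
  have hp : IsProbabilityOn (closedBall 0 ρ) (m⁻¹ • τ.restrict B) := by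
    refine ⟨⟨?_⟩, ?_⟩
    · simp only [Measure.smul_apply, Measure.restrict_apply_univ, smul_eq_mul]
      exact ENNReal.inv_mul_cancel hne hfinB
    · simp only [Measure.smul_apply, smul_eq_mul]
      rw [Measure.restrict_apply measurableSet_closedBall.compl,
        measure_mono_null Set.inter_subset_left hτ, mul_zero]
  have := hp.1
  have hEp : mutualEnergy (logk (2 * ρ)) (m⁻¹ • τ.restrict B) (m⁻¹ • τ.restrict B) ≠ ⊤ := by
    rw [mutualEnergy_smul_left, mutualEnergy_comm (measurable_uncurry_logk _) (logk_comm _),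
      mutualEnergy_smul_left]
    have h1 : m⁻¹ ≠ ⊤ := ENNReal.inv_ne_top.2 hne
    have h2 : mutualEnergy (logk (2 * ρ)) (τ.restrict B) (τ.restrict B) ≠ ⊤ :=
      ne_top_of_le_ne_top hE (mutualEnergy_mono Measure.restrict_le_self Measure.restrict_le_self)
    finiteness
  have hle := const_le_lintegral_fieldPotential hu hμ hfin hmin hp hEp
  rw [← hG, lintegral_smul_measure, smul_eq_mul] at hle
  have hlt : ∫⁻ x in B, G x ∂τ < ∫⁻ x in B, c ∂τ := by
    refine lintegral_strict_mono (by simpa using hne) aemeasurable_const ?_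
      ((ae_restrict_iff' hBm).2 (Eventually.of_forall fun x hx => hx))
    refine ne_top_of_le_ne_top (b := c * m) (by finiteness) ?_
    rw [hm, ← setLIntegral_const]
    exact setLIntegral_mono measurable_const fun x hx => le_of_lt hx
  rw [setLIntegral_const, ← hm] at hlt
  have : c * m ≤ ∫⁻ x in B, G x ∂τ := by
    calc c * m ≤ m⁻¹ * (∫⁻ x in B, G x ∂τ) * m := by gcongr
      _ = ∫⁻ x in B, G x ∂τ := by
        rw [mul_assoc, mul_comm, mul_assoc, ENNReal.mul_inv_cancel hne hfinB, mul_one]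
  exact absurd hlt (not_lt.2 this)

/-- Testing against a small circle around `x`: the mean of the logarithmic potential is at most its
value at the centre, and the mean of `u` exceeds `u x` by at most `ε`. -/
theorem const_le_fieldPotential_of_mem_ball (hu : Measurable u)
    (huc : ∀ x ∈ ball (0 : ℂ) ρ, ContinuousAt u x) (huf : ∀ x, u x ≠ ⊤)
    (hμ : IsProbabilityOn (closedBall 0 ρ) μ)
    (hfin : fieldEnergy (logk (2 * ρ)) u μ ≠ ⊤)
    (hmin : ∀ μ', IsProbabilityOn (closedBall 0 ρ) μ' →
      fieldEnergy (logk (2 * ρ)) u μ ≤ fieldEnergy (logk (2 * ρ)) u μ')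
    {x : ℂ} (hx : x ∈ ball (0 : ℂ) ρ) :
    ∫⁻ x, fieldPotential (logk (2 * ρ)) u μ x ∂μ ≤ fieldPotential (logk (2 * ρ)) u μ x := by
  have := hμ.1
  refine ENNReal.le_of_forall_pos_le_add fun ε hε _ => ?_
  have hux : ∀ᶠ y in 𝓝 x, u y < u x + ε :=
    (huc x hx).eventually_lt_const (ENNReal.lt_add_right (huf x) (by simpa using hε.ne'))
  obtain ⟨δ, hδ, hball⟩ := Metric.eventually_nhds_iff.1 hux
  rw [mem_ball_zero_iff] at hx
  set r := min (δ / 2) (ρ - ‖x‖) with hr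
  have hr0 : 0 < r := lt_min (by positivity) (by linarith)
  have hrδ : r < δ := (min_le_left _ _).trans_lt (by linarith)
  have hrρ : ‖x‖ + r ≤ ρ := by linarith [min_le_right (δ / 2) (ρ - ‖x‖)]
  have hp := isProbabilityOn_circle hr0.le hrρ
  have := hp.1
  have hm : Measurable (circleMap x r) := (continuous_circleMap x r).measurable
  have hEc := mutualEnergy_circle_le hr0 hrρ hp.2
  have hle := const_le_lintegral_fieldPotential hu hμ hfin hmin hp
    (ne_top_of_le_ne_top (by finiteness) hEc)
  refine hle.trans ?_
  have h0 : ∀ᵐ y ∂μ, y ∈ closedBall (0 : ℂ) ρ := mem_ae_iff.2 hμ.2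
  rw [lintegral_fieldPotential (measurable_uncurry_logk _) hu, fieldPotential, add_assoc]
  gcongr
  · rw [mutualEnergy, lintegral_map (measurable_potential_logk _ μ) hm,
      potential_logk_eq_circle_add (d := fun _ => 2 * ρ) measurable_const hr0]
    · exact le_self_add
    · filter_upwards [h0] with y hy
      rw [mem_closedBall_zero_iff] at hy
      linarith [norm_sub_le x y]
  · rw [lintegral_map hu hm]
    calc ∫⁻ θ, u (circleMap x r θ) ∂circleProb ≤ ∫⁻ θ, (u x + ε) ∂circleProb := by
          refine lintegral_mono fun θ => (hball ?_).le
          rw [dist_eq_norm]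
          simpa [circleMap, abs_of_pos hr0] using hrδ
      _ = u x + ε := by simp

/-- Euler-Lagrange equation for an equilibrium measure whose support is the closed disk and which
charges neither points nor the boundary circle. -/
theorem fieldPotential_eq_const (hu : Measurable u) (huc : Continuous u) (huf : ∀ x, u x ≠ ⊤)
    (hμ : IsProbabilityOn (closedBall 0 ρ) μ)
    (hfin : fieldEnergy (logk (2 * ρ)) u μ ≠ ⊤)
    (hmin : ∀ μ', IsProbabilityOn (closedBall 0 ρ) μ' →
      fieldEnergy (logk (2 * ρ)) u μ ≤ fieldEnergy (logk (2 * ρ)) u μ')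
    (hsphere : μ (sphere 0 ρ) = 0) (hatom : ∀ x, μ {x} = 0)
    (hsupp : closedBall (0 : ℂ) ρ ⊆ μ.support) {x : ℂ} (hx : x ∈ closedBall (0 : ℂ) ρ) :
    fieldPotential (logk (2 * ρ)) u μ x ≤ ∫⁻ x, fieldPotential (logk (2 * ρ)) u μ x ∂μ := by
  have := hμ.1
  set G := fieldPotential (logk (2 * ρ)) u μ with hG
  have hGm : Measurable G := measurable_fieldPotential (measurable_uncurry_logk _) hu μ
  set c := ∫⁻ x, G x ∂μ with hc
  have hcfin : c ≠ ⊤ := lintegral_fieldPotential_ne_top hu hfin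
  have hge : ∀ᵐ y ∂μ, c ≤ G y := by
    have h0 : ∀ᵐ y ∂μ, y ∈ closedBall (0 : ℂ) ρ := mem_ae_iff.2 hμ.2
    rw [← compl_mem_ae_iff] at hsphere
    filter_upwards [h0, hsphere] with y hy hy'
    refine const_le_fieldPotential_of_mem_ball hu (fun x _ => huc.continuousAt) huf hμ hfin hmin ?_
    rw [mem_closedBall] at hy
    exact lt_of_le_of_ne hy hy'
  -- The field is at least `c` almost everywhere and has mean `c`, hence equals `c` almost
  -- everywhere.
  have heq : ∀ᵐ y ∂μ, G y ≤ c := by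
    have : (fun _ => c) =ᵐ[μ] G := by
      refine ae_eq_of_ae_le_of_lintegral_le hge (by simpa using hcfin) hGm.aemeasurable ?_
      simp [hc]
    exact this.mono fun y hy => hy.ge
  -- Every neighbourhood of a point of the support has positive mass and so contains such points.
  have hfreq : ∃ᶠ y in 𝓝 x, G y ≤ c := by
    have hxs := Measure.mem_support_iff_forall x |>.1 (hsupp hx)
    rw [Filter.frequently_iff]
    intro V hV
    by_contra! hcon
    have := hxs V hV
    refine this.ne' (measure_mono_null (t := {y | ¬ G y ≤ c}) (fun y hy => ?_) heq)
    exact not_le.2 (hcon y hy)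
  obtain ⟨v, hv, hvc⟩ := Filter.exists_seq_forall_of_frequently hfreq
  have hae : ∀ᵐ y ∂μ, x ≠ y := by
    have := hatom x
    rw [← compl_mem_ae_iff] at this
    filter_upwards [this] with y hy h
    exact hy h.symm
  have hlim : ∀ᵐ y ∂μ, logk (2 * ρ) x y ≤ liminf (fun n => logk (2 * ρ) (v n) y) atTop := by
    filter_upwards [hae] with y hy
    refine (Tendsto.liminf_eq ?_).ge
    have h1 : Tendsto (fun z => ENNReal.ofReal (Real.log (2 * ρ / ‖z - y‖))) (𝓝 x)
        (𝓝 (logk (2 * ρ) x y)) := by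
      rw [logk_of_ne hy]
      by_cases hρ0 : ρ = 0
      · simp [hρ0]
      refine (ENNReal.continuous_ofReal.tendsto _).comp ?_
      have hne : ‖x - y‖ ≠ 0 := norm_ne_zero_iff.2 (sub_ne_zero.2 hy)
      have : ContinuousAt (fun z : ℂ => 2 * ρ / ‖z - y‖) x := by
        fun_prop (disch := assumption)
      exact (Real.continuousAt_log (by positivity)).tendsto.comp this
    refine (h1.comp hv).congr' ?_
    filter_upwards [hv (isOpen_ne.mem_nhds hy)] with n hn
    exact (logk_of_ne hn).symm
  -- Lower semicontinuity of the potential along the sequence; the absence of an atom at `x` gives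
  -- convergence of the kernel almost everywhere.
  have hfatou : ∫⁻ y, logk (2 * ρ) x y ∂μ ≤
      liminf (fun n => ∫⁻ y, logk (2 * ρ) (v n) y ∂μ) atTop :=
    (lintegral_mono_ae hlim).trans (lintegral_liminf_le fun n =>
      measurable_logk measurable_const measurable_const measurable_id)
  have hul : Tendsto (fun n => u (v n)) atTop (𝓝 (u x)) := (huc.tendsto x).comp hv
  refine ENNReal.le_of_forall_pos_le_add fun ε hε _ => ?_
  by_contra! hcon
  have h3 : ∀ᶠ n in atTop, u x < u (v n) + ε := by
    have : Tendsto (fun n => u (v n) + ε) atTop (𝓝 (u x + ε)) := hul.add tendsto_const_nhds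
    exact this.eventually_const_lt (ENNReal.lt_add_right (huf x) (by simpa using hε.ne'))
  have h4 : ∀ᶠ n in atTop, 2 * ∫⁻ y, logk (2 * ρ) (v n) y ∂μ ≤ c + ε - u x := by
    filter_upwards [h3] with n hn
    have := hvc n
    rw [hG, fieldPotential] at this
    refine ENNReal.le_sub_of_add_le_right (huf x) ?_
    calc 2 * ∫⁻ y, logk (2 * ρ) (v n) y ∂μ + u x
        ≤ 2 * ∫⁻ y, logk (2 * ρ) (v n) y ∂μ + (u (v n) + ε) := by gcongr
      _ ≤ c + ε := by rw [← add_assoc]; gcongr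
  have h5 : 2 * ∫⁻ y, logk (2 * ρ) x y ∂μ ≤ c + ε - u x := by
    have h6 : ∀ᶠ n in atTop, ∫⁻ y, logk (2 * ρ) (v n) y ∂μ ≤ (c + ε - u x) / 2 := by
      filter_upwards [h4] with n hn
      rwa [ENNReal.le_div_iff_mul_le (by simp) (by simp), mul_comm]
    have h7 := hfatou.trans (liminf_le_of_frequently_le' h6.frequently)
    rwa [ENNReal.le_div_iff_mul_le (by simp) (by simp), mul_comm] at h7
  have h8 : u x ≤ c + ε := by
    obtain ⟨n, hn⟩ := h3.exists
    refine hn.le.trans ?_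
    gcongr
    exact le_trans (by rw [hG, fieldPotential]; exact le_add_self) (hvc n)
  refine absurd hcon (not_lt.2 ?_)
  rw [hG, fieldPotential]
  calc _ ≤ (c + ε - u x) + u x := by gcongr
    _ = c + ε := tsub_add_cancel_of_le h8

end EulerLagrange

end LogPotential

namespace LogPotential

/-! ### Circular means of `C^{1,1}` functions -/

section MeanValues

variable {f : ℂ → ℝ} {x : ℂ} {r : ℝ}

theorem lintegral_circleProb_ofReal (hr : 0 ≤ r) (hf : ContinuousOn f (sphere x r))
    (h0 : ∀ z ∈ sphere x r, 0 ≤ f z) :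
    ∫⁻ θ, ENNReal.ofReal (f (circleMap x r θ)) ∂circleProb =
      ENNReal.ofReal (Real.circleAverage f x r) := by
  rw [← integral_circleProb, ← ofReal_integral_eq_lintegral_ofReal]
  · exact integrable_circleProb (hf.circleIntegrable hr)
  · exact Eventually.of_forall fun θ => h0 _ (circleMap_mem_sphere x hr θ)

theorem circleAverage_clm_sub (L : ℂ →L[ℝ] ℝ) (x : ℂ) (r : ℝ) :
    Real.circleAverage (fun y => L (y - x)) x r = 0 := by
  have h1 : CircleIntegrable (fun y : ℂ => y - x) x r :=
    (Continuous.continuousOn (by fun_prop)).circleIntegrable'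
  have h2 := L.circleAverage_comp_comm h1
  have h3 : Real.circleAverage (fun y : ℂ => y - x) x r = 0 := by
    rw [DiffContOnCl.circleAverage (Differentiable.diffContOnCl (by fun_prop)), sub_self]
  rw [h3, map_zero] at h2
  exact h2

/-- Second-order estimate for the circular means of a function with Lipschitz derivative. -/
theorem abs_circleAverage_sub_le {g : ℂ → ℝ} (hg : Differentiable ℝ g) {L : ℝ≥0} {s : Set ℂ}
    (hL : LipschitzOnWith L (fderiv ℝ g) s) (hr : 0 ≤ r) (hs : closedBall x r ⊆ s) :
    |Real.circleAverage g x r - g x| ≤ L * r ^ 2 := by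
  have hx : x ∈ closedBall x r := mem_closedBall_self hr
  -- The derivative varies by at most `L * r` on the disk, so the first-order Taylor remainder is at
  -- most `L * r ^ 2`; its linear term has mean zero.
  have hT : ∀ y ∈ sphere x |r|, |g y - g x - fderiv ℝ g x (y - x)| ≤ L * r ^ 2 := by
    intro y hy
    rw [abs_of_nonneg hr] at hy
    have h1 := (convex_closedBall x r).norm_image_sub_le_of_norm_fderiv_le' (𝕜 := ℝ) (f := g)
      (φ := fderiv ℝ g x) (C := L * r) (fun z _ => hg z) (fun z hz => ?_) hx
      (sphere_subset_closedBall hy)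
    · rw [Real.norm_eq_abs, ← dist_eq_norm y, mem_sphere.1 hy] at h1
      linarith
    · rw [← dist_eq_norm]
      refine (hL.dist_le_mul z (hs hz) x (hs hx)).trans ?_
      gcongr
      exact hz
  have hgi : CircleIntegrable g x r := hg.continuous.continuousOn.circleIntegrable'
  have hci : CircleIntegrable (fun y => g y - g x) x r :=
    (Continuous.continuousOn (hg.continuous.sub continuous_const)).circleIntegrable'
  have hLi : CircleIntegrable (fun y => fderiv ℝ g x (y - x)) x r :=
    (Continuous.continuousOn (by fun_prop)).circleIntegrable'
  have heq : Real.circleAverage (fun y => g y - g x - fderiv ℝ g x (y - x)) x r =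
      Real.circleAverage g x r - g x := by
    rw [Real.circleAverage_fun_sub hci hLi, circleAverage_clm_sub,
      Real.circleAverage_fun_sub hgi (circleIntegrable_const _ _ _), Real.circleAverage_const,
      sub_zero]
  rw [← heq]
  refine Real.abs_circleAverage_le_circleAverage_abs.trans ?_
  refine Real.circleAverage_mono_on_of_le_circle ?_ hT
  exact (hci.sub hLi).abs

end MeanValues

/-! ### Comparison of measures through small balls and truncated potentials -/

section Comparison

variable {ρ : ℝ}

/-- Markov's inequality: the kernel is at least `a` on the ball of radius `δ * exp (-a)`. -/
theorem measure_closedBall_le_lintegral_logk {μ : Measure ℂ} {x : ℂ} {δ a : ℝ} (hδ : 0 < δ) :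
    ENNReal.ofReal a * μ (closedBall x (δ * Real.exp (-a))) ≤ ∫⁻ y, logk δ x y ∂μ := by
  rw [← setLIntegral_const]
  refine le_trans (setLIntegral_mono' measurableSet_closedBall fun y hy => ?_)
    (setLIntegral_le_lintegral _ _)
  by_cases hxy : x = y
  · simp [hxy]
  rw [logk_of_ne hxy]
  have hpos : 0 < ‖x - y‖ := norm_pos_iff.2 (sub_ne_zero.2 hxy)
  refine ENNReal.ofReal_le_ofReal ?_
  rw [Real.le_log_iff_exp_le (by positivity), le_div_iff₀ hpos]
  rw [mem_closedBall, dist_comm, dist_eq_norm, Real.exp_neg, ← div_eq_mul_inv,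
    le_div_iff₀ (Real.exp_pos a)] at hy
  linarith

theorem measure_singleton_eq_zero_of_potential_ne_top {μ : Measure ℂ} {x : ℂ} {δ : ℝ}
    (h : ∫⁻ y, logk δ x y ∂μ ≠ ⊤) : μ {x} = 0 := by
  by_contra hne
  refine h (top_unique ?_)
  calc ⊤ = ∫⁻ y in {x}, logk δ x y ∂μ := by
        rw [Measure.restrict_singleton, lintegral_smul_measure, lintegral_dirac, logk_self,
          smul_eq_mul, ENNReal.mul_top hne]
    _ ≤ ∫⁻ y, logk δ x y ∂μ := setLIntegral_le_lintegral _ _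

/-- A measure whose density at the centres of small balls is bounded has bounded density. -/
theorem le_smul_of_measure_closedBall_le {μ ν : Measure ℂ} [IsFiniteMeasure μ]
    [IsLocallyFiniteMeasure ν] (hac : μ ≪ ν) {C : ℝ≥0} {s : Set ℂ} (hs : MeasurableSet s)
    (hμs : μ sᶜ = 0)
    (h : ∀ x ∈ s, ∀ᶠ r in 𝓝[>] 0, μ (closedBall x r) ≤ C * ν (closedBall x r)) :
    μ ≤ C • ν := by
  have : SigmaFinite ν := inferInstance
  have hle : ∀ᵐ x ∂ν, x ∈ s → μ.rnDeriv ν x ≤ C := by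
    filter_upwards [Besicovitch.ae_tendsto_rnDeriv μ ν] with x hx hxs
    refine le_of_tendsto hx ?_
    filter_upwards [h x hxs] with r hr
    exact ENNReal.div_le_of_le_mul hr
  refine Measure.le_iff.2 fun t ht => ?_
  calc μ t ≤ μ (s ∩ t) + μ (sᶜ ∩ t) := by
        refine (measure_mono ?_).trans (measure_union_le _ _)
        rw [← Set.union_inter_distrib_right, Set.union_compl_self, Set.univ_inter]
    _ = μ (s ∩ t) := by rw [measure_mono_null Set.inter_subset_left hμs, add_zero]
    _ = ∫⁻ x in s ∩ t, μ.rnDeriv ν x ∂ν := (Measure.setLIntegral_rnDeriv hac _).symm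
    _ ≤ ∫⁻ x in s ∩ t, C ∂ν := by
        refine lintegral_mono_ae ((ae_restrict_iff' (hs.inter ht)).2 ?_)
        filter_upwards [hle] with x hx hxs using hx hxs.1
    _ ≤ (C • ν) t := by
        rw [setLIntegral_const, Measure.smul_apply, ENNReal.smul_def, smul_eq_mul]
        gcongr
        exact Set.inter_subset_right

/-- Comparison of measures from comparison of their truncated potentials. -/
theorem restrict_le_of_truncated_potential_le {μ κ : Measure ℂ} [IsFiniteMeasure μ]
    [IsFiniteMeasure κ] {s : Set ℂ} (hs : MeasurableSet s) (hκ : ∀ x, κ {x} = 0)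
    (hfin : ∀ᵐ x ∂μ, ∀ δ, 0 < δ → ∫⁻ y, logk δ x y ∂μ ≠ ⊤)
    {δ : ℕ → ℝ} (hδ0 : ∀ n, 0 < δ n) (hδ : Tendsto δ atTop (𝓝 0))
    (h : ∀ᵐ x ∂μ, x ∈ s → ∀ᶠ n in atTop,
      ∫⁻ y, logk (δ n) x y ∂μ ≤ ∫⁻ y, logk (δ n) x y ∂κ) :
    μ.restrict s ≤ κ := by
  have hone : ∀ᵐ x ∂μ, x ∈ s → 1 ≤ κ.rnDeriv μ x := by
    filter_upwards [Besicovitch.ae_tendsto_rnDeriv κ μ, hfin, h, Measure.support_mem_ae (μ := μ)]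
      with x hx hxfin hxle hxsupp hxs
    have hμa := measure_singleton_eq_zero_of_potential_ne_top (hxfin 1 one_pos)
    -- A density below `q < 1` at `x` bounds the masses of all small balls, and the layer-cake
    -- formula then gives `Λ ≤ q * Λ` although `0 < Λ < ∞`.
    by_contra! hlt
    obtain ⟨q, hq1, hq2⟩ := exists_between hlt
    have hev : ∀ᶠ r in 𝓝[>] (0 : ℝ), κ (closedBall x r) ≤ q * μ (closedBall x r) := by
      filter_upwards [hx.eventually_lt_const hq1, self_mem_nhdsWithin] with r hr hr0
      have hpos := (Measure.mem_support_iff_forall x).1 hxsupp _ (closedBall_mem_nhds x hr0)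
      exact (ENNReal.div_le_iff hpos.ne' (measure_ne_top _ _)).1 hr.le
    obtain ⟨r₀, hr₀, hball⟩ := mem_nhdsGT_iff_exists_Ioo_subset.1 hev
    obtain ⟨n, hn, hnr⟩ := ((hxle hxs).and (hδ.eventually_lt_const hr₀)).exists
    set Λ := ∫⁻ y, logk (δ n) x y ∂μ with hΛ
    have hle : Λ ≤ q * Λ := by
      calc Λ ≤ ∫⁻ y, logk (δ n) x y ∂κ := hn
        _ = ∫⁻ r in Set.Ioo 0 (δ n), ENNReal.ofReal r⁻¹ * κ (closedBall x r) :=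
          potential_logk_eq_lintegral_closedBall (hδ0 n) (hκ x)
        _ ≤ ∫⁻ r in Set.Ioo 0 (δ n), q * (ENNReal.ofReal r⁻¹ * μ (closedBall x r)) := by
          refine setLIntegral_mono' measurableSet_Ioo fun r hr => ?_
          rw [mul_left_comm]
          gcongr
          exact hball ⟨hr.1, hr.2.trans hnr⟩
        _ = q * ∫⁻ r in Set.Ioo 0 (δ n), ENNReal.ofReal r⁻¹ * μ (closedBall x r) :=
          lintegral_const_mul' _ _ (hq2.trans_le le_top).ne
        _ = q * Λ := by rw [hΛ, potential_logk_eq_lintegral_closedBall (hδ0 n) hμa]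
    have hpos : 0 < Λ := by
      have h1 := measure_closedBall_le_lintegral_logk (μ := μ) (x := x) (a := 1) (hδ0 n)
      refine lt_of_lt_of_le ?_ h1
      simp only [ENNReal.ofReal_one, one_mul]
      exact (Measure.mem_support_iff_forall x).1 hxsupp _
        (closedBall_mem_nhds x (mul_pos (hδ0 n) (Real.exp_pos _)))
    have hlt' : q * Λ < 1 * Λ := by
      exact (ENNReal.mul_lt_mul_iff_left hpos.ne' (hxfin _ (hδ0 n))).2 hq2
    rw [one_mul] at hlt'
    exact absurd hle (not_le.2 hlt')
  refine Measure.le_iff.2 fun t ht => ?_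
  rw [Measure.restrict_apply ht]
  calc μ (t ∩ s) = ∫⁻ x in t ∩ s, 1 ∂μ := by simp
    _ ≤ ∫⁻ x in t ∩ s, κ.rnDeriv μ x ∂μ := by
        refine lintegral_mono_ae ((ae_restrict_iff' (ht.inter hs)).2 ?_)
        filter_upwards [hone] with x hx hxs using hx hxs.2
    _ ≤ κ (t ∩ s) := Measure.setLIntegral_rnDeriv_le _
    _ ≤ κ t := measure_mono Set.inter_subset_left

end Comparison

end LogPotential

namespace LogPotential

/-! ### The potential of the exterior measure inside the disk -/

section Exterior

variable {ρ : ℝ} {ν : Measure ℂ} {x : ℂ}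

/-- The nonnegative normalization of the potential of `ν` on the disk of radius `ρ`. -/
noncomputable def normalizedPotential (ρ : ℝ) (ν : Measure ℂ) (z : ℂ) : ℝ≥0∞ :=
  ∫⁻ w, logk (1 + ρ + ‖w‖) z w ∂ν

theorem measurable_normalizedPotential [SFinite ν] : Measurable (normalizedPotential ρ ν) :=
  measurable_kernel_lintegral (K := fun z w => logk (1 + ρ + ‖w‖) z w)
    (measurable_logk (by fun_prop) measurable_fst measurable_snd) ν

theorem ae_le_norm_of_measure_ball (hν : ν (ball 0 ρ) = 0) : ∀ᵐ w ∂ν, ρ ≤ ‖w‖ := by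
  rw [← compl_mem_ae_iff] at hν
  filter_upwards [hν] with w hw
  simpa using hw

/-- On the support of `ν` the distance to `x` is at least `ρ - ‖x‖`. As `‖w‖ ≤ ‖x‖ + ‖x - w‖`, the
quotient in the logarithm stays bounded even for large `w`. -/
theorem normalizedPotential_ne_top [IsFiniteMeasure ν] (hρ : 0 < ρ) (hν : ν (ball 0 ρ) = 0)
    (hx : ‖x‖ < ρ) : normalizedPotential ρ ν x ≠ ⊤ := by
  refine ne_top_of_le_ne_top
    (b := ENNReal.ofReal (Real.log ((1 + 2 * ρ) / (ρ - ‖x‖) + 1)) * ν Set.univ) (by finiteness) ?_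
  rw [← lintegral_const]
  refine lintegral_mono_ae ?_
  filter_upwards [ae_le_norm_of_measure_ball hν] with w hw
  have hd : 0 < ρ - ‖x‖ := by linarith
  have h1 : ρ - ‖x‖ ≤ ‖x - w‖ := by
    rw [norm_sub_rev]
    linarith [norm_sub_norm_le w x]
  have hpos : 0 < ‖x - w‖ := by linarith
  rw [logk_of_ne (sub_ne_zero.1 (norm_pos_iff.1 hpos))]
  refine ENNReal.ofReal_le_ofReal (Real.log_le_log (by positivity) ?_)
  have h2 : ‖w‖ ≤ ‖x‖ + ‖x - w‖ := by
    have := norm_sub_le x (x - w)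
    simpa using this
  calc (1 + ρ + ‖w‖) / ‖x - w‖ ≤ ((1 + 2 * ρ) + ‖x - w‖) / ‖x - w‖ :=
        div_le_div_of_nonneg_right (by linarith) hpos.le
    _ = (1 + 2 * ρ) / ‖x - w‖ + 1 := by field_simp
    _ ≤ (1 + 2 * ρ) / (ρ - ‖x‖) + 1 := by gcongr

/-- Harmonicity: in the Riesz-type formula the truncated term vanishes, since almost all of `ν` is
at distance at least `δ` from `x`. -/
theorem normalizedPotential_eq_circle [SFinite ν] {δ : ℝ} (hδ : 0 < δ) (hν : ν (ball 0 ρ) = 0)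
    (hx : ‖x‖ + δ ≤ ρ) : normalizedPotential ρ ν x =
      ∫⁻ θ, normalizedPotential ρ ν (circleMap x δ θ) ∂circleProb := by
  unfold normalizedPotential
  rw [potential_logk_eq_circle_add (by fun_prop) hδ]
  · convert add_zero _
    rw [lintegral_eq_zero_iff (measurable_logk (g := fun y => y) measurable_const measurable_const
      measurable_id)]
    filter_upwards [ae_le_norm_of_measure_ball hν] with w hw
    have h1 : δ ≤ ‖x - w‖ := by
      rw [norm_sub_rev]
      linarith [norm_sub_norm_le w x]
    have hpos : 0 < ‖x - w‖ := by linarith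
    rw [logk_of_ne (sub_ne_zero.1 (norm_pos_iff.1 hpos))]
    exact ENNReal.ofReal_of_nonpos (Real.log_nonpos (by positivity) ((div_le_one hpos).2 h1))
  · exact Eventually.of_forall fun w => by linarith [norm_sub_le x w]

end Exterior

/-! ### Local consequences of the Euler-Lagrange equation -/

section Interior

variable {ρ : ℝ} {μ : Measure ℂ} {g : ℂ → ℝ} {b : ℝ} {c : ℝ≥0∞}

theorem potential_eq_circle_add_of_mem {x : ℂ} {δ : ℝ} [SFinite μ] (hμ : μ (closedBall 0 ρ)ᶜ = 0)
    (hδ : 0 < δ) (hx : ‖x‖ + δ ≤ ρ) :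
    ∫⁻ y, logk (2 * ρ) x y ∂μ =
      ∫⁻ θ, ∫⁻ y, logk (2 * ρ) (circleMap x δ θ) y ∂μ ∂circleProb + ∫⁻ y, logk δ x y ∂μ := by
  refine potential_logk_eq_circle_add (d := fun _ => 2 * ρ) measurable_const hδ ?_
  have h0 : ∀ᵐ y ∂μ, y ∈ closedBall (0 : ℂ) ρ := mem_ae_iff.2 hμ
  filter_upwards [h0] with y hy
  rw [mem_closedBall_zero_iff] at hy
  linarith [norm_sub_le x y]

theorem norm_lt_of_mem_sphere {x z : ℂ} {δ : ℝ} (hx : ‖x‖ + δ < ρ) (hz : z ∈ sphere x δ) :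
    ‖z‖ < ρ := by
  rw [mem_sphere, dist_eq_norm] at hz
  have : ‖z‖ ≤ ‖z - x‖ + ‖x‖ := by simpa using norm_add_le (z - x) x
  linarith

/-- The Euler-Lagrange equation at `x` is subtracted from its mean over the circle, and the
Riesz-type formula identifies the difference of the potentials. This is an integrated form of `Δ g =
4 π μ` that needs no second derivatives. -/
theorem two_mul_truncated_potential_eq (hg : Continuous g)
    (hgb : ∀ z ∈ closedBall (0 : ℂ) ρ, 0 ≤ g z + b) [IsFiniteMeasure μ]
    (hμ : μ (closedBall 0 ρ)ᶜ = 0) (hc : c ≠ ⊤)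
    (hG : ∀ x ∈ ball (0 : ℂ) ρ,
      fieldPotential (logk (2 * ρ)) (fun z => ENNReal.ofReal (g z + b)) μ x = c)
    {x : ℂ} {δ : ℝ} (hδ : 0 < δ) (hx : ‖x‖ + δ < ρ) :
    2 * ∫⁻ y, logk δ x y ∂μ = ENNReal.ofReal (Real.circleAverage g x δ - g x) := by
  have hu : Measurable fun z => ENNReal.ofReal (g z + b) := by
    have := hg.measurable
    fun_prop
  have hm : Measurable (circleMap x δ) := (continuous_circleMap x δ).measurable
  have hP : Measurable fun θ => ∫⁻ y, logk (2 * ρ) (circleMap x δ θ) y ∂μ :=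
    (measurable_potential_logk _ μ).comp hm
  have hsph : ∀ z ∈ sphere x δ, z ∈ ball (0 : ℂ) ρ := fun z hz =>
    mem_ball_zero_iff.2 (norm_lt_of_mem_sphere hx hz)
  have havg : ∫⁻ θ, ENNReal.ofReal (g (circleMap x δ θ) + b) ∂circleProb =
      ENNReal.ofReal (Real.circleAverage g x δ + b) := by
    rw [lintegral_circleProb_ofReal (f := fun z => g z + b) hδ.le (by fun_prop)
      (fun z hz => hgb z (ball_subset_closedBall (hsph z hz))), Real.circleAverage_fun_add
        hg.continuousOn.circleIntegrable' (circleIntegrable_const _ _ _), Real.circleAverage_const]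
  have h1 : 2 * ∫⁻ θ, ∫⁻ y, logk (2 * ρ) (circleMap x δ θ) y ∂μ ∂circleProb +
      ENNReal.ofReal (Real.circleAverage g x δ + b) = c := by
    have hum : Measurable fun θ => ENNReal.ofReal (g (circleMap x δ θ) + b) := hu.comp hm
    rw [← havg, ← lintegral_const_mul _ hP, ← lintegral_add_right _ hum]
    calc _ = ∫⁻ θ, c ∂circleProb := lintegral_congr fun θ =>
          hG _ (hsph _ (circleMap_mem_sphere x hδ.le θ))
      _ = c := by simp
  have h2 := hG x (mem_ball_zero_iff.2 (by linarith))
  rw [fieldPotential, potential_eq_circle_add_of_mem hμ hδ hx.le, mul_add, add_assoc, ← h1] at h2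
  have hfin : 2 * ∫⁻ θ, ∫⁻ y, logk (2 * ρ) (circleMap x δ θ) y ∂μ ∂circleProb ≠ ⊤ :=
    ne_top_of_le_ne_top hc (le_self_add.trans h1.le)
  have h3 := (ENNReal.add_right_inj hfin).1 h2
  have hgx : 0 ≤ g x + b := hgb x (mem_closedBall_zero_iff.2 (by linarith))
  rw [ENNReal.eq_sub_of_add_eq ENNReal.ofReal_ne_top h3, ← ENNReal.ofReal_sub _ hgx]
  congr 1
  ring

theorem truncated_potential_ne_top {μ : Measure ℂ} {x : ℂ} {δ d : ℝ} [IsFiniteMeasure μ]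
    (hd : 0 < d) (h : ∫⁻ y, logk d x y ∂μ ≠ ⊤) (hδ : 0 < δ) : ∫⁻ y, logk δ x y ∂μ ≠ ⊤ := by
  refine ne_top_of_le_ne_top
    (b := ∫⁻ y, (ENNReal.ofReal (Real.log (max δ d / d)) + logk d x y) ∂μ) ?_ ?_
  · rw [lintegral_add_left measurable_const, lintegral_const]
    finiteness
  · refine lintegral_mono fun y => ?_
    rw [← max_eq_left (le_max_right δ d)] 
    by_cases hxy : x = y
    · simp [hxy]
    have hpos : 0 < ‖x - y‖ := norm_pos_iff.2 (sub_ne_zero.2 hxy)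
    have hm : 0 < max δ d := lt_max_of_lt_right hd
    rw [logk_of_ne hxy, logk_of_ne hxy, max_eq_left (le_max_right δ d)]
    refine le_trans (ENNReal.ofReal_le_ofReal ?_) ENNReal.ofReal_add_le
    rw [Real.log_div hδ.ne' hpos.ne', Real.log_div hm.ne' hd.ne', Real.log_div hd.ne' hpos.ne']
    linarith [Real.log_le_log hδ (le_max_left δ d)]

/-- The equilibrium measure of a `C^{1,1}` potential has a bounded density. -/
theorem exists_le_smul_volume (hg : Differentiable ℝ g) {L : ℝ≥0}
    (hL : LipschitzOnWith L (fderiv ℝ g) (closedBall 0 ρ))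
    (hgb : ∀ z ∈ closedBall (0 : ℂ) ρ, 0 ≤ g z + b) [IsFiniteMeasure μ] (hac : μ ≪ volume)
    (hμ : μ (closedBall 0 ρ)ᶜ = 0) (hμb : μ (ball 0 ρ)ᶜ = 0) (hc : c ≠ ⊤)
    (hG : ∀ x ∈ ball (0 : ℂ) ρ,
      fieldPotential (logk (2 * ρ)) (fun z => ENNReal.ofReal (g z + b)) μ x = c) :
    ∃ C : ℝ≥0, μ ≤ C • volume := by
  -- Markov's inequality with `a = 1` bounds the mass of the ball of radius `r` by the potential
  -- truncated at `r * exp 1`, hence by `L * (r * exp 1) ^ 2`; and `r ^ 2` is at most the area of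
  -- the ball.
  refine ⟨Real.toNNReal (L * Real.exp 1 ^ 2), le_smul_of_measure_closedBall_le hac
    measurableSet_ball hμb fun x hx => ?_⟩
  rw [mem_ball_zero_iff] at hx
  have hlim : Tendsto (fun r : ℝ => ‖x‖ + r * Real.exp 1) (𝓝[>] 0) (𝓝 ‖x‖) := by
    have : Continuous fun r : ℝ => ‖x‖ + r * Real.exp 1 := by fun_prop
    have h := this.tendsto 0
    simp only [zero_mul, add_zero] at h
    exact h.mono_left nhdsWithin_le_nhds
  filter_upwards [hlim.eventually_lt_const hx, self_mem_nhdsWithin] with r hr hr0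
  have hr0 : 0 < r := hr0
  have hδ : 0 < r * Real.exp 1 := mul_pos hr0 (Real.exp_pos _)
  have h1 := measure_closedBall_le_lintegral_logk (μ := μ) (x := x) (a := 1) hδ
  rw [mul_assoc, ← Real.exp_add, add_neg_cancel, Real.exp_zero, mul_one, ENNReal.ofReal_one,
    one_mul] at h1
  have h2 := two_mul_truncated_potential_eq hg.continuous hgb hμ hc hG hδ hr
  have h3 := abs_circleAverage_sub_le hg hL hδ.le (x := x) fun y hy => by
    rw [mem_closedBall, dist_eq_norm] at hy
    rw [mem_closedBall_zero_iff]
    have : ‖y‖ ≤ ‖y - x‖ + ‖x‖ := by simpa using norm_add_le (y - x) x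
    linarith
  calc μ (closedBall x r) ≤ ∫⁻ y, logk (r * Real.exp 1) x y ∂μ := h1
    _ ≤ 2 * ∫⁻ y, logk (r * Real.exp 1) x y ∂μ := by
        rw [two_mul]
        exact le_self_add
    _ ≤ ENNReal.ofReal (L * (r * Real.exp 1) ^ 2) := by
        rw [h2]
        exact ENNReal.ofReal_le_ofReal ((le_abs_self _).trans h3)
    _ = ENNReal.ofReal (L * Real.exp 1 ^ 2) * (ENNReal.ofReal r ^ 2 * 1) := by
        rw [mul_one, ← ENNReal.ofReal_pow hr0.le, ← ENNReal.ofReal_mul (by positivity)]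
        congr 1
        ring
    _ ≤ _ := by
        rw [Complex.volume_closedBall]
        change _ ≤ ENNReal.ofReal _ * _
        gcongr
        rw [← ENNReal.coe_one, ENNReal.coe_le_coe, ← NNReal.coe_le_coe]
        simpa using Real.one_le_pi_div_two.trans (by linarith [Real.pi_pos])

end Interior

/-! ### Domination inside the disk -/

section Domination

variable {ρ t b b₁ : ℝ} {g R : ℂ → ℝ} {c : ℝ≥0∞} {μV μW ν : Measure ℂ} {uR : ℂ → ℝ≥0∞}

/-- Spreading each point over a circle of fixed radius makes the potential bounded, so no assumption
on the energy of `τ` is needed. -/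
theorem mutualEnergy_map_circle_ne_top {δ : ℝ} (hδ : 0 < δ) {τ : Measure ℂ}
    [IsFiniteMeasure τ] (hτ : τ {x : ℂ | ‖x‖ + δ < ρ}ᶜ = 0) :
    mutualEnergy (logk (2 * ρ)) ((τ.prod circleProb).map fun p => circleMap p.1 δ p.2)
      ((τ.prod circleProb).map fun p => circleMap p.1 δ p.2) ≠ ⊤ := by
  have hT : Measurable fun p : ℂ × ℝ => circleMap p.1 δ p.2 := by
    unfold circleMap
    fun_prop
  set τ' := (τ.prod circleProb).map fun p => circleMap p.1 δ p.2 with hτ'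
  have hmem : ∀ᵐ x ∂τ, ‖x‖ + δ < ρ := mem_ae_iff.2 hτ
  have hτ'mem : ∀ᵐ y ∂τ', y ∈ closedBall (0 : ℂ) ρ := by
    refine (ae_map_iff (p := fun y => y ∈ closedBall (0 : ℂ) ρ) hT.aemeasurable
      measurableSet_closedBall).2 ?_
    have h1 := (Measure.quasiMeasurePreserving_fst (μ := τ) (ν := circleProb)).ae hmem
    filter_upwards [h1] with p hp using circleMap_mem_closedBall_of_le hδ.le hp.le _
  have : IsFiniteMeasure τ' := by rw [hτ']; infer_instance
  refine ne_top_of_le_ne_top (b := ENNReal.ofReal (Real.log (2 * ρ / δ)) * τ' Set.univ *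
    τ Set.univ) (by finiteness) ?_
  unfold mutualEnergy
  rw [hτ', lintegral_map (measurable_potential_logk _ _) hT, ← hτ', lintegral_prod]
  · rw [← lintegral_const]
    refine lintegral_mono_ae (hmem.mono fun x hx => ?_)
    have := mutualEnergy_circle_le hδ (le_of_lt hx) (τ := τ') hτ'mem
    rwa [mutualEnergy, lintegral_map (measurable_potential_logk _ _)
      (continuous_circleMap x δ).measurable] at this
  · exact ((measurable_potential_logk _ _).comp hT).aemeasurable

/-- At almost every point the field potential of the minimizer is at most its circular means. -/
theorem ae_fieldPotential_le_circle {u : ℂ → ℝ≥0∞} (hu : Measurable u) {μ : Measure ℂ}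
    (hμ : IsProbabilityOn (closedBall 0 ρ) μ) (hfin : fieldEnergy (logk (2 * ρ)) u μ ≠ ⊤)
    (hmin : ∀ μ', IsProbabilityOn (closedBall 0 ρ) μ' →
      fieldEnergy (logk (2 * ρ)) u μ ≤ fieldEnergy (logk (2 * ρ)) u μ') {δ : ℝ} (hδ : 0 < δ) :
    ∀ᵐ x ∂μ, x ∈ {x : ℂ | ‖x‖ + δ < ρ} → fieldPotential (logk (2 * ρ)) u μ x ≤
      ∫⁻ θ, fieldPotential (logk (2 * ρ)) u μ (circleMap x δ θ) ∂circleProb := by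
  have hT : Measurable fun p : ℂ × ℝ => circleMap p.1 δ p.2 := by
    unfold circleMap
    fun_prop
  have hA : MeasurableSet {x : ℂ | ‖x‖ + δ < ρ} := measurableSet_lt (by fun_prop) measurable_const
  exact ae_fieldPotential_le_of_isMin (K := logk (2 * ρ)) (u := u) (P := circleProb)
    (T := fun p : ℂ × ℝ => circleMap p.1 δ p.2) (measurable_uncurry_logk _) (logk_comm _)
    hu hμ hfin hmin hA measurableSet_closedBall hT
    (fun x hx θ => circleMap_mem_closedBall_of_le hδ.le (le_of_lt hx) θ)
    (fun τ _ hτ _ => mutualEnergy_map_circle_ne_top hδ hτ)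

/-- Inside the disk the equilibrium measure of the perturbed potential is dominated by `t` times
the original one. -/
theorem restrict_ball_le_smul (hρ : 0 < ρ) (ht : 0 < t) (hg : Continuous g)
    (hgb : ∀ z ∈ closedBall (0 : ℂ) ρ, 0 ≤ g z + b) (hμV : IsProbabilityOn (closedBall 0 ρ) μV)
    (hVatom : ∀ x, μV {x} = 0) (hc : c ≠ ⊤)
    (hG : ∀ x ∈ ball (0 : ℂ) ρ,
      fieldPotential (logk (2 * ρ)) (fun z => ENNReal.ofReal (g z + b)) μV x = c)
    [IsFiniteMeasure ν] (hν : ν (ball 0 ρ) = 0)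
    (hR : ContinuousOn R (closedBall 0 ρ))
    (hRharm : InnerProductSpace.HarmonicOnNhd R (ball 0 ρ)) (huR : Measurable uR)
    (huReq : ∀ z ∈ closedBall (0 : ℂ) ρ, uR z = ENNReal.ofReal (t * g z + 2 * R z + b₁))
    (huR0 : ∀ z ∈ closedBall (0 : ℂ) ρ, 0 ≤ t * g z + 2 * R z + b₁)
    (hμW : IsProbabilityOn (closedBall 0 ρ) μW)
    (hfin : fieldEnergy (logk (2 * ρ)) (fun z => uR z + 2 * normalizedPotential ρ ν z) μW ≠ ⊤)
    (hmin : ∀ μ', IsProbabilityOn (closedBall 0 ρ) μ' →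
      fieldEnergy (logk (2 * ρ)) (fun z => uR z + 2 * normalizedPotential ρ ν z) μW ≤
        fieldEnergy (logk (2 * ρ)) (fun z => uR z + 2 * normalizedPotential ρ ν z) μ') :
    μW.restrict (ball 0 ρ) ≤ ENNReal.ofReal t • μV := by
  have := hμV.1
  have := hμW.1
  set u := fun z => uR z + 2 * normalizedPotential ρ ν z with hu
  have hN : Measurable (normalizedPotential ρ ν) := measurable_normalizedPotential
  have hum : Measurable u := huR.add (hN.const_mul 2)
  have hPfin : ∀ᵐ x ∂μW, ∫⁻ y, logk (2 * ρ) x y ∂μW ≠ ⊤ := by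
    have h1 : mutualEnergy (logk (2 * ρ)) μW μW ≠ ⊤ := ne_top_of_le_ne_top hfin le_self_add
    filter_upwards [ae_lt_top (measurable_potential_logk _ μW) h1] with x hx using hx.ne
  have hδ0 : ∀ n : ℕ, 0 < 1 / ((n : ℝ) + 1) := fun n => by positivity
  have : IsFiniteMeasure (ENNReal.ofReal t • μV) := Measure.smul_finite μV ENNReal.ofReal_ne_top
  refine restrict_le_of_truncated_potential_le measurableSet_ball (fun x => by simp [hVatom x])
    ?_ hδ0 tendsto_one_div_add_atTop_nhds_zero_nat ?_
  · filter_upwards [hPfin] with x hx δ hδ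
    exact truncated_potential_ne_top (by positivity) hx hδ
  -- Countably many radii leave a single exceptional null set.
  have hall : ∀ᵐ x ∂μW, ∀ n : ℕ, x ∈ {x : ℂ | ‖x‖ + 1 / ((n : ℝ) + 1) < ρ} →
      fieldPotential (logk (2 * ρ)) u μW x ≤ ∫⁻ θ, fieldPotential (logk (2 * ρ)) u μW
        (circleMap x (1 / ((n : ℝ) + 1)) θ) ∂circleProb := by
    exact ae_all_iff.2 fun n => ae_fieldPotential_le_circle hum hμW hfin hmin (hδ0 n)
  filter_upwards [hPfin, hall] with x hxfin hx hxball
  rw [mem_ball_zero_iff] at hxball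
  have hev : ∀ᶠ n : ℕ in atTop, 1 / ((n : ℝ) + 1) < ρ - ‖x‖ :=
    tendsto_one_div_add_atTop_nhds_zero_nat.eventually_lt_const (by linarith)
  filter_upwards [hev] with n hn
  have hxn : ‖x‖ + 1 / ((n : ℝ) + 1) < ρ := by linarith
  have hle := hx n hxn
  have hδ := hδ0 n
  generalize 1 / ((n : ℝ) + 1) = δ at hxn hle hδ
  have hm : Measurable (circleMap x δ) := (continuous_circleMap x δ).measurable
  have hsph : ∀ z ∈ sphere x δ, z ∈ closedBall (0 : ℂ) ρ := fun z hz =>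
    mem_closedBall_zero_iff.2 (norm_lt_of_mem_sphere hxn hz).le
  have hV := two_mul_truncated_potential_eq hg hgb hμV.2 hc hG hδ hxn
  have hpot := potential_eq_circle_add_of_mem hμW.2 hδ hxn.le
  have hRsph : ContinuousOn R (sphere x δ) := hR.mono hsph
  have hRavg : Real.circleAverage R x δ = R x := by
    refine InnerProductSpace.HarmonicOnNhd.circleAverage_eq fun z hz => hRharm z ?_
    rw [abs_of_pos hδ, mem_closedBall, dist_eq_norm] at hz
    rw [mem_ball_zero_iff]
    have : ‖z‖ ≤ ‖z - x‖ + ‖x‖ := by simpa using norm_add_le (z - x) x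
    linarith
  have huRavg : ∫⁻ θ, uR (circleMap x δ θ) ∂circleProb =
      ENNReal.ofReal (t * Real.circleAverage g x δ + 2 * R x + b₁) := by
    have h1 : CircleIntegrable (fun z => t * g z) x δ :=
      (Continuous.continuousOn (by fun_prop)).circleIntegrable'
    have h2 : CircleIntegrable (fun z => 2 * R z) x δ :=
      (continuousOn_const.mul hRsph).circleIntegrable hδ.le
    have h3 : CircleIntegrable (fun z => t * g z + 2 * R z) x δ := h1.add h2
    have e1 : Real.circleAverage (fun z => t * g z) x δ = t * Real.circleAverage g x δ :=
      Real.circleAverage_fun_smul (a := t) (f := g)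
    have e2 : Real.circleAverage (fun z => 2 * R z) x δ = 2 * R x := by
      rw [← hRavg]
      exact Real.circleAverage_fun_smul (a := (2 : ℝ)) (f := R)
    rw [lintegral_congr fun θ => huReq _ (hsph _ (circleMap_mem_sphere x hδ.le θ)),
      lintegral_circleProb_ofReal (f := fun z => t * g z + 2 * R z + b₁) hδ.le (by fun_prop)
      (fun z hz => huR0 z (hsph z hz)),
      Real.circleAverage_fun_add h3 (circleIntegrable_const _ _ _),
      Real.circleAverage_fun_add h1 h2, Real.circleAverage_const, e1, e2]
  have hNfin : normalizedPotential ρ ν x ≠ ⊤ := normalizedPotential_ne_top hρ hν hxball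
  have hrhs : ∫⁻ θ, fieldPotential (logk (2 * ρ)) u μW (circleMap x δ θ) ∂circleProb =
      2 * ∫⁻ θ, ∫⁻ y, logk (2 * ρ) (circleMap x δ θ) y ∂μW ∂circleProb +
      (ENNReal.ofReal (t * Real.circleAverage g x δ + 2 * R x + b₁) +
        2 * normalizedPotential ρ ν x) := by
    have hP : Measurable fun θ => ∫⁻ y, logk (2 * ρ) (circleMap x δ θ) y ∂μW :=
      (measurable_potential_logk _ μW).comp hm
    have hum' : Measurable fun θ => uR (circleMap x δ θ) := huR.comp hm
    have hNm : Measurable fun θ => normalizedPotential ρ ν (circleMap x δ θ) := hN.comp hm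
    simp only [fieldPotential, hu]
    rw [lintegral_add_left (hP.const_mul 2), lintegral_const_mul _ hP,
      lintegral_add_left hum', lintegral_const_mul _ hNm, huRavg,
      ← normalizedPotential_eq_circle hδ hν hxn.le]
  have hxmem : x ∈ closedBall (0 : ℂ) ρ := mem_closedBall_zero_iff.2 hxball.le
  rw [hrhs, fieldPotential, hpot, hu] at hle
  simp only at hle
  rw [huReq x hxmem, mul_add, add_assoc] at hle
  -- The circular mean of the potential of `μW` occurs on both sides and is cancelled, which
  -- requires it to be finite.
  have hAfin : 2 * ∫⁻ θ, ∫⁻ y, logk (2 * ρ) (circleMap x δ θ) y ∂μW ∂circleProb ≠ ⊤ :=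
    ENNReal.mul_ne_top (by simp) (ne_top_of_le_ne_top hxfin (le_self_add.trans hpot.ge))
  have h1 := (ENNReal.add_le_add_iff_left hAfin).1 hle
  rw [← add_assoc] at h1
  have h2 := (ENNReal.add_le_add_iff_right (ENNReal.mul_ne_top (by simp) hNfin)).1 h1
  have h3 := ENNReal.le_sub_of_add_le_right ENNReal.ofReal_ne_top h2
  rw [← ENNReal.ofReal_sub _ (huR0 x hxmem)] at h3
  -- Harmonicity of `R` has removed it from the mean; only the excess of the mean of `g` remains,
  -- which is a truncated potential of `μV`.
  have h4 : t * Real.circleAverage g x δ + 2 * R x + b₁ - (t * g x + 2 * R x + b₁) =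
      t * (Real.circleAverage g x δ - g x) := by ring
  rw [h4, ENNReal.ofReal_mul ht.le, ← hV, mul_left_comm] at h3
  rw [lintegral_smul_measure, smul_eq_mul]
  exact (ENNReal.mul_le_mul_iff_right (by simp) (by simp)).1 h3

end Domination

end LogPotential

namespace LogPotential

/-! ### Radial increments of potentials at the boundary -/

section Radial

variable {ρ l : ℝ} {z w : ℂ}

/-- For `‖z‖ = ‖w‖ = ρ` the last term is `(1 - l) ^ 2 * ρ ^ 2`; for `‖w‖ ≥ ρ = ‖z‖` and `0 ≤ l ≤ 1`
it is nonnegative. These cases govern `η` and `ν` respectively. -/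
theorem norm_smul_sub_sq (l : ℝ) (z w : ℂ) :
    ‖(l : ℂ) * z - w‖ ^ 2 = l * ‖z - w‖ ^ 2 + (1 - l) * (‖w‖ ^ 2 - l * ‖z‖ ^ 2) := by
  simp only [← Complex.normSq_eq_norm_sq, Complex.normSq_apply, Complex.sub_re, Complex.sub_im,
    Complex.mul_re, Complex.mul_im, Complex.ofReal_re, Complex.ofReal_im]
  ring

theorem smul_mem_ball (hρ : 0 < ρ) (hl0 : 0 < l) (hl1 : l < 1) (hz : ‖z‖ ≤ ρ) :
    (l : ℂ) * z ∈ ball (0 : ℂ) ρ := by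
  rw [mem_ball_zero_iff, norm_mul, Complex.norm_real, Real.norm_of_nonneg hl0.le]
  nlinarith

/-- Change of the potential of a measure on the circle along the inner normal. -/
theorem potential_smul_add_le_of_sphere {η : Measure ℂ} (hη : η (sphere 0 ρ)ᶜ = 0)
    (hl0 : 0 < l) (hl1 : l < 1) (hz : ‖z‖ = ρ) (hρ : 0 < ρ) (hatom : η {z} = 0) :
    ∫⁻ w, logk (2 * ρ) ((l : ℂ) * z) w ∂η +
      ∫⁻ w, ENNReal.ofReal (Real.log (1 + (1 - l) ^ 2 * ρ ^ 2 / l / ‖z - w‖ ^ 2) / 2) ∂η ≤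
    ∫⁻ w, logk (2 * ρ) z w ∂η + ENNReal.ofReal (Real.log (1 / l) / 2) * η Set.univ := by
  rw [← lintegral_const, ← lintegral_add_right _ measurable_const,
    ← lintegral_add_left (measurable_logk measurable_const measurable_const measurable_id')]
  have h0 : ∀ᵐ w ∂η, w ∈ sphere (0 : ℂ) ρ := mem_ae_iff.2 hη
  rw [← compl_mem_ae_iff] at hatom
  refine lintegral_mono_ae ?_
  filter_upwards [h0, hatom] with w hw hwz
  rw [mem_sphere_zero_iff_norm] at hw
  have hne : z ≠ w := fun h => hwz h.symm
  have hs : 0 < ‖z - w‖ := norm_pos_iff.2 (sub_ne_zero.2 hne)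
  have hsq := norm_smul_sub_sq l z w
  rw [hw, hz] at hsq
  have hsq' : ‖(l : ℂ) * z - w‖ ^ 2 =
      l * ‖z - w‖ ^ 2 * (1 + (1 - l) ^ 2 * ρ ^ 2 / l / ‖z - w‖ ^ 2) := by
    rw [hsq]
    field_simp
  have hone : 1 ≤ 1 + (1 - l) ^ 2 * ρ ^ 2 / l / ‖z - w‖ ^ 2 := by
    have : 0 ≤ (1 - l) ^ 2 * ρ ^ 2 / l / ‖z - w‖ ^ 2 := by positivity
    linarith
  set q := 1 + (1 - l) ^ 2 * ρ ^ 2 / l / ‖z - w‖ ^ 2 with hq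
  have hlb : (l : ℂ) * z ∈ ball (0 : ℂ) ρ := smul_mem_ball hρ hl0 hl1 hz.le
  have hs' : 0 < ‖(l : ℂ) * z - w‖ := by
    rw [norm_pos_iff, sub_ne_zero]
    rintro h
    rw [h, mem_ball_zero_iff, hw] at hlb
    exact lt_irrefl _ hlb
  have hD : ‖z - w‖ ≤ 2 * ρ := by linarith [norm_sub_le z w]
  have hD' : ‖(l : ℂ) * z - w‖ ≤ 2 * ρ := by
    rw [mem_ball_zero_iff] at hlb
    linarith [norm_sub_le ((l : ℂ) * z) w]
  have hlog := congrArg Real.log hsq'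
  rw [Real.log_pow, Real.log_mul (by positivity) (by positivity), Real.log_mul (by positivity)
    (by positivity), Real.log_pow] at hlog
  rw [logk_of_ne hne, logk_of_ne (sub_ne_zero.1 (norm_pos_iff.1 hs')), ← ENNReal.ofReal_add,
    ← ENNReal.ofReal_add]
  · refine ENNReal.ofReal_le_ofReal (le_of_eq ?_)
    rw [Real.log_div (by positivity) hs'.ne', Real.log_div (by positivity) hs.ne', one_div,
      Real.log_inv]
    push_cast at hlog
    linarith
  · exact Real.log_nonneg ((one_le_div hs).2 hD)
  · exact div_nonneg (Real.log_nonneg ((one_le_div hl0).2 hl1.le)) (by norm_num)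
  · exact Real.log_nonneg ((one_le_div hs').2 hD')
  · exact div_nonneg (Real.log_nonneg hone) (by norm_num)

/-- Change of the potential of an exterior measure along the inner normal. -/
theorem normalizedPotential_smul_le {ν : Measure ℂ} (hν : ν (ball 0 ρ) = 0)
    (hl0 : 0 < l) (hl1 : l < 1) (hz : ‖z‖ = ρ) (hρ : 0 < ρ) :
    normalizedPotential ρ ν ((l : ℂ) * z) ≤
      normalizedPotential ρ ν z + ENNReal.ofReal (Real.log (1 / l) / 2) * ν Set.univ := by
  unfold normalizedPotential
  rw [← lintegral_const, ← lintegral_add_right _ measurable_const]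
  refine lintegral_mono_ae ?_
  filter_upwards [ae_le_norm_of_measure_ball hν] with w hw
  by_cases hne : z = w
  · simp [hne]
  have hs : 0 < ‖z - w‖ := norm_pos_iff.2 (sub_ne_zero.2 hne)
  have hlb : (l : ℂ) * z ∈ ball (0 : ℂ) ρ := smul_mem_ball hρ hl0 hl1 hz.le
  rw [mem_ball_zero_iff] at hlb
  have hs' : 0 < ‖(l : ℂ) * z - w‖ := by
    rw [norm_pos_iff, sub_ne_zero]
    rintro h
    rw [h] at hlb
    linarith
  rw [logk_of_ne hne, logk_of_ne (sub_ne_zero.1 (norm_pos_iff.1 hs'))]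
  refine le_trans (ENNReal.ofReal_le_ofReal ?_) ENNReal.ofReal_add_le
  have hsq := norm_smul_sub_sq l z w
  rw [hz] at hsq
  have hge : l * ‖z - w‖ ^ 2 ≤ ‖(l : ℂ) * z - w‖ ^ 2 := by
    rw [hsq]
    have h1 : l * ρ ^ 2 ≤ ‖w‖ ^ 2 := by nlinarith
    nlinarith
  have hlog := Real.log_le_log (by positivity) hge
  rw [Real.log_pow, Real.log_mul (by positivity) (by positivity), Real.log_pow] at hlog
  rw [Real.log_div (by positivity) hs'.ne', Real.log_div (by positivity) hs.ne', one_div,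
    Real.log_inv]
  push_cast at hlog
  linarith

/-- The part of the disk that is closer to the boundary point `z` than to `l z`. -/
def radialCap (ρ l : ℝ) (z : ℂ) : Set ℂ := {w | w ∈ ball (0 : ℂ) ρ ∧ ‖z - w‖ < ‖(l : ℂ) * z - w‖}

theorem measurableSet_radialCap : MeasurableSet (radialCap ρ l z) :=
  by
  have h1 : Measurable fun w : ℂ => ‖z - w‖ := by fun_prop
  have h2 : Measurable fun w : ℂ => ‖(l : ℂ) * z - w‖ := by fun_prop
  exact measurableSet_ball.inter (measurableSet_lt h1 h2)

/-- Change of the potential of a measure of bounded density along the inner normal. -/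
theorem potential_le_smul_add_of_le_volume {κ : Measure ℂ} {C : ℝ≥0} (hκ : κ ≤ C • volume)
    (hκb : κ (ball 0 ρ)ᶜ = 0) (hl1 : l < 1) (hz : ‖z‖ = ρ) (hρ : 0 < ρ) :
    ∫⁻ w, logk (2 * ρ) z w ∂κ ≤ ∫⁻ w, logk (2 * ρ) ((l : ℂ) * z) w ∂κ +
      ENNReal.ofReal ((1 - l) * ρ) *
        (C * ∫⁻ w in radialCap ρ l z, ENNReal.ofReal (‖z - w‖⁻¹)) := by
  have hm : Measurable fun w => ENNReal.ofReal ‖z - w‖⁻¹ := by fun_prop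
  have h1 : ∫⁻ w, logk (2 * ρ) z w ∂κ ≤ ∫⁻ w, logk (2 * ρ) ((l : ℂ) * z) w ∂κ +
      ∫⁻ w, (radialCap ρ l z).indicator
        (fun w => ENNReal.ofReal ((1 - l) * ρ) * ENNReal.ofReal (‖z - w‖⁻¹)) w ∂κ := by
    rw [← lintegral_add_left (measurable_logk measurable_const measurable_const measurable_id')]
    have h0 : ∀ᵐ w ∂κ, w ∈ ball (0 : ℂ) ρ := mem_ae_iff.2 hκb
    refine lintegral_mono_ae ?_
    filter_upwards [h0] with w hw
    have hne : z ≠ w := by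
      rintro rfl
      rw [mem_ball_zero_iff, hz] at hw
      exact lt_irrefl _ hw
    have hs : 0 < ‖z - w‖ := norm_pos_iff.2 (sub_ne_zero.2 hne)
    by_cases hne' : (l : ℂ) * z = w
    · simp [hne']
    have hs' : 0 < ‖(l : ℂ) * z - w‖ := norm_pos_iff.2 (sub_ne_zero.2 hne')
    rw [logk_of_ne hne, logk_of_ne hne']
    -- Only points closer to `z` than to `l z` raise the potential at `z`. There `log x ≤ x - 1` and
    -- the triangle inequality bound the difference by `(1 - l) * ρ / ‖z - w‖`.
    by_cases hcap : ‖z - w‖ < ‖(l : ℂ) * z - w‖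
    · rw [Set.indicator_of_mem (show w ∈ radialCap ρ l z from ⟨hw, hcap⟩),
        ← ENNReal.ofReal_mul (mul_nonneg (by linarith) hρ.le)]
      refine le_trans (ENNReal.ofReal_le_ofReal ?_) ENNReal.ofReal_add_le
      have h2 : ‖(l : ℂ) * z - w‖ ≤ ‖z - w‖ + (1 - l) * ρ := by
        have h3 : (l : ℂ) * z - w = (z - w) - ((1 - l : ℝ) : ℂ) * z := by push_cast; ring
        rw [h3]
        refine (norm_sub_le _ _).trans (le_of_eq ?_)
        rw [norm_mul, Complex.norm_real, hz, Real.norm_of_nonneg (by linarith)]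
      have h4 : Real.log (‖(l : ℂ) * z - w‖ / ‖z - w‖) ≤ ‖(l : ℂ) * z - w‖ / ‖z - w‖ - 1 :=
        Real.log_le_sub_one_of_pos (by positivity)
      have h5 : ‖(l : ℂ) * z - w‖ / ‖z - w‖ - 1 ≤ (1 - l) * ρ * ‖z - w‖⁻¹ := by
        rw [div_sub_one hs.ne', ← div_eq_mul_inv]
        gcongr
        linarith
      rw [Real.log_div hs'.ne' hs.ne'] at h4
      rw [Real.log_div (by positivity) hs.ne', Real.log_div (by positivity) hs'.ne']
      linarith
    · refine le_add_right (ENNReal.ofReal_le_ofReal (Real.log_le_log (by positivity) ?_))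
      rw [not_lt] at hcap
      gcongr
  refine h1.trans ?_
  gcongr
  rw [lintegral_indicator measurableSet_radialCap, lintegral_const_mul _ hm]
  gcongr
  calc ∫⁻ w in radialCap ρ l z, ENNReal.ofReal (‖z - w‖⁻¹) ∂κ
      ≤ ∫⁻ w in radialCap ρ l z, ENNReal.ofReal (‖z - w‖⁻¹) ∂(C • volume) :=
        lintegral_mono' (Measure.restrict_mono le_rfl hκ) le_rfl
    _ = C * ∫⁻ w in radialCap ρ l z, ENNReal.ofReal (‖z - w‖⁻¹) := by
        rw [Measure.restrict_smul, lintegral_smul_measure]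
        rfl

/-- Write `1 / s` as `1 / (2 * ρ)` plus the integral of `1 / r ^ 2` from `s` to `2 * ρ`; the area `π
* r ^ 2` of a ball compensates the weight. -/
theorem lintegral_inv_norm_sub_ne_top (hz : ‖z‖ = ρ) :
    ∫⁻ w in ball 0 ρ, ENNReal.ofReal (‖z - w‖⁻¹) ≠ ⊤ := by
  have hw : Measurable fun r : ℝ => ENNReal.ofReal ((r ^ 2)⁻¹) := by fun_prop
  set μ := (volume : Measure ℂ).restrict (ball 0 ρ) with hμ
  have h1 := lintegral_radial_eq_lintegral_closedBall μ z (2 * ρ) hw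
  have h2 : ∫⁻ r in Set.Ioo 0 (2 * ρ), ENNReal.ofReal ((r ^ 2)⁻¹) * μ (closedBall z r) ≠ ⊤ := by
    refine ne_top_of_le_ne_top
      (b := ∫⁻ r : ℝ in Set.Ioo 0 (2 * ρ), (NNReal.pi : ℝ≥0∞)) ?_ ?_
    · rw [setLIntegral_const, Real.volume_Ioo]
      finiteness
    · refine setLIntegral_mono' measurableSet_Ioo fun r hr => ?_
      calc ENNReal.ofReal ((r ^ 2)⁻¹) * μ (closedBall z r)
          ≤ ENNReal.ofReal ((r ^ 2)⁻¹) * volume (closedBall z r) := by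
            gcongr
            exact Measure.restrict_le_self
        _ = NNReal.pi := by
            have hr2 : 0 < r ^ 2 := pow_pos hr.1 2
            rw [Complex.volume_closedBall, ← mul_assoc, ← ENNReal.ofReal_pow hr.1.le,
              ← ENNReal.ofReal_mul (by positivity), inv_mul_cancel₀ hr2.ne', ENNReal.ofReal_one,
              one_mul]
  rw [← h1] at h2
  have h3 : ∫⁻ w, ENNReal.ofReal (‖z - w‖⁻¹) ∂μ ≤ ∫⁻ w, (ENNReal.ofReal ((2 * ρ)⁻¹) +
      ∫⁻ r : ℝ in Set.Ioo 0 (2 * ρ), (Set.Ici ‖z - w‖).indicator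
        (fun r => ENNReal.ofReal ((r ^ 2)⁻¹)) r) ∂μ := by
    refine setLIntegral_mono' measurableSet_ball fun w hw => ?_
    rw [mem_ball_zero_iff] at hw
    have hs : 0 < ‖z - w‖ := by
      rw [norm_pos_iff, sub_ne_zero]
      rintro rfl
      linarith
    have hsD : ‖z - w‖ ≤ 2 * ρ := by linarith [norm_sub_le z w]
    rw [lintegral_Ioo_indicator_Ici (φ := fun r => (r ^ 2)⁻¹) (Φ := fun r => -r⁻¹) hs hsD]
    · refine le_trans (ENNReal.ofReal_le_ofReal (le_of_eq ?_)) ENNReal.ofReal_add_le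
      ring
    · intro r hr
      exact (hasDerivAt_inv hr.ne').neg.congr_deriv (neg_neg _)
    · intro r hr
      have : r ^ 2 ≠ 0 := pow_ne_zero 2 (ne_of_gt hr)
      exact ContinuousAt.continuousWithinAt (by fun_prop (disch := assumption))
    · intro r hr
      positivity
  refine ne_top_of_le_ne_top ?_ h3
  rw [lintegral_add_left measurable_const, lintegral_const]
  refine ENNReal.add_ne_top.2 ⟨ENNReal.mul_ne_top ENNReal.ofReal_ne_top ?_, h2⟩
  rw [hμ, Measure.restrict_apply_univ]
  exact measure_ball_lt_top.ne

/-- Dominated convergence: a fixed `w` in the open disk leaves the cap once `l * ρ ^ 2 > ‖w‖ ^ 2`.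
Hence a bounded density contributes only `o(1 - l)`. -/
theorem tendsto_lintegral_radialCap (hz : ‖z‖ = ρ) {l : ℕ → ℝ}
    (hl1 : ∀ n, l n < 1) (hl : Tendsto l atTop (𝓝 1)) :
    Tendsto (fun n => ∫⁻ w in radialCap ρ (l n) z, ENNReal.ofReal (‖z - w‖⁻¹)) atTop (𝓝 0) := by
  have hm : Measurable fun w => ENNReal.ofReal ‖z - w‖⁻¹ := by fun_prop
  have heq : ∀ n, ∫⁻ w in radialCap ρ (l n) z, ENNReal.ofReal (‖z - w‖⁻¹) =
      ∫⁻ w in ball 0 ρ, (radialCap ρ (l n) z).indicator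
        (fun w => ENNReal.ofReal (‖z - w‖⁻¹)) w := by
    intro n
    rw [lintegral_indicator measurableSet_radialCap,
      Measure.restrict_restrict measurableSet_radialCap, Set.inter_eq_left.2 fun w hw => hw.1]
  simp_rw [heq]
  rw [← lintegral_zero (μ := volume.restrict (ball (0 : ℂ) ρ))]
  refine tendsto_lintegral_of_dominated_convergence (fun w => ENNReal.ofReal (‖z - w‖⁻¹))
    (fun n => hm.indicator measurableSet_radialCap)
    (fun n => Eventually.of_forall fun w => Set.indicator_le_self _ _ _)
    (lintegral_inv_norm_sub_ne_top hz) ?_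
  refine (ae_restrict_iff' measurableSet_ball).2 (Eventually.of_forall fun w hw => ?_)
  refine tendsto_const_nhds.congr' ?_
  rw [mem_ball_zero_iff] at hw
  have hlim : Tendsto (fun n => l n * ρ ^ 2) atTop (𝓝 (ρ ^ 2)) := by
    simpa using hl.mul_const (ρ ^ 2)
  have hlt : ‖w‖ ^ 2 < ρ ^ 2 := by gcongr
  filter_upwards [hlim.eventually_const_lt hlt] with n hn
  refine (Set.indicator_of_notMem (fun hmem => ?_) _).symm
  have h1 := norm_smul_sub_sq (l n) z w
  rw [hz] at h1
  have h2 : ‖z - w‖ ^ 2 < ‖(l n : ℂ) * z - w‖ ^ 2 := by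
    have := hmem.2
    gcongr
  have h3 := hl1 n
  nlinarith [sq_nonneg ‖z - w‖]

/-- Lower bound for the radial increment of the potential of a measure with given lower density. -/
theorem le_lintegral_log_of_density {η : Measure ℂ} [SFinite η] {m a r₀ : ℝ} (ha : 0 < a)
    (hr₀ : 0 < r₀) (hm : 0 ≤ m) (hatom : η {z} = 0)
    (hη : ∀ r ∈ Set.Ioo 0 r₀, ENNReal.ofReal (m * (2 * r)) ≤ η (closedBall z r)) :
    ENNReal.ofReal (2 * m * (a * Real.arctan (r₀ / a))) ≤
      ∫⁻ w, ENNReal.ofReal (Real.log (1 + a ^ 2 / ‖z - w‖ ^ 2) / 2) ∂η := by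
  -- The weight is minus the derivative of `log (1 + a ^ 2 / r ^ 2) / 2`. Multiplied by `m * (2 *
  -- r)` it becomes `2 * m * a ^ 2 / (r ^ 2 + a ^ 2)`, whose primitive is an arctangent.
  have hw : Measurable fun r : ℝ => ENNReal.ofReal (a ^ 2 / (r * (r ^ 2 + a ^ 2))) := by fun_prop
  have hint : IntervalIntegrable (fun r => a ^ 2 / (r ^ 2 + a ^ 2)) volume 0 r₀ := by
    refine Continuous.intervalIntegrable ?_ _ _
    have : ∀ r : ℝ, r ^ 2 + a ^ 2 ≠ 0 := fun r => by positivity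
    fun_prop (disch := assumption)
  have hder : ∀ r : ℝ, HasDerivAt (fun r => a * Real.arctan (r / a)) (a ^ 2 / (r ^ 2 + a ^ 2)) r := by
    intro r
    refine ((((hasDerivAt_id' r).div_const a).arctan).const_mul a).congr_deriv ?_
    have : r ^ 2 + a ^ 2 ≠ 0 := by positivity
    field_simp
    ring
  have hval : ∫⁻ r in Set.Ioo 0 r₀, ENNReal.ofReal (a ^ 2 / (r ^ 2 + a ^ 2)) =
      ENNReal.ofReal (a * Real.arctan (r₀ / a)) := by
    have h1 := intervalIntegral.integral_eq_sub_of_hasDerivAt (a := 0) (b := r₀)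
      (fun r _ => hder r) hint
    simp only [zero_div, Real.arctan_zero, mul_zero, sub_zero] at h1
    rw [← h1, intervalIntegral.integral_of_le hr₀.le, ofReal_integral_eq_lintegral_ofReal hint.1
      (Eventually.of_forall fun r => by positivity)]
    exact setLIntegral_congr Ioo_ae_eq_Ioc
  calc ENNReal.ofReal (2 * m * (a * Real.arctan (r₀ / a)))
      = ENNReal.ofReal (2 * m) *
          ∫⁻ r in Set.Ioo 0 r₀, ENNReal.ofReal (a ^ 2 / (r ^ 2 + a ^ 2)) := by
        rw [hval, ENNReal.ofReal_mul (by positivity)]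
    _ = ∫⁻ r in Set.Ioo 0 r₀, ENNReal.ofReal (2 * m) *
          ENNReal.ofReal (a ^ 2 / (r ^ 2 + a ^ 2)) := by
        rw [lintegral_const_mul' _ _ ENNReal.ofReal_ne_top]
    _ ≤ ∫⁻ r in Set.Ioo 0 r₀, ENNReal.ofReal (a ^ 2 / (r * (r ^ 2 + a ^ 2))) *
          η (closedBall z r) := by
        refine setLIntegral_mono' measurableSet_Ioo fun r hr => ?_
        have hr0 : 0 < r := hr.1
        refine le_trans (le_of_eq ?_) (mul_le_mul_right (hη r hr) _)
        rw [← ENNReal.ofReal_mul (by positivity), ← ENNReal.ofReal_mul (by positivity)]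
        congr 1
        field_simp
    _ = ∫⁻ w, (∫⁻ r : ℝ in Set.Ioo 0 r₀, (Set.Ici ‖z - w‖).indicator
          (fun r => ENNReal.ofReal (a ^ 2 / (r * (r ^ 2 + a ^ 2)))) r) ∂η :=
        (lintegral_radial_eq_lintegral_closedBall η z r₀ hw).symm
    _ ≤ _ := by
        rw [← compl_mem_ae_iff] at hatom
        refine lintegral_mono_ae ?_
        filter_upwards [hatom] with w hwz
        have hs : 0 < ‖z - w‖ := norm_pos_iff.2 (sub_ne_zero.2 fun h => hwz h.symm)
        rcases le_total ‖z - w‖ r₀ with h | h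
        · rw [lintegral_Ioo_indicator_Ici (φ := fun r => a ^ 2 / (r * (r ^ 2 + a ^ 2)))
            (Φ := fun r => -(Real.log (1 + a ^ 2 / r ^ 2) / 2)) hs h]
          · refine ENNReal.ofReal_le_ofReal ?_
            have : 0 ≤ Real.log (1 + a ^ 2 / r₀ ^ 2) := Real.log_nonneg (by
              have : 0 ≤ a ^ 2 / r₀ ^ 2 := by positivity
              linarith)
            linarith
          · intro r hr
            have hne : 1 + a ^ 2 / r ^ 2 ≠ 0 := by positivity
            have hd : HasDerivAt (fun r => 1 + a ^ 2 / r ^ 2) (-(2 * a ^ 2 / r ^ 3)) r := by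
              have h1 := (((hasDerivAt_pow 2 r).fun_inv (by positivity)).const_mul
                (a ^ 2)).const_add 1
              refine h1.congr_deriv ?_
              push_cast
              field_simp
            refine ((hd.log hne).div_const 2).neg.congr_deriv ?_
            field_simp
          · refine ContinuousOn.div (by fun_prop) (by fun_prop) fun r hr => ?_
            have hr0 : (0 : ℝ) < r := hr
            positivity
          · intro r hr
            positivity
        · rw [setLIntegral_eq_zero measurableSet_Ioo]
          · exact zero_le
          · intro r hr
            exact Set.indicator_of_notMem
              (fun h' => absurd (hr.2.trans_le h) (not_lt.2 h')) _

end Radial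

end LogPotential

namespace LogPotential

/-! ### The density inequality on the circle -/

section Boundary

variable {ρ l t b b₁ d m : ℝ} {z : ℂ} {g R : ℂ → ℝ} {c : ℝ≥0∞} {C : ℝ≥0}
  {μV μW μ η κ ν : Measure ℂ} {uR : ℂ → ℝ≥0∞}

/-- Dilation by `l` raises the kernel by at most `log (1 / l)`. -/
theorem mutualEnergy_map_smul_ne_top (hl0 : 0 < l) (hρ : 0 < ρ) {τ : Measure ℂ}
    [IsFiniteMeasure τ] (hE : mutualEnergy (logk (2 * ρ)) τ τ ≠ ⊤) :
    mutualEnergy (logk (2 * ρ)) (τ.map fun x => (l : ℂ) * x) (τ.map fun x => (l : ℂ) * x) ≠ ⊤ := by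
  have hT : Measurable fun x : ℂ => (l : ℂ) * x := by fun_prop
  refine ne_top_of_le_ne_top (b := mutualEnergy (logk (2 * ρ)) τ τ +
    ENNReal.ofReal (Real.log (1 / l)) * τ Set.univ * τ Set.univ) (by finiteness) ?_
  unfold mutualEnergy
  rw [lintegral_map (measurable_potential_logk _ _) hT, ← lintegral_const,
    ← lintegral_add_right _ measurable_const]
  refine lintegral_mono fun x => ?_
  rw [lintegral_map (measurable_logk measurable_const measurable_const measurable_id') hT,
    ← lintegral_const, ← lintegral_add_right _ measurable_const]
  refine lintegral_mono fun y => ?_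
  by_cases hxy : x = y
  · simp [hxy]
  have hs : 0 < ‖x - y‖ := norm_pos_iff.2 (sub_ne_zero.2 hxy)
  have hne : (l : ℂ) * x ≠ (l : ℂ) * y := by
    simpa [hxy] using hl0.ne'
  rw [logk_of_ne hxy, logk_of_ne hne]
  refine le_trans (ENNReal.ofReal_le_ofReal ?_) ENNReal.ofReal_add_le
  rw [← mul_sub, norm_mul, Complex.norm_real, Real.norm_of_nonneg hl0.le,
    ← Real.log_mul (by positivity) (by positivity)]
  refine (congrArg Real.log ?_).le
  field_simp

/-- At almost every point the field potential of the minimizer is at most its value at the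
dilated point. -/
theorem ae_fieldPotential_le_smul {u : ℂ → ℝ≥0∞} (hu : Measurable u) {μ : Measure ℂ}
    (hμ : IsProbabilityOn (closedBall 0 ρ) μ) (hfin : fieldEnergy (logk (2 * ρ)) u μ ≠ ⊤)
    (hmin : ∀ μ', IsProbabilityOn (closedBall 0 ρ) μ' →
      fieldEnergy (logk (2 * ρ)) u μ ≤ fieldEnergy (logk (2 * ρ)) u μ')
    (hl0 : 0 < l) (hl1 : l < 1) (hρ : 0 < ρ) :
    ∀ᵐ x ∂μ, x ∈ closedBall (0 : ℂ) ρ → fieldPotential (logk (2 * ρ)) u μ x ≤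
      fieldPotential (logk (2 * ρ)) u μ ((l : ℂ) * x) := by
  have hT : Measurable fun p : ℂ × ℝ => (l : ℂ) * p.1 := by fun_prop
  -- The displacement is deterministic; `circleProb` serves only as a dummy probability space.
  have h := ae_fieldPotential_le_of_isMin (K := logk (2 * ρ)) (u := u) (P := circleProb)
    (T := fun p : ℂ × ℝ => (l : ℂ) * p.1) (measurable_uncurry_logk _) (logk_comm _)
    hu hμ hfin hmin (A := closedBall 0 ρ) measurableSet_closedBall measurableSet_closedBall hT
    (fun x hx _ => ball_subset_closedBall
      (smul_mem_ball hρ hl0 hl1 (mem_closedBall_zero_iff.1 hx)))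
    (fun τ _ _ hE => by
      have heq : (τ.prod circleProb).map (fun p : ℂ × ℝ => (l : ℂ) * p.1) =
          τ.map fun x => (l : ℂ) * x := by
        have h1 : (τ.prod circleProb).map Prod.fst = τ := by
          rw [Measure.map_fst_prod, measure_univ, one_smul]
        conv_rhs => rw [← h1]
        rw [Measure.map_map (by fun_prop) measurable_fst]
        rfl
      rw [heq]
      exact mutualEnergy_map_smul_ne_top hl0 hρ hE)
  filter_upwards [h] with x hx hxm
  simpa using hx hxm

/-- Add the potential of `κ` to the inequality between `z` and `l z`. Then `μ + κ = t μV` appears,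
and `t` times the Euler-Lagrange equation at both points removes it together with `t g`. What
remains are the radial increments of `η`, `ν`, `κ` and `R`. -/
theorem lintegral_log_le_of_fieldPotential_le (hρ : 0 < ρ) (ht : 0 < t) (hl0 : 0 < l)
    (hl1 : l < 1) (hz : ‖z‖ = ρ) [IsFiniteMeasure μV] [IsFiniteMeasure μ] [IsFiniteMeasure η]
    [IsFiniteMeasure κ] [IsFiniteMeasure ν]
    (hgb : ∀ z ∈ closedBall (0 : ℂ) ρ, 0 ≤ g z + b) (hc : c ≠ ⊤)
    (huReq : ∀ z ∈ closedBall (0 : ℂ) ρ, uR z = ENNReal.ofReal (t * g z + 2 * R z + b₁))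
    (huR0 : ∀ z ∈ closedBall (0 : ℂ) ρ, 0 ≤ t * g z + 2 * R z + b₁)
    (hν : ν (ball 0 ρ) = 0) (hη : η (sphere 0 ρ)ᶜ = 0) (hsum : μW = μ + η)
    (hκ : μ + κ = ENNReal.ofReal t • μV) (hκC : κ ≤ C • volume) (hκb : κ (ball 0 ρ)ᶜ = 0)
    (hGz : fieldPotential (logk (2 * ρ)) (fun z => ENNReal.ofReal (g z + b)) μV z = c)
    (hGlz : fieldPotential (logk (2 * ρ)) (fun z => ENNReal.ofReal (g z + b)) μV ((l : ℂ) * z) = c)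
    (hfin : fieldPotential (logk (2 * ρ)) (fun z => uR z + 2 * normalizedPotential ρ ν z) μW z ≠ ⊤)
    (hle : fieldPotential (logk (2 * ρ)) (fun z => uR z + 2 * normalizedPotential ρ ν z) μW z ≤
      fieldPotential (logk (2 * ρ)) (fun z => uR z + 2 * normalizedPotential ρ ν z) μW
        ((l : ℂ) * z))
    {J I : ℝ} (hJ0 : 0 ≤ J) (hI0 : 0 ≤ I)
    (hJ : ENNReal.ofReal J ≤
      ∫⁻ w, ENNReal.ofReal (Real.log (1 + (1 - l) ^ 2 * ρ ^ 2 / l / ‖z - w‖ ^ 2) / 2) ∂η)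
    (hI : ∫⁻ w in radialCap ρ l z, ENNReal.ofReal (‖z - w‖⁻¹) ≤ ENNReal.ofReal I) :
    2 * J ≤ Real.log (1 / l) * (η.real Set.univ + ν.real Set.univ) +
      2 * (R ((l : ℂ) * z) - R z) + 2 * ((1 - l) * ρ * (C * I)) := by
  have hzm : z ∈ closedBall (0 : ℂ) ρ := mem_closedBall_zero_iff.2 hz.le
  have hlzb : (l : ℂ) * z ∈ ball (0 : ℂ) ρ := smul_mem_ball hρ hl0 hl1 hz.le
  have hlzm := ball_subset_closedBall hlzb
  have hlog : 0 ≤ Real.log (1 / l) := Real.log_nonneg ((one_le_div hl0).2 hl1.le)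
  simp only [fieldPotential, hsum, lintegral_add_measure, huReq z hzm,
    huReq _ hlzm] at hfin hle
  simp only [ne_eq, ENNReal.add_eq_top, ENNReal.mul_eq_top, not_or, OfNat.ofNat_ne_zero,
    not_false_eq_true, true_and, ENNReal.ofNat_ne_top, false_and, or_false] at hfin
  obtain ⟨⟨hμz, hηz⟩, -, hNz⟩ := hfin
  have hatom := measure_singleton_eq_zero_of_potential_ne_top hηz
  have e1 := potential_smul_add_le_of_sphere hη hl0 hl1 hz hρ hatom
  have e2 := normalizedPotential_smul_le hν hl0 hl1 hz hρ
  have e3 := potential_le_smul_add_of_le_volume hκC hκb hl1 hz hρ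
  have eP : ∀ x, ∫⁻ w, logk (2 * ρ) x w ∂μ + ∫⁻ w, logk (2 * ρ) x w ∂κ =
      ENNReal.ofReal t * ∫⁻ w, logk (2 * ρ) x w ∂μV := by
    intro x
    rw [← lintegral_add_measure, hκ, lintegral_smul_measure, smul_eq_mul]
  have hPV : ∀ x, fieldPotential (logk (2 * ρ)) (fun z => ENNReal.ofReal (g z + b)) μV x = c →
      ∫⁻ w, logk (2 * ρ) x w ∂μV ≠ ⊤ := by
    intro x hx h
    rw [fieldPotential, h, ENNReal.mul_top (by simp), top_add] at hx
    exact hc hx.symm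
  have hVz := hPV _ hGz
  have hVlz := hPV _ hGlz
  have eV : 2 * ∫⁻ w, logk (2 * ρ) z w ∂μV + ENNReal.ofReal (g z + b) =
      2 * ∫⁻ w, logk (2 * ρ) ((l : ℂ) * z) w ∂μV + ENNReal.ofReal (g ((l : ℂ) * z) + b) :=
    hGz.trans hGlz.symm
  have hκz : ∫⁻ w, logk (2 * ρ) z w ∂κ ≠ ⊤ := ne_top_of_le_ne_top
    (ENNReal.mul_ne_top ENNReal.ofReal_ne_top hVz) (le_add_self.trans (eP z).le)
  have hκlz : ∫⁻ w, logk (2 * ρ) ((l : ℂ) * z) w ∂κ ≠ ⊤ := ne_top_of_le_ne_top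
    (ENNReal.mul_ne_top ENNReal.ofReal_ne_top hVlz) (le_add_self.trans (eP _).le)
  have hμlz : ∫⁻ w, logk (2 * ρ) ((l : ℂ) * z) w ∂μ ≠ ⊤ := ne_top_of_le_ne_top
    (ENNReal.mul_ne_top ENNReal.ofReal_ne_top hVlz) (le_self_add.trans (eP _).le)
  have hηlz : ∫⁻ w, logk (2 * ρ) ((l : ℂ) * z) w ∂η ≠ ⊤ :=
    ne_top_of_le_ne_top (by finiteness) (le_self_add.trans e1)
  have hNlz : normalizedPotential ρ ν ((l : ℂ) * z) ≠ ⊤ :=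
    ne_top_of_le_ne_top (by finiteness) e2
  have e1' := (add_le_add_right hJ _).trans e1
  have e3' := e3.trans (add_le_add_right (mul_le_mul_right (mul_le_mul_right hI _) _) _)
  have ePz := eP z
  have ePlz := eP ((l : ℂ) * z)
  have hηu : η Set.univ = ENNReal.ofReal (η.real Set.univ) := (ofReal_measureReal).symm
  have hνu : ν Set.univ = ENNReal.ofReal (ν.real Set.univ) := (ofReal_measureReal).symm
  rw [hηu] at e1'
  rw [hνu] at e2
  have hCE : (C : ℝ≥0∞) = ENNReal.ofReal C := (ENNReal.ofReal_coe_nnreal).symm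
  rw [hCE] at e3'
  have hη0 : 0 ≤ η.real Set.univ := measureReal_nonneg
  have hν0 : 0 ≤ ν.real Set.univ := measureReal_nonneg
  clear eP hPV e1 e3 hGz hGlz hηu hνu hCE
  generalize η.real Set.univ = nη at *
  generalize ν.real Set.univ = nν at *
  have tor : ∀ x : ℝ≥0∞, x ≠ ⊤ → ∃ y : ℝ, 0 ≤ y ∧ x = ENNReal.ofReal y := fun x hx =>
    ⟨x.toReal, ENNReal.toReal_nonneg, (ENNReal.ofReal_toReal hx).symm⟩
  obtain ⟨pμ, pμ0, pμe⟩ := tor _ hμz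
  obtain ⟨pμ', pμ0', pμe'⟩ := tor _ hμlz
  obtain ⟨pη, pη0, pηe⟩ := tor _ hηz
  obtain ⟨pη', pη0', pηe'⟩ := tor _ hηlz
  obtain ⟨pκ, pκ0, pκe⟩ := tor _ hκz
  obtain ⟨pκ', pκ0', pκe'⟩ := tor _ hκlz
  obtain ⟨pV, pV0, pVe⟩ := tor _ hVz
  obtain ⟨pV', pV0', pVe'⟩ := tor _ hVlz
  obtain ⟨N, N0, Ne⟩ := tor _ hNz
  obtain ⟨N', N0', Ne'⟩ := tor _ hNlz
  have hgz := hgb z hzm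
  have hglz := hgb _ hlzm
  have huz := huR0 z hzm
  have hulz := huR0 _ hlzm
  have h2 : (2 : ℝ≥0∞) = ENNReal.ofReal 2 := by simp
  have hl' : 0 ≤ 1 - l := by linarith
  have hC0 : (0 : ℝ) ≤ C := C.2
  rw [pηe, pηe', ← ENNReal.ofReal_mul (by positivity), ← ENNReal.ofReal_add (by positivity)
    (by positivity), ← ENNReal.ofReal_add (by positivity) (by positivity),
    ENNReal.ofReal_le_ofReal_iff (by positivity)] at e1'
  rw [Ne, Ne', ← ENNReal.ofReal_mul (by positivity), ← ENNReal.ofReal_add (by positivity)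
    (by positivity), ENNReal.ofReal_le_ofReal_iff (by positivity)] at e2
  rw [pκe, pκe', ← ENNReal.ofReal_mul (by positivity), ← ENNReal.ofReal_mul (by positivity),
    ← ENNReal.ofReal_add (by positivity) (by positivity),
    ENNReal.ofReal_le_ofReal_iff (by positivity)] at e3'
  rw [pμe, pκe, pVe, ← ENNReal.ofReal_mul (by positivity), ← ENNReal.ofReal_add (by positivity)
    (by positivity), ENNReal.ofReal_eq_ofReal_iff (by positivity) (by positivity)] at ePz
  rw [pμe', pκe', pVe', ← ENNReal.ofReal_mul (by positivity), ← ENNReal.ofReal_add (by positivity)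
    (by positivity), ENNReal.ofReal_eq_ofReal_iff (by positivity) (by positivity)] at ePlz
  rw [pVe, pVe', h2, ← ENNReal.ofReal_mul (by positivity), ← ENNReal.ofReal_mul (by positivity),
    ← ENNReal.ofReal_add (by positivity) (by positivity),
    ← ENNReal.ofReal_add (by positivity) (by positivity),
    ENNReal.ofReal_eq_ofReal_iff (by positivity) (by positivity)] at eV
  rw [pμe, pμe', pηe, pηe', Ne, Ne', h2, ← ENNReal.ofReal_mul (by positivity),
    ← ENNReal.ofReal_mul (by positivity),
    ← ENNReal.ofReal_add (by positivity) (by positivity),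
    ← ENNReal.ofReal_mul (by positivity),
    ← ENNReal.ofReal_add (by positivity) (by positivity),
    ← ENNReal.ofReal_add (by positivity) (by positivity),
    ← ENNReal.ofReal_add (by positivity) (by positivity),
    ← ENNReal.ofReal_mul (by positivity),
    ← ENNReal.ofReal_add (by positivity) (by positivity),
    ← ENNReal.ofReal_add (by positivity) (by positivity),
    ENNReal.ofReal_le_ofReal_iff (by positivity)] at hle
  -- With the equation already multiplied by `t`, all the remaining relations combine linearly.
  have eVt : t * (2 * pV + (g z + b)) = t * (2 * pV' + (g ((l : ℂ) * z) + b)) := by rw [eV]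
  linarith

/-- The density inequality at a boundary point, from the radial inequalities at that point. -/
theorem density_le_of_radial_le (hρ : 0 < ρ) (hz : ‖z‖ = ρ) [IsFiniteMeasure η] {M r₀ : ℝ}
    (hM : 0 ≤ M) (hm : 0 ≤ m) (hatom : η {z} = 0) (hd : HasInnerNormalDeriv R d z) (hr₀ : 0 < r₀)
    (hdens : ∀ r ∈ Set.Ioo 0 r₀, ENNReal.ofReal (m * (2 * r)) ≤ η (closedBall z r))
    {h : ℕ → ℝ} (hh0 : ∀ n, 0 < h n) (hh1 : ∀ n, h n < 1) (hh : Tendsto h atTop (𝓝 0))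
    (hrad : ∀ n, ∀ J I : ℝ, 0 ≤ J → 0 ≤ I →
      ENNReal.ofReal J ≤ ∫⁻ w, ENNReal.ofReal
        (Real.log (1 + (1 - (1 - h n)) ^ 2 * ρ ^ 2 / (1 - h n) / ‖z - w‖ ^ 2) / 2) ∂η →
      ∫⁻ w in radialCap ρ (1 - h n) z, ENNReal.ofReal (‖z - w‖⁻¹) ≤ ENNReal.ofReal I →
      2 * J ≤ Real.log (1 / (1 - h n)) * M + 2 * (R (((1 - h n : ℝ) : ℂ) * z) - R z) +
        2 * ((1 - (1 - h n)) * ρ * (C * I))) :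
    2 * Real.pi * ρ * m ≤ M - 2 * ρ * d := by
  have hl0 : ∀ n, 0 < 1 - h n := fun n => by linarith [hh1 n]
  have hl1 : ∀ n, 1 - h n < 1 := fun n => by linarith [hh0 n]
  have hl : Tendsto (fun n => 1 - h n) atTop (𝓝 1) := by
    simpa using hh.const_sub 1
  set I : ℕ → ℝ := fun n =>
    (∫⁻ w in radialCap ρ (1 - h n) z, ENNReal.ofReal (‖z - w‖⁻¹)).toReal with hI
  have hIlim : Tendsto I atTop (𝓝 0) := by
    have := (ENNReal.tendsto_toReal ENNReal.zero_ne_top).comp (tendsto_lintegral_radialCap hz hl1 hl)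
    simpa [Function.comp_def] using this
  have hIfin : ∀ n, ∫⁻ w in radialCap ρ (1 - h n) z, ENNReal.ofReal (‖z - w‖⁻¹) ≠ ⊤ := fun n =>
    ne_top_of_le_ne_top (lintegral_inv_norm_sub_ne_top hz)
      (lintegral_mono_set fun w hw => hw.1)
  -- Chosen so that `a n ^ 2` is the constant in the logarithm for `l = 1 - h n`.
  set a : ℕ → ℝ := fun n => h n * (ρ / √(1 - h n)) with ha
  have ha0 : ∀ n, 0 < a n := fun n =>
    mul_pos (hh0 n) (div_pos hρ (Real.sqrt_pos.2 (hl0 n)))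
  have hasq : ∀ n, a n ^ 2 = (1 - (1 - h n)) ^ 2 * ρ ^ 2 / (1 - h n) := by
    intro n
    simp only [ha]
    rw [mul_pow, div_pow, Real.sq_sqrt (hl0 n).le]
    ring
  have hqlim : Tendsto (fun n => ρ / √(1 - h n)) atTop (𝓝 ρ) := by
    have h1 : Tendsto (fun n => √(1 - h n)) atTop (𝓝 1) := by
      simpa [Function.comp_def] using (Real.continuous_sqrt.tendsto 1).comp hl
    simpa [Pi.div_def] using (tendsto_const_nhds (x := ρ)).div h1 one_ne_zero
  have halim : Tendsto a atTop (𝓝[>] 0) := by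
    refine tendsto_nhdsWithin_iff.2 ⟨?_, Eventually.of_forall ha0⟩
    simpa using hh.mul hqlim
  have hatan : Tendsto (fun n => Real.arctan (r₀ / a n)) atTop (𝓝 (Real.pi / 2)) := by
    refine (Real.tendsto_arctan_atTop.mono_right nhdsWithin_le_nhds).comp ?_
    simp_rw [div_eq_mul_inv]
    exact (tendsto_inv_nhdsGT_zero.comp halim).const_mul_atTop hr₀
  have hRlim : Tendsto (fun n => (R (((1 - h n : ℝ) : ℂ) * z) - R z) / h n) atTop
      (𝓝 (-(ρ * d))) := by
    have hε : Tendsto (fun n => h n * ρ) atTop (𝓝[>] 0) := by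
      refine tendsto_nhdsWithin_iff.2 ⟨by simpa using hh.mul_const ρ, Eventually.of_forall
        fun n => mul_pos (hh0 n) hρ⟩
    have h1 := ((hd.comp hε).const_mul ρ).neg
    refine h1.congr fun n => ?_
    have h2 : z - ((h n * ρ : ℝ) : ℂ) * (z / (‖z‖ : ℂ)) = ((1 - h n : ℝ) : ℂ) * z := by
      have : (ρ : ℂ) ≠ 0 := by exact_mod_cast hρ.ne'
      rw [hz]
      push_cast
      field_simp
    simp only [Function.comp_apply]
    rw [h2]
    have := (hh0 n).ne'
    field_simp
    ring
  -- The radial inequality divided by `h n`. As `n` grows the arctangent tends to `π / 2`, so the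
  -- left side tends to `2 * π * ρ * m`.
  have hineq : ∀ n, 4 * m * (ρ / √(1 - h n)) * Real.arctan (r₀ / a n) ≤
      M / (1 - h n) + 2 * ((R (((1 - h n : ℝ) : ℂ) * z) - R z) / h n) + 2 * (ρ * (C * I n)) := by
    intro n
    have hat : 0 ≤ Real.arctan (r₀ / a n) := Real.arctan_nonneg.2 (div_nonneg hr₀.le (ha0 n).le)
    have h1 := hrad n (2 * m * (a n * Real.arctan (r₀ / a n))) (I n)
      (mul_nonneg (by positivity) (mul_nonneg (ha0 n).le hat)) ENNReal.toReal_nonneg ?_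
      (by rw [hI, ENNReal.ofReal_toReal (hIfin n)])
    · have h2 : Real.log (1 / (1 - h n)) ≤ h n / (1 - h n) := by
        have := Real.log_le_sub_one_of_pos (one_div_pos.2 (hl0 n))
        refine this.trans (le_of_eq ?_)
        have := (hl0 n).ne'
        field_simp
        ring
      have h3 := mul_le_mul_of_nonneg_right h2 hM
      rw [← mul_le_mul_iff_of_pos_left (hh0 n)]
      have h4 : h n * (4 * m * (ρ / √(1 - h n)) * Real.arctan (r₀ / a n)) =
          2 * (2 * m * (a n * Real.arctan (r₀ / a n))) := by
        simp only [ha]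
        ring
      have h5 : h n * (M / (1 - h n) + 2 * ((R (((1 - h n : ℝ) : ℂ) * z) - R z) / h n) +
          2 * (ρ * (C * I n))) = h n / (1 - h n) * M + 2 * (R (((1 - h n : ℝ) : ℂ) * z) - R z) +
            2 * ((1 - (1 - h n)) * ρ * (C * I n)) := by
        have := (hh0 n).ne'
        have := (hl0 n).ne'
        field_simp
        ring
      rw [h4, h5]
      linarith
    · rw [← hasq n]
      exact le_lintegral_log_of_density (ha0 n) hr₀ hm hatom hdens
  have hL : Tendsto (fun n => 4 * m * (ρ / √(1 - h n)) * Real.arctan (r₀ / a n)) atTop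
      (𝓝 (4 * m * ρ * (Real.pi / 2))) := (hqlim.const_mul (4 * m)).mul hatan
  have hRt : Tendsto (fun n => M / (1 - h n) + 2 * ((R (((1 - h n : ℝ) : ℂ) * z) - R z) / h n) +
      2 * (ρ * (C * I n))) atTop (𝓝 (M / 1 + 2 * (-(ρ * d)) + 2 * (ρ * (C * 0)))) :=
    ((tendsto_const_nhds.div hl one_ne_zero).add (hRlim.const_mul 2)).add
      (((hIlim.const_mul (C : ℝ)).const_mul ρ).const_mul 2)
  have := le_of_tendsto_of_tendsto' hL hRt hineq
  rw [div_one] at this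
  linarith

end Boundary

/-! ### Arclength of small balls centred on the circle -/

section Arclength

variable {ρ : ℝ} {z : ℂ}

instance (ρ : ℝ) : IsFiniteMeasure (arclength ρ) := by
  unfold arclength
  exact Measure.smul_finite _ ENNReal.ofReal_ne_top

/-- A chord is no longer than its arc, so the ball contains the arc of half-angle `r / ρ` around
`z`. By periodicity the parameter interval is recentred at `z.arg`, so that this arc does not wrap
around. -/
theorem le_arclength_closedBall (hρ : 0 < ρ) (hz : ‖z‖ = ρ) {r : ℝ} (hrρ : r ≤ ρ) :
    ENNReal.ofReal (2 * r) ≤ arclength ρ (closedBall z r) := by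
  have hm : Measurable (circleMap 0 ρ) := (continuous_circleMap 0 ρ).measurable
  set A := circleMap 0 ρ ⁻¹' closedBall z r with hA
  have hAm : MeasurableSet A := hm measurableSet_closedBall
  have hzα : circleMap 0 ρ z.arg = z := by
    rw [circleMap, zero_add, ← hz, Complex.norm_mul_exp_arg_mul_I]
  have hinv : ∀ g : AddSubgroup.zmultiples (2 * Real.pi), (fun x : ℝ => g +ᵥ x) ⁻¹' A = A := by
    rintro ⟨g, hg⟩
    obtain ⟨n, rfl⟩ := AddSubgroup.mem_zmultiples_iff.1 hg
    ext θ
    have h1 : circleMap 0 ρ (θ + n • (2 * Real.pi)) = circleMap 0 ρ θ :=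
      (periodic_circleMap 0 ρ).zsmul n θ
    change circleMap 0 ρ (n • (2 * Real.pi) + θ) ∈ closedBall z r ↔
      circleMap 0 ρ θ ∈ closedBall z r
    rw [add_comm, h1]
  have hdom := (isAddFundamentalDomain_Ioc Real.two_pi_pos 0 volume).measure_set_eq
    (isAddFundamentalDomain_Ioc Real.two_pi_pos (z.arg - Real.pi) volume) hAm hinv
  rw [zero_add] at hdom
  rw [arclength, Measure.smul_apply, Measure.map_apply hm measurableSet_closedBall,
    Measure.restrict_apply hAm, hdom, smul_eq_mul]
  have hsub : Set.Ioc (z.arg - r / ρ) (z.arg + r / ρ) ⊆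
      A ∩ Set.Ioc (z.arg - Real.pi) (z.arg - Real.pi + 2 * Real.pi) := by
    intro θ hθ
    have hrρ' : r / ρ ≤ 1 := (div_le_one hρ).2 hrρ
    have hpi := Real.pi_gt_three
    refine ⟨?_, by linarith [hθ.1], by linarith [hθ.2]⟩
    have h1 := (lipschitzWith_circleMap 0 ρ).dist_le_mul θ z.arg
    rw [hzα, Real.coe_nnabs, abs_of_pos hρ] at h1
    have h2 : dist θ z.arg ≤ r / ρ := by
      rw [Real.dist_eq, abs_le]
      constructor <;> linarith [hθ.1, hθ.2]
    refine mem_closedBall.2 (h1.trans ?_)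
    calc ρ * dist θ z.arg ≤ ρ * (r / ρ) := by gcongr
      _ = r := by field_simp
  calc ENNReal.ofReal (2 * r) = ENNReal.ofReal ρ *
        volume (Set.Ioc (z.arg - r / ρ) (z.arg + r / ρ)) := by
        rw [Real.volume_Ioc, ← ENNReal.ofReal_mul hρ.le]
        congr 1
        field_simp
        ring
    _ ≤ _ := by gcongr

end Arclength

end LogPotential

namespace LogPotential

/-! ### From lower densities to absolute continuity and the essential supremum -/

section BoundaryDensity

variable {ρ M : ℝ} {η : Measure ℂ} {D : ℂ → ℝ}

theorem ae_mem_sphere_arclength (hρ : 0 < ρ) : ∀ᵐ z ∂(arclength ρ), z ∈ sphere (0 : ℂ) ρ := by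
  have hm : Measurable (circleMap 0 ρ) := (continuous_circleMap 0 ρ).measurable
  refine Measure.ae_smul_measure ?_ _
  refine (ae_map_iff (p := fun z => z ∈ sphere (0 : ℂ) ρ) hm.aemeasurable
    isClosed_sphere.measurableSet).2 ?_
  exact Eventually.of_forall fun θ => circleMap_mem_sphere 0 hρ.le θ

/-- The bound on lower densities implied by the boundary inequality with data `M` and `D`. -/
def HasDensityBound (ρ M : ℝ) (D : ℂ → ℝ) (η : Measure ℂ) (z : ℂ) : Prop :=
  ∀ m r₀ : ℝ, 0 ≤ m → 0 < r₀ →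
    (∀ r ∈ Set.Ioo 0 r₀, ENNReal.ofReal (m * (2 * r)) ≤ η (closedBall z r)) →
    2 * Real.pi * ρ * m ≤ M - 2 * ρ * D z

theorem HasDensityBound.le_of_eventually {z : ℂ} (h : HasDensityBound ρ M D η z) {m : ℝ}
    (hm : 0 ≤ m)
    (hev : ∀ᶠ r in 𝓝[>] (0 : ℝ), ENNReal.ofReal (m * (2 * r)) ≤ η (closedBall z r)) :
    2 * Real.pi * ρ * m ≤ M - 2 * ρ * D z := by
  obtain ⟨r₀, hr₀, hball⟩ := mem_nhdsGT_iff_exists_Ioo_subset.1 hev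
  exact h m r₀ hm hr₀ fun r hr => hball hr

/-- On a null set of arclength the density of arclength with respect to `η` vanishes `η`-almost
everywhere. There every `m` is eventually a lower density of `η`, which contradicts the finite
bound. -/
theorem absolutelyContinuous_arclength (hρ : 0 < ρ) [IsFiniteMeasure η]
    (hη : η (sphere 0 ρ)ᶜ = 0) (h : ∀ᵐ z ∂η, HasDensityBound ρ M D η z) : η ≪ arclength ρ := by
  refine Measure.AbsolutelyContinuous.mk fun N hN hN0 => ?_
  have hzero : ∀ᵐ z ∂η, z ∈ N → (arclength ρ).rnDeriv η z = 0 := by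
    have h1 : ∫⁻ z in N, (arclength ρ).rnDeriv η z ∂η = 0 :=
      le_antisymm ((Measure.setLIntegral_rnDeriv_le N).trans hN0.le) zero_le
    rw [lintegral_eq_zero_iff (Measure.measurable_rnDeriv _ _)] at h1
    exact (ae_restrict_iff' hN).1 h1
  have hS : ∀ᵐ z ∂η, z ∈ sphere (0 : ℂ) ρ := mem_ae_iff.2 hη
  have hnot : ∀ᵐ z ∂η, z ∉ N := by
    filter_upwards [hzero, h, hS, Besicovitch.ae_tendsto_rnDeriv (arclength ρ) η,
      Measure.support_mem_ae (μ := η)] with z hz0 hb hzS hlim hsupp hzN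
    rw [mem_sphere_zero_iff_norm] at hzS
    rw [hz0 hzN] at hlim
    -- This choice makes `2 * π * ρ * m` exceed `M - 2 * ρ * D z` by at least `2 * π * ρ`.
    set m : ℝ := |M - 2 * ρ * D z| / (2 * Real.pi * ρ) + 1 with hm
    have hpos : 0 < 2 * Real.pi * ρ := by positivity
    have hm0 : 0 < m := by positivity
    have hle := hb.le_of_eventually hm0.le (by
      have h1 : (0 : ℝ≥0∞) < ENNReal.ofReal m⁻¹ := ENNReal.ofReal_pos.2 (inv_pos.2 hm0)
      have h2 : ∀ᶠ r in 𝓝[>] (0 : ℝ), r ≤ ρ :=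
        (eventually_le_nhds hρ).filter_mono nhdsWithin_le_nhds
      filter_upwards [hlim.eventually_lt_const h1, self_mem_nhdsWithin, h2] with r hr hr0 hrρ
      have hr0 : 0 < r := hr0
      have hBpos := (Measure.mem_support_iff_forall z).1 hsupp _ (closedBall_mem_nhds z hr0)
      have h3 := (ENNReal.div_le_iff hBpos.ne' (measure_ne_top _ _)).1 hr.le
      have h4 := (le_arclength_closedBall hρ hzS hrρ).trans h3
      calc ENNReal.ofReal (m * (2 * r)) = ENNReal.ofReal m * ENNReal.ofReal (2 * r) :=
            ENNReal.ofReal_mul hm0.le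
        _ ≤ ENNReal.ofReal m * (ENNReal.ofReal m⁻¹ * η (closedBall z r)) := by gcongr
        _ = η (closedBall z r) := by
            rw [← mul_assoc, ← ENNReal.ofReal_mul hm0.le, mul_inv_cancel₀ hm0.ne',
              ENNReal.ofReal_one, one_mul])
    have h5 : 2 * Real.pi * ρ * m = |M - 2 * ρ * D z| + 2 * Real.pi * ρ := by
      rw [hm]
      field_simp
    linarith [le_abs_self (M - 2 * ρ * D z)]
  have := mem_ae_iff.1 hnot
  exact measure_mono_null (fun z hz => by simpa using hz) this

theorem rnDeriv_arclength_le (hρ : 0 < ρ) [IsFiniteMeasure η]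
    (h : ∀ᵐ z ∂η, HasDensityBound ρ M D η z) :
    ∀ᵐ z ∂(arclength ρ), η.rnDeriv (arclength ρ) z ≤
      ENNReal.ofReal ((M - 2 * ρ * D z) / (2 * Real.pi * ρ)) := by
  -- The bound is known only `η`-almost everywhere, hence arclength-almost everywhere where the
  -- density of `η` is nonzero; elsewhere there is nothing to prove.
  have hb : ∀ᵐ z ∂(arclength ρ), η.rnDeriv (arclength ρ) z ≠ 0 → HasDensityBound ρ M D η z :=
    (ae_withDensity_iff (Measure.measurable_rnDeriv _ _)).1
      (ae_mono (Measure.withDensity_rnDeriv_le η (arclength ρ)) h)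
  have hpos : 0 < 2 * Real.pi * ρ := by positivity
  filter_upwards [hb, ae_mem_sphere_arclength hρ,
    Besicovitch.ae_tendsto_rnDeriv η (arclength ρ)] with z hz hzS hlim
  rw [mem_sphere_zero_iff_norm] at hzS
  refine ENNReal.le_of_forall_nnreal_lt fun m hm => ?_
  have hbz := hz (bot_lt_iff_ne_bot.1 (bot_le.trans_lt hm))
  have hle := hbz.le_of_eventually m.2 (by
    have h2 : ∀ᶠ r in 𝓝[>] (0 : ℝ), r ≤ ρ :=
      (eventually_le_nhds hρ).filter_mono nhdsWithin_le_nhds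
    filter_upwards [hlim.eventually_const_lt hm, h2] with r hr hrρ
    rw [ENNReal.ofReal_mul m.2]
    change ENNReal.ofReal (m : ℝ) * _ ≤ _
    rw [ENNReal.ofReal_coe_nnreal]
    refine le_trans ?_ (ENNReal.mul_le_of_le_div hr.le)
    gcongr
    exact le_arclength_closedBall hρ hzS hrρ)
  rw [← ENNReal.ofReal_coe_nnreal]
  refine ENNReal.ofReal_le_ofReal ((le_div_iff₀ hpos).2 ?_)
  change 2 * Real.pi * ρ * (m : ℝ) ≤ _ at hle
  linarith

theorem essSup_rnDeriv_arclength_le (hρ : 0 < ρ) [IsFiniteMeasure η] {ν : Measure ℂ}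
    [IsFiniteMeasure ν]
    (h : ∀ᵐ z ∂η, HasDensityBound ρ (η.real Set.univ + ν.real Set.univ) D η z) :
    ENNReal.ofReal ρ * essSup (η.rnDeriv (arclength ρ)) (arclength ρ) ≤
      ENNReal.ofReal (1 / (2 * Real.pi)) * (η Set.univ + ν Set.univ +
        2 * ENNReal.ofReal ρ * eLpNorm D ⊤ (arclength ρ)) := by
  rw [← ENNReal.essSup_const_mul]
  refine essSup_le_of_ae_le _ ?_
  have hD : ∀ᵐ z ∂(arclength ρ), ‖D z‖ₑ ≤ eLpNorm D ⊤ (arclength ρ) := by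
    rw [eLpNorm_exponent_top]
    exact ae_le_eLpNormEssSup
  filter_upwards [rnDeriv_arclength_le hρ h, hD] with z hz hDz
  have hη0 : 0 ≤ η.real Set.univ := measureReal_nonneg
  have hν0 : 0 ≤ ν.real Set.univ := measureReal_nonneg
  calc ENNReal.ofReal ρ * η.rnDeriv (arclength ρ) z
      ≤ ENNReal.ofReal ρ * ENNReal.ofReal
        ((η.real Set.univ + ν.real Set.univ - 2 * ρ * D z) / (2 * Real.pi * ρ)) := by gcongr
    _ ≤ ENNReal.ofReal (1 / (2 * Real.pi) *
          (η.real Set.univ + ν.real Set.univ + 2 * ρ * |D z|)) := by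
        rw [← ENNReal.ofReal_mul hρ.le]
        refine ENNReal.ofReal_le_ofReal ?_
        have h1 : ρ * ((η.real Set.univ + ν.real Set.univ - 2 * ρ * D z) / (2 * Real.pi * ρ)) =
            1 / (2 * Real.pi) * (η.real Set.univ + ν.real Set.univ + 2 * ρ * (-D z)) := by
          have := Real.pi_pos
          field_simp
          ring
        rw [h1]
        gcongr
        exact neg_le_abs _
    _ = ENNReal.ofReal (1 / (2 * Real.pi)) * (η Set.univ + ν Set.univ +
          2 * ENNReal.ofReal ρ * ‖D z‖ₑ) := by
        rw [ENNReal.ofReal_mul (by positivity), ENNReal.ofReal_add (by positivity) (by positivity),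
          ENNReal.ofReal_add hη0 hν0, ENNReal.ofReal_mul (by positivity),
          ENNReal.ofReal_mul (by positivity), ofReal_measureReal, ofReal_measureReal,
          Real.enorm_eq_ofReal_abs]
        simp
    _ ≤ _ := by gcongr

end BoundaryDensity

/-! ### The perturbed potential as a nonnegative field minus a constant -/

section Perturbed

variable {ρ t b₁ : ℝ} {V : ℂ → EReal} {g R : ℂ → ℝ} {ν : Measure ℂ}

theorem integrable_log_one_add_add [IsFiniteMeasure ν] (hρ : 0 < ρ)
    (hνlog : Integrable (fun w : ℂ => Real.log (1 + ‖w‖)) ν) :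
    Integrable (fun w : ℂ => Real.log (1 + ρ + ‖w‖)) ν := by
  refine Integrable.mono' ((integrable_const (Real.log (1 + ρ))).add hνlog)
    (Measurable.aestronglyMeasurable (by fun_prop)) (Eventually.of_forall fun w => ?_)
  have hw := norm_nonneg w
  rw [Real.norm_of_nonneg (Real.log_nonneg (by linarith))]
  simp only [Pi.add_apply]
  rw [← Real.log_mul (by positivity) (by positivity)]
  exact Real.log_le_log (by positivity) (by nlinarith)

/-- The truncation radius `1 + ρ + ‖w‖` exceeds the distance from `w` to every point of the disk,
and its logarithm is nonnegative and `ν`-integrable. -/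
theorem potential_eq_normalizedPotential_sub [IsFiniteMeasure ν] (hρ : 0 < ρ)
    (hνlog : Integrable (fun w : ℂ => Real.log (1 + ‖w‖)) ν) {z : ℂ} (hz : ‖z‖ ≤ ρ) :
    potential ν z = (normalizedPotential ρ ν z : EReal) -
      ((∫ w, Real.log (1 + ρ + ‖w‖) ∂ν : ℝ) : EReal) := by
  unfold potential normalizedPotential
  rw [← eintegral_coe_sub (measurable_logk (by fun_prop) measurable_const measurable_id')
    (integrable_log_one_add_add hρ hνlog) (by fun_prop)
    (fun w => Real.log_nonneg (by linarith [norm_nonneg w]))]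
  congr 1
  ext w
  have hw := norm_nonneg w
  exact logKernel_eq_logk_sub (by positivity) (by linarith [norm_sub_le z w])

theorem perturbed_eq [IsFiniteMeasure ν] (hρ : 0 < ρ)
    (hνlog : Integrable (fun w : ℂ => Real.log (1 + ‖w‖)) ν)
    (hV : ∀ z ∈ closedBall (0 : ℂ) ρ, V z = (g z : EReal))
    (h0 : ∀ z ∈ closedBall (0 : ℂ) ρ, 0 ≤ t * g z + 2 * R z + b₁) {z : ℂ}
    (hz : z ∈ closedBall (0 : ℂ) ρ) :
    perturbed ρ t V ν R z =
      ((ENNReal.ofReal (t * g z + 2 * R z + b₁) + 2 * normalizedPotential ρ ν z : ℝ≥0∞) : EReal) -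
        ((b₁ + 2 * ∫ w, Real.log (1 + ρ + ‖w‖) ∂ν : ℝ) : EReal) := by
  unfold perturbed
  rw [if_pos hz, hV z hz,
    potential_eq_normalizedPotential_sub hρ hνlog (mem_closedBall_zero_iff.1 hz)]
  generalize normalizedPotential ρ ν z = N
  generalize ∫ w, Real.log (1 + ρ + ‖w‖) ∂ν = B
  have h2 : (2 : EReal) = ((2 : ℝ) : EReal) := rfl
  have hr := h0 z hz
  induction N with
  | top =>
    rw [ENNReal.mul_top (by simp), add_top, EReal.coe_ennreal_top, EReal.top_sub_coe,
      EReal.top_sub_coe, h2, EReal.coe_mul_top_of_pos (by norm_num), ← EReal.coe_mul,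
      ← EReal.coe_mul, EReal.coe_add_top, EReal.top_add_coe]
  | coe N =>
    have h3 : ENNReal.ofReal (t * g z + 2 * R z + b₁) + 2 * (N : ℝ≥0∞) =
        ((Real.toNNReal (t * g z + 2 * R z + b₁) + 2 * N : ℝ≥0) : ℝ≥0∞) := by
      push_cast
      rfl
    rw [h3]
    change (t : EReal) * (g z : EReal) + 2 * (((N : ℝ) : EReal) - (B : EReal)) +
      2 * (R z : EReal) =
      (((Real.toNNReal (t * g z + 2 * R z + b₁) + 2 * N : ℝ≥0) : ℝ) : EReal) -
        ((b₁ + 2 * B : ℝ) : EReal)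
    rw [h2]
    simp only [← EReal.coe_mul, ← EReal.coe_sub, ← EReal.coe_add]
    congr 1
    push_cast
    rw [Real.coe_toNNReal _ hr]
    ring

/-- The potential of `ν` is finite in the open disk. It may be infinite on the circle, but the
closure of the open disk already contains it. -/
theorem finitenessSet_perturbed [IsFiniteMeasure ν] (hρ : 0 < ρ)
    (hνlog : Integrable (fun w : ℂ => Real.log (1 + ‖w‖)) ν) (hν : ν (ball 0 ρ) = 0)
    (hV : ∀ z ∈ closedBall (0 : ℂ) ρ, V z = (g z : EReal))
    (h0 : ∀ z ∈ closedBall (0 : ℂ) ρ, 0 ≤ t * g z + 2 * R z + b₁) :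
    finitenessSet (perturbed ρ t V ν R) = closedBall 0 ρ := by
  unfold finitenessSet
  refine Set.Subset.antisymm (closure_minimal (fun z hz => ?_) isClosed_closedBall) ?_
  · by_contra hn
    simp only [perturbed, if_neg hn, Set.mem_ofPred_eq, lt_self_iff_false] at hz
  · rw [← closure_ball (0 : ℂ) hρ.ne']
    refine closure_mono fun z hz => ?_
    have hN := normalizedPotential_ne_top hρ hν (mem_ball_zero_iff.1 hz)
    rw [Set.mem_ofPred_eq, perturbed_eq hρ hνlog hV h0 (ball_subset_closedBall hz)]
    have hfin : ENNReal.ofReal (t * g z + 2 * R z + b₁) + 2 * normalizedPotential ρ ν z ≠ ⊤ := by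
      finiteness
    generalize ENNReal.ofReal (t * g z + 2 * R z + b₁) + 2 * normalizedPotential ρ ν z = N at hfin
    lift N to ℝ≥0 using hfin
    change ((N : ℝ) : EReal) - (_ : ℝ) < ⊤
    rw [← EReal.coe_sub]
    exact EReal.coe_lt_top _

end Perturbed

end LogPotential

namespace LogPotential

/-! ### Assembly of the proof -/

section Main

variable {ρ t : ℝ} {V : ℂ → EReal} {g R : ℂ → ℝ} {μV μW ν : Measure ℂ}

theorem exists_nonneg_add_of_continuousOn {f : ℂ → ℝ} (hf : ContinuousOn f (closedBall 0 ρ))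
    (a : ℝ) : ∃ b, (∀ z ∈ closedBall (0 : ℂ) ρ, 0 ≤ f z + b) ∧ 0 ≤ a + b := by
  obtain ⟨B, hB⟩ := (isCompact_closedBall (0 : ℂ) ρ).exists_bound_of_continuousOn hf
  refine ⟨|B| + |a|, fun z hz => ?_, by linarith [neg_abs_le a, abs_nonneg B]⟩
  have h1 := (abs_le.1 (hB z hz)).1
  linarith [le_abs_self B, abs_nonneg a]

/-- Euler-Lagrange equations and density bound for the equilibrium measure of a potential of
class `C^{1,1}` whose support is the closed disk. -/
theorem exists_const_of_isEquilibriumMeasure (hρ : 0 < ρ) (hg : Differentiable ℝ g)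
    (hgL : LocallyLipschitz (fderiv ℝ g)) (hV : ∀ z ∈ closedBall (0 : ℂ) ρ, V z = (g z : EReal))
    (hμV : IsEquilibriumMeasure V μV) (hsupp : μV.support = closedBall 0 ρ) (hac : μV ≪ volume) :
    ∃ (b : ℝ) (c : ℝ≥0∞) (C : ℝ≥0), (∀ z ∈ closedBall (0 : ℂ) ρ, 0 ≤ g z + b) ∧ c ≠ ⊤ ∧
      IsProbabilityOn (closedBall 0 ρ) μV ∧ μV ≤ C • volume ∧
      (∀ x ∈ ball (0 : ℂ) ρ,
        fieldPotential (logk (2 * ρ)) (fun z => ENNReal.ofReal (g z + b)) μV x = c) ∧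
      ∀ τ : Measure ℂ, IsFiniteMeasure τ → τ (closedBall 0 ρ)ᶜ = 0 →
        mutualEnergy (logk (2 * ρ)) τ τ ≠ ⊤ → ∀ᵐ x ∂τ,
          fieldPotential (logk (2 * ρ)) (fun z => ENNReal.ofReal (g z + b)) μV x = c := by
  have hgc := hg.continuous
  obtain ⟨b, hgb, hb⟩ := exists_nonneg_add_of_continuousOn (ρ := ρ) hgc.continuousOn
    (Real.log (2 * ρ))
  set u := fun z => ENNReal.ofReal (g z + b) with hu
  have huc : Continuous u := ENNReal.continuous_ofReal.comp (by fun_prop)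
  have hum : Measurable u := huc.measurable
  have hμS : μV (closedBall 0 ρ)ᶜ = 0 := by
    rw [← hsupp]
    exact Measure.measure_compl_support
  have hp : IsProbabilityOn (closedBall 0 ρ) μV := ⟨hμV.1.1, hμS⟩
  have := hp.1
  have hUu : ∀ z ∈ closedBall (0 : ℂ) ρ, V z = (u z : EReal) - (b : EReal) := by
    intro z hz
    rw [hV z hz, hu, EReal.coe_ennreal_ofReal, max_eq_left (hgb z hz), ← EReal.coe_sub]
    congr 1
    ring
  have hsub : closedBall 0 ρ ⊆ finitenessSet V := fun z hz =>
    subset_closure (by rw [Set.mem_ofPred_eq, hV z hz]; exact EReal.coe_lt_top _)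
  have hmin := isMin_fieldEnergy hρ hum hUu hb hsub hμV hμS
  have hfin : fieldEnergy (logk (2 * ρ)) u μV ≠ ⊤ := by
    refine fieldEnergy_ne_top_of_isMin (x := 0) (r := ρ) hum hρ (by simp) hmin ?_
    rw [lintegral_circleProb_ofReal (f := fun z => g z + b) hρ.le (by fun_prop)
      (fun z hz => hgb z (sphere_subset_closedBall hz))]
    exact ENNReal.ofReal_ne_top
  have hsphere : μV (sphere 0 ρ) = 0 := hac (Measure.addHaar_sphere _ _ _)
  have hatom : ∀ x, μV {x} = 0 := fun x => hac (measure_singleton x)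
  have huf : ∀ x, u x ≠ ⊤ := fun x => ENNReal.ofReal_ne_top
  have hle : ∀ x ∈ closedBall (0 : ℂ) ρ, fieldPotential (logk (2 * ρ)) u μV x ≤ _ := fun x hx =>
    fieldPotential_eq_const hum huc huf hp hfin hmin hsphere hatom hsupp.ge hx
  have hc := lintegral_fieldPotential_ne_top hum hfin
  have hG : ∀ x ∈ ball (0 : ℂ) ρ, fieldPotential (logk (2 * ρ)) u μV x = _ := fun x hx =>
    le_antisymm (hle x (ball_subset_closedBall hx)) (const_le_fieldPotential_of_mem_ball hum
      (fun x _ => huc.continuousAt) huf hp hfin hmin hx)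
  have hμb : μV (ball 0 ρ)ᶜ = 0 := by
    refine measure_mono_null (t := (closedBall 0 ρ)ᶜ ∪ sphere 0 ρ) (fun z hz => ?_)
      (measure_union_null hμS hsphere)
    rw [← ball_union_sphere]
    by_cases h : z ∈ sphere (0 : ℂ) ρ
    · exact Or.inr h
    · exact Or.inl fun h' => h'.elim hz h
  obtain ⟨L, hL⟩ := LocallyLipschitzOn.exists_lipschitzOnWith_of_compact
    (isCompact_closedBall (0 : ℂ) ρ) hgL.locallyLipschitzOn
  obtain ⟨C, hC⟩ := exists_le_smul_volume hg hL hgb hac hμS hμb hc hG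
  -- The upper bound holds everywhere on the closed disk, the lower bound on the circle only almost
  -- everywhere for measures of finite energy.
  refine ⟨b, _, C, hgb, hc, hp, hC, hG, fun τ _ hτ hE => ?_⟩
  have hτS : ∀ᵐ x ∂τ, x ∈ closedBall (0 : ℂ) ρ := mem_ae_iff.2 hτ
  filter_upwards [ae_const_le_fieldPotential hum hp hfin hmin hτ hE, hτS] with x hx hxS
  exact le_antisymm (hle x hxS) hx

end Main

end LogPotential

theorem proposition3p4
    (ρ α t : ℝ) (hρ : 0 < ρ) (hα : 0 < α) (ht : 0 < t)
    -- the potential `V`, with equilibrium measure `μV`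
    (V : ℂ → EReal) (hVbot : ∀ z, V z ≠ ⊥) (hVlsc : LowerSemicontinuous V)
    (hVgrowth : LogPotential.HasGrowth V)
    (hVC11 : LogPotential.IsC11On V (closedBall 0 ρ))
    (μV : Measure ℂ) (hμV : LogPotential.IsEquilibriumMeasure V μV)
    (hsupp : μV.support = closedBall 0 ρ)
    (hlap : ∀ᵐ z ∂(volume.restrict (ball (0 : ℂ) ρ)),
      α ≤ 1 / (4 * Real.pi) * Laplacian.laplacian (fun w : ℂ => (V w).toReal) z)
    (hac : μV ≪ volume)
    -- the perturbation
    (ν : Measure ℂ) [IsFiniteMeasure ν]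
    (hνlog : Integrable (fun w : ℂ => Real.log (1 + ‖w‖)) ν)
    (hνsupp : ν.support ∩ ball 0 ρ = ∅)
    (R : ℂ → ℝ) (hRcont : ContinuousOn R (closedBall 0 ρ))
    (hRharm : InnerProductSpace.HarmonicOnNhd R (ball 0 ρ))
    (hRderiv : ∀ z ∈ sphere (0 : ℂ) ρ, ∃ d : ℝ, LogPotential.HasInnerNormalDeriv R d z)
    (μW : Measure ℂ)
    (hμW : LogPotential.IsEquilibriumMeasure (LogPotential.perturbed ρ t V ν R) μW) :
    ∃ μ η : Measure ℂ, μW = μ + η ∧ μ ≪ μV ∧ η ≪ LogPotential.arclength ρ ∧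
      ENNReal.ofReal ρ *
          essSup (η.rnDeriv (LogPotential.arclength ρ)) (LogPotential.arclength ρ) ≤
        ENNReal.ofReal (1 / (2 * Real.pi)) *
          (η Set.univ + ν Set.univ +
            2 * ENNReal.ofReal ρ *
              eLpNorm (LogPotential.innerNormalDeriv R) ⊤ (LogPotential.arclength ρ) +
            ENNReal.ofReal |1 - t| * ENNReal.ofReal ρ *
              eLpNorm (LogPotential.innerNormalDeriv (fun w => (V w).toReal)) ⊤
                (LogPotential.arclength ρ)) := by
  open LogPotential in
  obtain ⟨g, hg, hgL, hV⟩ := hVC11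
  obtain ⟨b, c, C, hgb, hc, hp, hC, hG, hGae⟩ :=
    exists_const_of_isEquilibriumMeasure hρ hg hgL hV hμV hsupp hac
  have := hp.1
  have hgc := hg.continuous
  have hν : ν (ball 0 ρ) = 0 := by
    refine measure_mono_null (t := ν.supportᶜ) (fun z hz (hzs : z ∈ ν.support) => ?_)
      Measure.measure_compl_support
    have hmem : z ∈ ν.support ∩ ball 0 ρ := ⟨hzs, hz⟩
    rw [hνsupp] at hmem
    exact hmem
  have hfc : ContinuousOn (fun z => t * g z + 2 * R z) (closedBall 0 ρ) := by fun_prop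
  obtain ⟨b₁, huR0, hb₁⟩ := exists_nonneg_add_of_continuousOn hfc
    (Real.log (2 * ρ) + 2 * ∫ w, Real.log (1 + ρ + ‖w‖) ∂ν)
  -- `R` is controlled only on the closed disk; cutting off outside makes the field measurable on
  -- the plane.
  obtain ⟨uR, huR, huReq⟩ : ∃ uR : ℂ → ℝ≥0∞, Measurable uR ∧
      ∀ z ∈ closedBall (0 : ℂ) ρ, uR z = ENNReal.ofReal (t * g z + 2 * R z + b₁) := by
    classical
    refine ⟨fun z => ENNReal.ofReal ((closedBall (0 : ℂ) ρ).piecewise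
      (fun z => t * g z + 2 * R z + b₁) 0 z), ?_, fun z hz => ?_⟩
    · refine (ContinuousOn.measurable_piecewise (hfc.add continuousOn_const)
        continuousOn_const measurableSet_closedBall).ennreal_ofReal
    · simp only [Set.piecewise_eq_of_mem _ _ _ hz]
  set u := fun z => uR z + 2 * normalizedPotential ρ ν z with hu
  have hN : Measurable (normalizedPotential ρ ν) := measurable_normalizedPotential
  have hum : Measurable u := huR.add (hN.const_mul 2)
  have hUu : ∀ z ∈ closedBall (0 : ℂ) ρ, perturbed ρ t V ν R z = (u z : EReal) -
      ((b₁ + 2 * ∫ w, Real.log (1 + ρ + ‖w‖) ∂ν : ℝ) : EReal) := by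
    intro z hz
    rw [perturbed_eq hρ hνlog hV huR0 hz, hu]
    simp only [huReq z hz]
  have hfs := finitenessSet_perturbed hρ hνlog hν hV huR0
  have hWS : μW (closedBall 0 ρ)ᶜ = 0 := by
    rw [← hfs]
    exact hμW.1.2
  have hpW : IsProbabilityOn (closedBall 0 ρ) μW := ⟨hμW.1.1, hWS⟩
  have := hpW.1
  have hmin := isMin_fieldEnergy hρ hum hUu (by linarith) hfs.ge hμW hWS
  -- The test circle has radius `ρ / 2` because the potential of `ν` may be infinite on the boundary
  -- circle.
  have hfin : fieldEnergy (logk (2 * ρ)) u μW ≠ ⊤ := by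
    have hsph : sphere (0 : ℂ) (ρ / 2) ⊆ closedBall 0 ρ := fun z hz => by
      rw [mem_sphere_zero_iff_norm] at hz
      rw [mem_closedBall_zero_iff]
      linarith
    have hm : Measurable (circleMap 0 (ρ / 2)) := (continuous_circleMap 0 (ρ / 2)).measurable
    have hNm : Measurable fun θ => 2 * normalizedPotential ρ ν (circleMap 0 (ρ / 2) θ) :=
      (hN.comp hm).const_mul 2
    have hNm' : Measurable fun θ => normalizedPotential ρ ν (circleMap 0 (ρ / 2) θ) := hN.comp hm
    refine fieldEnergy_ne_top_of_isMin (x := 0) (r := ρ / 2) hum (by positivity)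
      (by simp; linarith) hmin ?_
    simp only [hu]
    rw [lintegral_add_right _ hNm, lintegral_const_mul _ hNm',
      ← normalizedPotential_eq_circle (by positivity) hν (by simp; linarith),
      lintegral_congr fun θ => huReq _ (hsph (circleMap_mem_sphere 0 (by positivity) θ)),
      lintegral_circleProb_ofReal (f := fun z => t * g z + 2 * R z + b₁) (by positivity)
        ((hfc.add continuousOn_const).mono hsph) (fun z hz => huR0 z (hsph hz))]
    have := normalizedPotential_ne_top (ν := ν) (x := 0) hρ hν (by simpa using hρ)
    finiteness
  set μ := μW.restrict (ball 0 ρ) with hμ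
  set η := μW.restrict (sphere 0 ρ) with hη
  have hsum : μW = μ + η := by
    rw [hμ, hη, ← Measure.restrict_union (by
      rw [Set.disjoint_left]
      intro z hz hz'
      rw [mem_ball] at hz
      exact hz.ne hz') isClosed_sphere.measurableSet, ball_union_sphere]
    exact (Measure.restrict_eq_self_of_ae_mem (mem_ae_iff.2 hWS)).symm
  have hμle : μ ≤ ENNReal.ofReal t • μV := restrict_ball_le_smul hρ ht hgc hgb hp
    (fun x => hac (measure_singleton x)) hc hG hν hRcont hRharm huR huReq huR0 hpW hfin hmin
  have : IsFiniteMeasure (ENNReal.ofReal t • μV) := Measure.smul_finite μV ENNReal.ofReal_ne_top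
  -- The mass missing from `t μV` is a positive measure of bounded density.
  obtain ⟨κ, hκ⟩ : ∃ κ, μ + κ = ENNReal.ofReal t • μV :=
    ⟨ENNReal.ofReal t • μV - μ, by rw [add_comm]; exact Measure.sub_add_cancel_of_le hμle⟩
  have hκle : κ ≤ ENNReal.ofReal t • μV := by
    rw [← hκ]
    exact Measure.le_add_left le_rfl
  have : IsFiniteMeasure κ := isFiniteMeasure_of_le _ hκle
  have hκC : κ ≤ (Real.toNNReal t * C) • volume := by
    refine hκle.trans ?_
    rw [mul_smul]
    change Real.toNNReal t • μV ≤ _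
    gcongr
  have hκb : κ (ball 0 ρ)ᶜ = 0 := by
    refine measure_mono_null (t := (closedBall 0 ρ)ᶜ ∪ sphere 0 ρ) (fun z hz => ?_)
      (measure_union_null (le_antisymm ((hκle _).trans (by simp [hp.2])) zero_le) ?_)
    · rw [← ball_union_sphere]
      by_cases h : z ∈ sphere (0 : ℂ) ρ
      · exact Or.inr h
      · exact Or.inl fun h' => h'.elim hz h
    · exact le_antisymm ((hκle _).trans
        (by simp [hac (Measure.addHaar_sphere volume (0 : ℂ) ρ)])) zero_le
  have hηS : η (sphere 0 ρ)ᶜ = 0 := by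
    rw [hη, Measure.restrict_apply isClosed_sphere.measurableSet.compl]
    simp
  have hηW : η ≤ μW := Measure.restrict_le_self
  have hEη : mutualEnergy (logk (2 * ρ)) η η ≠ ⊤ :=
    ne_top_of_le_ne_top hfin ((mutualEnergy_mono hηW hηW).trans le_self_add)
  -- `η` inherits finite energy from `μW`, so the Euler-Lagrange equation for `V` is available at
  -- `η`-almost every boundary point.
  have hGη := hGae η inferInstance (measure_mono_null
    (Set.compl_subset_compl.2 sphere_subset_closedBall) hηS) hEη
  -- The shift by `2` keeps every dilation factor `1 - 1 / (n + 2)` strictly between zero and one.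
  have hl0 : ∀ n : ℕ, (0 : ℝ) < 1 / ((n : ℝ) + 2) := fun n => by positivity
  have hl1 : ∀ n : ℕ, 1 / ((n : ℝ) + 2) < 1 := fun n => by
    rw [div_lt_one (by positivity)]
    linarith [(Nat.cast_nonneg n : (0 : ℝ) ≤ n)]
  have hl : Tendsto (fun n : ℕ => 1 / ((n : ℝ) + 2)) atTop (𝓝 0) := by
    have h1 : Tendsto (fun n : ℕ => (n : ℝ) + 2) atTop atTop :=
      tendsto_atTop_add_const_right _ _ tendsto_natCast_atTop_atTop
    exact h1.inv_tendsto_atTop.congr fun n => by simp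
  have hdil : ∀ᵐ x ∂η, ∀ n : ℕ, x ∈ closedBall (0 : ℂ) ρ →
      fieldPotential (logk (2 * ρ)) u μW x ≤
        fieldPotential (logk (2 * ρ)) u μW (((1 - 1 / ((n : ℝ) + 2) : ℝ) : ℂ) * x) :=
    ae_mono hηW (ae_all_iff.2 fun n => ae_fieldPotential_le_smul hum hpW hfin hmin
      (by linarith [hl1 n]) (by linarith [hl0 n]) hρ)
  have hGW : ∀ᵐ x ∂η, fieldPotential (logk (2 * ρ)) u μW x < ⊤ :=
    ae_mono hηW (ae_lt_top (measurable_fieldPotential (measurable_uncurry_logk _) hum μW)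
      (lintegral_fieldPotential_ne_top hum hfin))
  have hPη : ∀ᵐ x ∂η, ∫⁻ y, logk (2 * ρ) x y ∂η < ⊤ :=
    ae_lt_top (measurable_potential_logk _ η) hEη
  have hηmem : ∀ᵐ x ∂η, x ∈ sphere (0 : ℂ) ρ := mem_ae_iff.2 hηS
  have hdens : ∀ᵐ z ∂η, HasDensityBound ρ (η.real Set.univ + ν.real Set.univ)
      (innerNormalDeriv R) η z := by
    filter_upwards [hdil, hGW, hPη, hηmem, hGη] with z hz hzW hzη hzS hzG
    have hzn : ‖z‖ = ρ := mem_sphere_zero_iff_norm.1 hzS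
    have hder : HasInnerNormalDeriv R (innerNormalDeriv R z) z := by
      have hex := hRderiv z hzS
      rw [innerNormalDeriv, dif_pos hex]
      exact hex.choose_spec
    intro m r₀ hm hr₀ hmr
    refine density_le_of_radial_le hρ hzn (by positivity) hm
      (measure_singleton_eq_zero_of_potential_ne_top hzη.ne) hder hr₀ hmr hl0 hl1 hl
      (C := Real.toNNReal t * C) fun n J I hJ0 hI0 hJ hI => ?_
    have hn0 : 0 < 1 - 1 / ((n : ℝ) + 2) := by linarith [hl1 n]
    have hn1 : 1 - 1 / ((n : ℝ) + 2) < 1 := by linarith [hl0 n]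
    exact lintegral_log_le_of_fieldPotential_le hρ ht hn0 hn1 hzn hgb hc huReq huR0 hν hηS hsum
      hκ hκC hκb hzG (hG _ (smul_mem_ball hρ hn0 hn1 hzn.le)) hzW.ne
      (hz n (sphere_subset_closedBall hzS)) hJ0 hI0 hJ hI
  refine ⟨μ, η, hsum, ?_, absolutelyContinuous_arclength hρ hηS hdens, ?_⟩
  · exact (Measure.absolutelyContinuous_of_le hμle).trans Measure.smul_absolutelyContinuous
  · refine (essSup_rnDeriv_arclength_le hρ hdens).trans ?_
    -- The term in `|1 - t|` is nonnegative and only weakens the bound already obtained.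
    exact mul_le_mul_right le_self_add _
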